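/- Let $k$ be a field, let $K$ be a finite extension of the rational function field $k(q)$, let $\mathcal O_K$ be the integral closure of $k[q]$ in $K$, let $0\neq P\in\mathcal O_K[x]$ and $$\mathcal A=\mathcal O_K\Big[x,\tfrac1{P(x)},\tfrac1{P(qx)},\tfrac1{P(q^2x)},\dots\Big]\subset K(x),$$ with $\sigma_q f(x)=f(qx)$, $\delta_q=\frac{\sigma_q-1}{q-1}$ and $\partial=x\frac{d}{dx}$. For a maximal ideal $v$ of $\mathcal O_K$ with $q\notin v$ and $P\not\equiv 0 \bmod v$ put $k_v=\mathcal O_K/v$, $q_v=q\bmod v$, and $\mathcal A_v=\mathcal A\otimes_{\mathcal O_K}k_v$, whose fraction field is $k_v(x)$; it carries the induced operators $\sigma_{q_v}$, $\delta_{q_v}$ (equal to $x\frac{d}{dx}$ if $q_v=1$) and $\partial$. Let $B$ be one of the rings $\mathcal A$, $\mathcal A_v$, $K(x)$, $k_v(x)$. A *$q$-difference module* over $B$ is a finitely generated projective $B$-module $M$ with a $\sigma$-semilinear operator $\Sigma$ which is invertible in the sense that its linearization $B\otimes_{\sigma,B}M\to M$ is an isomorphism. A *module with connection* over $(B,\delta)$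 is a finitely generated projective $B$-module $M$ with an additive operator $\Delta$ such that $\Delta(bm)=\delta(b)m+\sigma(b)\Delta(m)$ and such that the $\sigma$-semilinear operator $\Sigma=1+(q-1)\Delta$ (with $q_v$ in place of $q$ over $\mathcal A_v$ and $k_v(x)$) is invertible in the same sense; for $q_v=1$ this is a differential module. Morphisms are the $B$-linear maps that commute with $\Sigma$ (resp. $\Delta$). The prolongation $F_\partial(M)=B[\partial]_{\le 1}\otimes_B M$ consists of the elements $m_0+\partial(m_1)$, with $b\,\partial(m)=\partial(bm)-\partial(b)m$, and $\Sigma$ (resp. $\Delta$) acts by $\partial^i(m)\mapsto\partial^i(\Sigma m)$ (resp. $\partial^i(\Delta m)$). In either category let $\langle M\rangle^{\otimes}$ (resp. $\langle M\rangle^{\otimes,\partial}$) be the smallest full subcategory that contains $M$ and the unit object and is stable under direct sums, tensor products, duals, subobjects and quotients (resp. and under $F_\partial$). The generic Galois group $Gal(M,\eta_B)$ is the group functor that maps a $B$-algebra $R$ to the group of tensor automorphisms of the functor $N\mapsto R\otimes_B N$ on $\langle M\rangle^{\otimes}$. The parameterized generic Galois group $Gal^\partial(M,\eta_B)$ is the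 group functor that maps a differential $B$-algebra $(R,\partial)$ to the group of those tensor automorphisms $g$ of $N\mapsto R\otimes_B N$ on $\langle M\rangle^{\otimes,\partial}$ for which $g_{F_\partial(N)}=F_\partial(g_N)$ for all $N$. The base change of such a functor to a (differential) $B$-algebra $F$ is its restriction to (differential) $F$-algebras. Let $M$ be a $q$-difference module over $\mathcal A$ and let $v$ be as above with $q_v\neq1$; or let $M$ be a module with connection over $(\mathcal A,\delta_q)$ and let $v$ be any place as above, $q_v=1$ allowed. Let $M_{K(x)}$, $M\otimes_{\mathcal A}\mathcal A_v$ and $M_{k_v(x)}=(M\otimes_{\mathcal A}\mathcal A_v)\otimes_{\mathcal A_v}k_v(x)$ be the modules obtained by base change. Then there are isomorphisms of group functors 1. $Gal(M,\eta_{\mathcal A})\otimes K(x)\simeq Gal(M_{K(x)},\eta_{K(x)})$, 2. $Gal^{\partial}(M,\eta_{\mathcal A})\otimes K(x)\simeq Gal^{\partial}(M_{K(x)},\eta_{K(x)})$, 3. $Gal(M\otimes_{\mathcal A}\mathcal A_v,\eta_{\mathcal A_v})\otimes k_v(x)\simeq Gal(M_{k_v(x)},\eta_{k_v(x)})$, 4.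 $Gal^{\partial}(M\otimes_{\mathcal A}\mathcal A_v,\eta_{\mathcal A_v})\otimes k_v(x)\simeq Gal^{\partial}(M_{k_v(x)},\eta_{k_v(x)})$, compatible with the actions on $M_{K(x)}$ and on $M_{k_v(x)}$, respectively. -/

import Mathlib

open Polynomial TensorProduct

universe u v w

namespace QDiff

noncomputable section

/-! ### Generalized differential rings of rank one -/

/-- A commutative ring `B` with a generalized differential `b ↦ dx · δ b` with values in the
bimodule `Ω¹ = dx · B`, where `b · dx = dx · σ b` and `σ = 1 + h δ`, together with a derivation
`∂` that commutes with everything.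

* `h = 1`, `δ = σ - 1`: a difference ring `(B, σ)`;
* `h = q - 1`, `δ = (σ_q - 1) / (q - 1)`: the ring `(B, δ_q)`;
* `h = 0`, `σ = 1`: the differential ring `(B, δ)`. -/
structure GenDiffRing (B : Type u) [CommRing B] where
  sig : B →+* B
  del : B →+ B
  h : B
  der : Derivation ℤ B B
  sig_eq : ∀ b, sig b = b + h * del b
  del_mul : ∀ a b, del (a * b) = del a * b + sig a * del b
  der_sig : ∀ b, der (sig b) = sig (der b)
  der_del : ∀ b, der (del b) = del (der b)
  der_h : der h = 0

namespace GenDiffRing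

variable {B : Type u} [CommRing B]

theorem del_one (D : GenDiffRing B) : D.del 1 = 0 := by
  have := D.del_mul 1 1
  simpa using this

/-- The difference ring `(B, σ)`: `h = 1` and `δ = σ - 1`. -/
def ofSig (sig : B →+* B) (der : Derivation ℤ B B) (comm : ∀ b, der (sig b) = sig (der b)) :
    GenDiffRing B where
  sig := sig
  del := sig.toAddMonoidHom - AddMonoidHom.id B
  h := 1
  der := der
  sig_eq b := by simp
  del_mul a b := by simp; ring
  der_sig := comm
  der_del b := by simp [comm]
  der_h := by simp

/-- The structure map `B → F` is a morphism of generalized differential rings that is compatible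
with the derivations `∂`. -/
structure IsMor {F : Type v} [CommRing F] [Algebra B F] (D : GenDiffRing B) (E : GenDiffRing F) :
    Prop where
  sig : ∀ b, algebraMap B F (D.sig b) = E.sig (algebraMap B F b)
  del : ∀ b, algebraMap B F (D.del b) = E.del (algebraMap B F b)
  h : algebraMap B F D.h = E.h
  der : ∀ b, algebraMap B F (D.der b) = E.der (algebraMap B F b)

end GenDiffRing

/-! ### The prolongation of a module -/

/-- `F_∂(V) = B[∂]_{≤ 1} ⊗ V`. The pair `(v₀, v₁)` stands for `v₀ + ∂(v₁)`, and the left module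
structure is given by the rule `b ∂(v) = ∂(b v) - ∂(b) v`. -/
def Prol {B : Type u} [CommRing B] (_d : Derivation ℤ B B) (V : Type v) : Type v := V × V

namespace Prol

variable {B : Type u} [CommRing B] (d : Derivation ℤ B B)
variable (V : Type v) [AddCommGroup V] [Module B V]
variable {W : Type w} [AddCommGroup W] [Module B W]

instance : AddCommGroup (Prol d V) := inferInstanceAs (AddCommGroup (V × V))

instance : Module B (Prol d V) where
  smul b x := (b • x.1 - d b • x.2, b • x.2)
  one_smul x := by
    change ((1 : B) • x.1 - d 1 • x.2, (1 : B) • x.2) = x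
    simp only [one_smul, Derivation.map_one_eq_zero, zero_smul, sub_zero]
    rfl
  mul_smul a b x := by
    change ((a * b) • x.1 - d (a * b) • x.2, (a * b) • x.2) =
      (a • (b • x.1 - d b • x.2) - d a • b • x.2, a • b • x.2)
    refine Prod.ext ?_ (mul_smul _ _ _)
    simp only [Derivation.leibniz, smul_sub, add_smul, mul_smul, smul_eq_mul]
    rw [smul_comm b (d a)]
    abel
  smul_zero a := by
    change (a • (0 : V) - d a • (0 : V), a • (0 : V)) = (0, 0)
    simp
  smul_add a x y := by
    change (a • (x.1 + y.1) - d a • (x.2 + y.2), a • (x.2 + y.2)) =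
      (a • x.1 - d a • x.2 + (a • y.1 - d a • y.2), a • x.2 + a • y.2)
    refine Prod.ext ?_ (smul_add _ _ _)
    simp only [smul_add]; abel
  add_smul a b x := by
    change ((a + b) • x.1 - d (a + b) • x.2, (a + b) • x.2) =
      (a • x.1 - d a • x.2 + (b • x.1 - d b • x.2), a • x.2 + b • x.2)
    refine Prod.ext ?_ (add_smul _ _ _)
    simp only [map_add, add_smul]; abel
  zero_smul x := by
    change ((0 : B) • x.1 - d 0 • x.2, (0 : B) • x.2) = (0, 0)
    simp

variable {V}

theorem smul_def (b : B) (x : Prol d V) :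
    b • x = ((b • x.1 - d b • x.2, b • x.2) : V × V) := rfl

/-- `F_∂(f)` for a linear map `f`. -/
def map (f : V →ₗ[B] W) : Prol d V →ₗ[B] Prol d W where
  toFun x := ((f x.1, f x.2) : W × W)
  map_add' x y := Prod.ext (map_add f x.1 y.1) (map_add f x.2 y.2)
  map_smul' b x := by
    change ((f (b • x.1 - d b • x.2), f (b • x.2)) : W × W) =
      (b • f x.1 - d b • f x.2, b • f x.2)
    simp

/-- The canonical map `R ⊗ F_∂(V) → F_∂(R ⊗ V)`, `r ⊗ ∂^k(v) ↦ r ∂^k(1 ⊗ v)`, for a differential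
`B`-algebra `R`. -/
def comparison {R : Type w} [CommRing R] [Algebra B R] (dR : Derivation ℤ R R)
    (hd : ∀ b, dR (algebraMap B R b) = algebraMap B R (d b)) :
    R ⊗[B] Prol d V →ₗ[R] Prol dR (R ⊗[B] V) :=
  letI : Module B (Prol dR (R ⊗[B] V)) := Module.compHom _ (algebraMap B R)
  haveI : IsScalarTower B R (Prol dR (R ⊗[B] V)) :=
    ⟨fun b r x => by rw [Algebra.smul_def, mul_smul]; rfl⟩
  LinearMap.liftBaseChange R
    { toFun := fun x => ((1 ⊗ₜ x.1, 1 ⊗ₜ x.2) : (R ⊗[B] V) × (R ⊗[B] V))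
      map_add' := fun x y =>
        Prod.ext (TensorProduct.tmul_add _ x.1 y.1) (TensorProduct.tmul_add _ x.2 y.2)
      map_smul' := fun b x => by
        change (((1 : R) ⊗ₜ[B] (b • x.1 - d b • x.2), (1 : R) ⊗ₜ[B] (b • x.2)) :
            (R ⊗[B] V) × (R ⊗[B] V)) =
          (algebraMap B R b • ((1 : R) ⊗ₜ[B] x.1) - dR (algebraMap B R b) • ((1 : R) ⊗ₜ[B] x.2),
            algebraMap B R b • ((1 : R) ⊗ₜ[B] x.2))
        rw [hd]
        simp only [TensorProduct.tmul_sub, TensorProduct.tmul_smul, algebraMap_smul] }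

variable (V)

/-- The projection `v₀ + ∂(v₁) ↦ v₁`. -/
def snd : Prol d V →ₗ[B] V where
  toFun x := x.2
  map_add' _ _ := rfl
  map_smul' _ _ := rfl

/-- The inclusion `v ↦ v`. -/
def inl : V →ₗ[B] Prol d V where
  toFun x := ((x, 0) : V × V)
  map_add' x y := Prod.ext rfl (by change (0 : V) = 0 + 0; simp)
  map_smul' b x := by
    change ((b • x, 0) : V × V) = (b • x - d b • (0 : V), b • (0 : V))
    simp

theorem exists_equiv [Module.Projective B V] : Nonempty (Prol d V ≃ₗ[B] V × V) := by
  obtain ⟨s, hs⟩ := Module.projective_lifting_property (Prol.snd d V) LinearMap.id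
    (fun v => ⟨((0, v) : V × V), rfl⟩)
  have hs' : ∀ v, (s v).2 = v := fun v => LinearMap.congr_fun hs v
  refine ⟨LinearEquiv.symm (LinearEquiv.ofBijective ((Prol.inl d V).coprod s) ⟨?_, ?_⟩)⟩
  · rw [← LinearMap.ker_eq_bot, LinearMap.ker_eq_bot']
    rintro ⟨a, b⟩ hab
    have h2 : (0 : V) + (s b).2 = 0 := congrArg Prod.snd hab
    have hb : b = 0 := by simpa [hs'] using h2
    subst hb
    have h1 : a + (s 0).1 = 0 := congrArg Prod.fst hab
    rw [map_zero] at h1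
    have h1' : a + (0 : V) = 0 := h1
    simpa using h1'
  · intro x
    refine ⟨(x.1 - (s x.2).1, x.2), ?_⟩
    refine Prod.ext ?_ ?_
    · change x.1 - (s x.2).1 + (s x.2).1 = x.1
      simp
    · change (0 : V) + (s x.2).2 = x.2
      simp [hs']

instance [Module.Projective B V] : Module.Projective B (Prol d V) :=
  Module.Projective.of_equiv (exists_equiv d V).some.symm

instance [Module.Projective B V] [Module.Finite B V] : Module.Finite B (Prol d V) :=
  Module.Finite.equiv (exists_equiv d V).some.symm

end Prol

/-! ### Modules with connection -/

/-- An object of `Diff_B`: a finitely generated projective `B`-module with a connection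
`m ↦ dx · Δ m`, such that the `σ`-semilinear operator `Σ = 1 + h Δ` is invertible, in the sense
that `Σ(N)` generates `N` (over a domain this says that the linearization `B ⊗_{σ, B} N → N` of
`Σ` is an isomorphism; if `N` is free, that the matrix of `Σ` in a basis is invertible). -/
structure Obj {B : Type u} [CommRing B] (D : GenDiffRing B) where
  carrier : Type u
  [addCommGroup : AddCommGroup carrier]
  [module : Module B carrier]
  [finite : Module.Finite B carrier]
  [projective : Module.Projective B carrier]
  del : carrier →+ carrier
  leibniz : ∀ (b : B) (n : carrier), del (b • n) = D.del b • n + D.sig b • del n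
  span_eq_top : Submodule.span B (Set.range fun n => n + D.h • del n) = ⊤

attribute [instance] Obj.addCommGroup Obj.module Obj.finite Obj.projective

namespace Obj

variable {B : Type u} [CommRing B] {D : GenDiffRing B}

instance : CoeSort (Obj D) (Type u) := ⟨Obj.carrier⟩

/-- The operator `Σ = 1 + h Δ`. -/
def sig (N : Obj D) : N →+ N where
  toFun n := n + D.h • N.del n
  map_zero' := by simp
  map_add' x y := by simp only [map_add, smul_add]; abel

theorem sig_apply (N : Obj D) (n : N) : N.sig n = n + D.h • N.del n := rfl

theorem sig_smul (N : Obj D) (b : B) (n : N) : N.sig (b • n) = D.sig b • N.sig n := by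
  simp only [sig_apply, N.leibniz, D.sig_eq, smul_add, add_smul, mul_smul]
  rw [smul_comm b D.h, smul_comm (D.del b) D.h, add_assoc]

/-- Morphisms of `Diff_B`: the linear maps that commute with the connections. -/
def IsHom (N N' : Obj D) (f : N →ₗ[B] N') : Prop := ∀ n, f (N.del n) = N'.del (f n)

variable (D) in
/-- The unit object. -/
def unit : Obj D where
  carrier := B
  del := D.del
  leibniz := D.del_mul
  span_eq_top := by
    refine (Ideal.eq_top_iff_one _).2 (Submodule.subset_span ⟨1, ?_⟩)
    simp [D.del_one]

/-- Direct sum. -/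
def prod (N N' : Obj D) : Obj D where
  carrier := N × N'
  del := N.del.prodMap N'.del
  leibniz b n := by ext <;> simp [leibniz]
  span_eq_top := by
    rw [eq_top_iff]
    have h1 : (⊤ : Submodule B N) ≤ Submodule.comap (LinearMap.inl B N N')
        (Submodule.span B (Set.range fun n : N × N' =>
          n + D.h • (N.del.prodMap N'.del) n)) := by
      rw [← N.span_eq_top, Submodule.span_le]
      rintro _ ⟨n, rfl⟩
      exact Submodule.subset_span ⟨(n, 0), by ext <;> simp⟩
    have h2 : (⊤ : Submodule B N') ≤ Submodule.comap (LinearMap.inr B N N')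
        (Submodule.span B (Set.range fun n : N × N' =>
          n + D.h • (N.del.prodMap N'.del) n)) := by
      rw [← N'.span_eq_top, Submodule.span_le]
      rintro _ ⟨n, rfl⟩
      exact Submodule.subset_span ⟨(0, n), by ext <;> simp⟩
    rintro ⟨a, b⟩ -
    have ha := h1 (Submodule.mem_top (x := a))
    have hb := h2 (Submodule.mem_top (x := b))
    rw [Submodule.mem_comap] at ha hb
    simpa using Submodule.add_mem _ ha hb

/-- `Δ(n ⊗ n') = Δ n ⊗ n' + Σ n ⊗ Δ n'` on a tensor product. -/
def tensorDel (N N' : Obj D) : N ⊗[B] N' →+ N ⊗[B] N' :=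
  TensorProduct.liftAddHom (R := B)
    (AddMonoidHom.mk' (fun n => AddMonoidHom.mk' (fun n' => N.del n ⊗ₜ[B] n' + N.sig n ⊗ₜ[B] N'.del n')
      (fun x y => by rw [map_add, TensorProduct.tmul_add, TensorProduct.tmul_add]; abel))
      (fun x y => by
        ext n'
        simp only [map_add, TensorProduct.add_tmul, AddMonoidHom.mk'_apply,
          AddMonoidHom.add_apply]
        abel))
    (fun b n n' => by
      simp only [AddMonoidHom.mk'_apply, N.leibniz, N'.leibniz, N.sig_smul,
        TensorProduct.tmul_add, TensorProduct.add_tmul, TensorProduct.tmul_smul]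
      simp only [sig_apply, ← TensorProduct.smul_tmul', TensorProduct.add_tmul, smul_add,
        smul_smul, D.sig_eq, add_smul]
      rw [mul_comm (D.del b) D.h]
      abel)

@[simp] theorem tensorDel_tmul (N N' : Obj D) (n : N) (n' : N') :
    tensorDel N N' (n ⊗ₜ n') = N.del n ⊗ₜ n' + N.sig n ⊗ₜ N'.del n' := rfl

theorem tensor_sig_aux (N N' : Obj D) (n : N) (n' : N') :
    n ⊗ₜ[B] n' + D.h • tensorDel N N' (n ⊗ₜ n') = N.sig n ⊗ₜ N'.sig n' := by
  simp only [tensorDel_tmul, sig_apply, TensorProduct.add_tmul, TensorProduct.tmul_add, smul_add,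
    TensorProduct.tmul_smul, ← TensorProduct.smul_tmul']
  abel

/-- Tensor product. -/
def tensor (N N' : Obj D) : Obj D where
  carrier := N ⊗[B] N'
  del := tensorDel N N'
  leibniz b t := by
    induction t using TensorProduct.induction_on with
    | zero => simp
    | tmul n n' =>
      rw [TensorProduct.smul_tmul', tensorDel_tmul, tensorDel_tmul, N.leibniz, N.sig_smul]
      simp only [TensorProduct.add_tmul, ← TensorProduct.smul_tmul', smul_add]
      abel
    | add x y hx hy => simp only [smul_add, map_add, hx, hy]; abel
  span_eq_top := by
    rw [eq_top_iff, ← TensorProduct.span_tmul_eq_top, Submodule.span_le]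
    rintro _ ⟨n, n', rfl⟩
    have hn : n ∈ Submodule.span B (Set.range fun n => n + D.h • N.del n) := by
      rw [N.span_eq_top]; trivial
    have hn' : n' ∈ Submodule.span B (Set.range fun n => n + D.h • N'.del n) := by
      rw [N'.span_eq_top]; trivial
    have := Submodule.apply_mem_map₂ (TensorProduct.mk B N N') hn hn'
    rw [Submodule.map₂_span_span] at this
    refine Submodule.span_mono ?_ this
    rintro _ ⟨_, ⟨m, rfl⟩, _, ⟨m', rfl⟩, rfl⟩
    exact ⟨m ⊗ₜ m', tensor_sig_aux N N' m m'⟩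

/-- `N'` is a dual of `N`: there is a perfect pairing `N' × N → B` that induces a morphism
`N' ⊗ N → B` of modules with connection. -/
def IsDual (N N' : Obj D) : Prop :=
  ∃ p : N' →ₗ[B] N →ₗ[B] B, p.IsPerfPair ∧
    ∀ (f : N') (n : N), D.del (p f n) = p (N'.del f) n + p (N'.sig f) (N.del n)

/-- `Δ(∂^k(n)) = ∂^k(Δ n)` on `F_∂(N)`. -/
def prolDel (N : Obj D) : Prol D.der N →+ Prol D.der N := N.del.prodMap N.del

/-- The prolongation `F_∂(N)`. -/
def prol (N : Obj D) : Obj D where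
  carrier := Prol D.der N
  del := prolDel N
  leibniz b n := by
    refine Prod.ext ?_ (N.leibniz b n.2)
    change N.del (b • n.1 - D.der b • n.2) =
      (D.del b • n.1 - D.der (D.del b) • n.2) + (D.sig b • N.del n.1 - D.der (D.sig b) • N.del n.2)
    rw [map_sub, N.leibniz, N.leibniz, D.der_del, D.der_sig]
    abel
  span_eq_top := by
    have key : ∀ a c : N, ((N.sig a, N.sig c) : N × N) ∈ (Submodule.span B (Set.range
        fun n : Prol D.der N => n + D.h • prolDel N n) :
          Submodule B (Prol D.der N)) := by
      intro a c
      refine Submodule.subset_span ⟨((a, c) : N × N), ?_⟩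
      refine Prod.ext ?_ rfl
      change a + (D.h • N.del a - D.der D.h • N.del c) = a + D.h • N.del a
      simp [D.der_h]
    have h1 : (⊤ : Submodule B N) ≤ Submodule.comap (Prol.inl D.der N) (Submodule.span B (Set.range
        fun n : Prol D.der N => n + D.h • prolDel N n)) := by
      rw [← N.span_eq_top, Submodule.span_le]
      rintro _ ⟨n, rfl⟩
      have := key n 0
      rw [map_zero] at this
      exact this
    have h2 : (⊤ : Submodule B N) ≤ Submodule.map (Prol.snd D.der N) (Submodule.span B (Set.range
        fun n : Prol D.der N => n + D.h • prolDel N n)) := by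
      rw [← N.span_eq_top, Submodule.span_le]
      rintro _ ⟨n, rfl⟩
      exact ⟨_, key 0 n, rfl⟩
    rw [eq_top_iff]
    rintro x -
    obtain ⟨y, hy, hyx⟩ := h2 (Submodule.mem_top (x := x.2))
    have hxy : x = y + Prol.inl D.der N (x.1 - y.1) := by
      refine Prod.ext ?_ ?_
      · change x.1 = y.1 + (x.1 - y.1)
        abel
      · change x.2 = y.2 + 0
        rw [add_zero]; exact hyx.symm
    rw [hxy]
    exact Submodule.add_mem _ hy (h1 Submodule.mem_top)

/-! #### Base change -/

section BaseChange

variable {F : Type u} [CommRing F] [Algebra B F] {E : GenDiffRing F}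

/-- `Δ(c ⊗ n) = δ(c) ⊗ n + σ(c) ⊗ Δ n` on `F ⊗ N`. -/
def baseChangeDel (hDE : D.IsMor E) (N : Obj D) : F ⊗[B] N →+ F ⊗[B] N :=
  TensorProduct.liftAddHom
    (AddMonoidHom.mk' (fun c => AddMonoidHom.mk' (fun n => E.del c ⊗ₜ n + E.sig c ⊗ₜ N.del n)
      (fun x y => by simp only [map_add, TensorProduct.tmul_add]; abel))
      (fun x y => by
        ext n
        simp only [map_add, TensorProduct.add_tmul, AddMonoidHom.mk'_apply,
          AddMonoidHom.add_apply]
        abel))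
    (fun b c n => by
      simp only [AddMonoidHom.mk'_apply, N.leibniz, TensorProduct.tmul_add]
      rw [Algebra.smul_def, mul_comm, E.del_mul, map_mul, ← hDE.del, ← hDE.sig, mul_comm _ (algebraMap B F b),
        mul_comm _ (algebraMap B F (D.del b)), mul_comm _ (algebraMap B F (D.sig b))]
      simp only [← Algebra.smul_def, TensorProduct.add_tmul, TensorProduct.tmul_smul,
        TensorProduct.smul_tmul']
      abel)

@[simp] theorem baseChangeDel_tmul (hDE : D.IsMor E) (N : Obj D) (c : F) (n : N) :
    baseChangeDel hDE N (c ⊗ₜ n) = E.del c ⊗ₜ n + E.sig c ⊗ₜ N.del n := rfl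

/-- The module with connection `F ⊗_B N`. -/
def baseChange (hDE : D.IsMor E) (N : Obj D) : Obj E where
  carrier := F ⊗[B] N
  del := baseChangeDel hDE N
  leibniz c t := by
    induction t using TensorProduct.induction_on with
    | zero => simp
    | tmul a n =>
      rw [TensorProduct.smul_tmul', baseChangeDel_tmul, baseChangeDel_tmul, smul_eq_mul,
        E.del_mul, map_mul]
      simp only [TensorProduct.add_tmul, TensorProduct.smul_tmul', smul_add, smul_eq_mul]
      abel
    | add x y hx hy => simp only [smul_add, map_add, hx, hy]; abel
  span_eq_top := by
    have h1 : (⊤ : Submodule B N) ≤ Submodule.comap (TensorProduct.mk B F N 1)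
        ((Submodule.span F (Set.range fun t => t + E.h • baseChangeDel hDE N t)).restrictScalars
          B) := by
      rw [← N.span_eq_top, Submodule.span_le]
      rintro _ ⟨n, rfl⟩
      refine Submodule.subset_span ⟨1 ⊗ₜ n, ?_⟩
      simp only [baseChangeDel_tmul, E.del_one, map_one, TensorProduct.zero_tmul, zero_add,
        TensorProduct.mk_apply, TensorProduct.tmul_add, TensorProduct.tmul_smul, ← hDE.h,
        algebraMap_smul]
    rw [eq_top_iff]
    rintro t -
    induction t using TensorProduct.induction_on with
    | zero => exact Submodule.zero_mem _
    | tmul c n =>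
      have := Submodule.smul_mem
        (Submodule.span F (Set.range fun t => t + E.h • baseChangeDel hDE N t)) c
        (h1 (Submodule.mem_top (x := n)))
      simpa [TensorProduct.smul_tmul'] using this
    | add x y hx hy => exact Submodule.add_mem _ hx hy

end BaseChange

/-- A difference module `(M, Σ)` over a difference ring `(B, σ)`, as a module with connection. -/
def ofSemilinear (sig : B →+* B) (der : Derivation ℤ B B) (comm : ∀ b, der (sig b) = sig (der b))
    (M : Type u) [AddCommGroup M] [Module B M] [Module.Finite B M] [Module.Projective B M]
    (S : M →ₛₗ[sig] M) (hS : Submodule.span B (Set.range S) = ⊤) :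
    Obj (GenDiffRing.ofSig sig der comm) where
  carrier := M
  del := S.toAddMonoidHom - AddMonoidHom.id M
  leibniz b m := by
    change S (b • m) - b • m = (sig b - b) • m + sig b • (S m - m)
    rw [map_smulₛₗ, smul_sub, sub_smul]
    abel
  span_eq_top := by
    convert hS using 3
    ext m
    change m + (1 : B) • (S m - m) = S m
    simp

end Obj

/-! ### Generated tannakian subcategories -/

section Generated

variable {B : Type u} [CommRing B] {D : GenDiffRing B}

/-- `C` is (the class of objects of) a full subcategory of `Diff_B` that contains the unit object
and is stable under direct sums, tensor products, duals, subobjects and quotients. -/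
structure IsTannakian (C : Obj D → Prop) : Prop where
  unit : C (Obj.unit D)
  prod : ∀ N N', C N → C N' → C (N.prod N')
  tensor : ∀ N N', C N → C N' → C (N.tensor N')
  dual : ∀ N N', C N → N.IsDual N' → C N'
  sub : ∀ (N N' : Obj D) (f : N' →ₗ[B] N), C N → Obj.IsHom N' N f → Function.Injective f → C N'
  quot : ∀ (N N' : Obj D) (f : N →ₗ[B] N'), C N → Obj.IsHom N N' f → Function.Surjective f → C N'

/-- Moreover, `C` is stable under the prolongation functor. -/
structure IsDiffTannakian (C : Obj D → Prop) : Prop extends IsTannakian C where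
  prol : ∀ N, C N → C N.prol

/-- `⟨M⟩^⊗`. -/
def Gen (M N : Obj D) : Prop := ∀ C : Obj D → Prop, IsTannakian C → C M → C N

/-- `⟨M⟩^{⊗,∂}`. -/
def GenDiff (M N : Obj D) : Prop := ∀ C : Obj D → Prop, IsDiffTannakian C → C M → C N

theorem Gen.self (M : Obj D) : Gen M M := fun _ _ h => h

theorem GenDiff.self (M : Obj D) : GenDiff M M := fun _ _ h => h

/-! ### Galois groups -/

/-- `R ⊗ (N ⊗ N') = (R ⊗ N) ⊗_R (R ⊗ N')`. -/
def tensorComparison (N N' : Obj D) (R : Type w) [CommRing R] [Algebra B R] :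
    R ⊗[B] (N.tensor N') ≃ₗ[R] (R ⊗[B] N) ⊗[R] (R ⊗[B] N') :=
  AlgebraTensorModule.distribBaseChange B R N N'

/-- `R ⊗ F_∂(N) → F_∂(R ⊗ N)`. -/
def prolComparison (N : Obj D) (R : Type w) [CommRing R] [Algebra B R] (dR : Derivation ℤ R R)
    (hd : ∀ b, dR (algebraMap B R b) = algebraMap B R (D.der b)) :
    R ⊗[B] N.prol →ₗ[R] Prol dR (R ⊗[B] N) :=
  Prol.comparison D.der dR hd

/-- The families of `R`-linear automorphisms of the `R ⊗ η(N)`, for `N` in `C`. -/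
abbrev AutFamily (C : Obj D → Prop) (R : Type w) [CommRing R] [Algebra B R] :=
  ∀ N : {N : Obj D // C N}, (R ⊗[B] N.1) ≃ₗ[R] (R ⊗[B] N.1)

/-- `Aut^⊗(η|_C)(R)`: the tensor automorphisms of the forgetful functor `N ↦ R ⊗ N` on `C`. -/
def TensorAut (C : Obj D → Prop) (R : Type w) [CommRing R] [Algebra B R] :
    Subgroup (AutFamily C R) where
  carrier := {g |
    (∀ (N N' : Obj D) (hN : C N) (hN' : C N') (f : N →ₗ[B] N'), Obj.IsHom N N' f →
      ∀ t, f.baseChange R (g ⟨N, hN⟩ t) = g ⟨N', hN'⟩ (f.baseChange R t)) ∧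
    (∀ (h : C (Obj.unit D)) t, g ⟨Obj.unit D, h⟩ t = t) ∧
    (∀ (N N' : Obj D) (hN : C N) (hN' : C N') (h : C (N.tensor N')) (t : R ⊗[B] (N.tensor N')),
      tensorComparison N N' R (g ⟨N.tensor N', h⟩ t) =
        TensorProduct.congr (g ⟨N, hN⟩) (g ⟨N', hN'⟩) (tensorComparison N N' R t))}
  one_mem' := by
    refine ⟨fun _ _ _ _ _ _ _ => rfl, fun _ _ => rfl, fun N N' _ _ _ t => ?_⟩
    change _ = TensorProduct.congr (LinearEquiv.refl R _) (LinearEquiv.refl R _) _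
    rw [TensorProduct.congr_refl_refl]
    rfl
  mul_mem' := by
    rintro a b ⟨ha1, ha2, ha3⟩ ⟨hb1, hb2, hb3⟩
    refine ⟨fun N N' hN hN' f hf t => ?_, fun h t => ?_, fun N N' hN hN' h t => ?_⟩
    · change f.baseChange R (a ⟨N, hN⟩ (b ⟨N, hN⟩ t)) =
        a ⟨N', hN'⟩ (b ⟨N', hN'⟩ (f.baseChange R t))
      rw [ha1 N N' hN hN' f hf, hb1 N N' hN hN' f hf]
    · change a ⟨_, h⟩ (b ⟨_, h⟩ t) = t
      rw [hb2, ha2]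
    · change tensorComparison N N' R (a ⟨_, h⟩ (b ⟨_, h⟩ t)) =
        TensorProduct.congr (b ⟨N, hN⟩ ≪≫ₗ a ⟨N, hN⟩) (b ⟨N', hN'⟩ ≪≫ₗ a ⟨N', hN'⟩) _
      rw [ha3 N N' hN hN' h, hb3 N N' hN hN' h, TensorProduct.congr_trans]
      rfl
  inv_mem' := by
    rintro a ⟨ha1, ha2, ha3⟩
    refine ⟨fun N N' hN hN' f hf t => ?_, fun h t => ?_, fun N N' hN hN' h t => ?_⟩
    · change f.baseChange R ((a ⟨N, hN⟩).symm t) = (a ⟨N', hN'⟩).symm (f.baseChange R t)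
      rw [LinearEquiv.eq_symm_apply, ← ha1 N N' hN hN' f hf, LinearEquiv.apply_symm_apply]
    · change (a ⟨_, h⟩).symm t = t
      rw [LinearEquiv.symm_apply_eq, ha2]
    · change tensorComparison N N' R ((a ⟨_, h⟩).symm t) =
        TensorProduct.congr (a ⟨N, hN⟩).symm (a ⟨N', hN'⟩).symm _
      rw [← TensorProduct.congr_symm, LinearEquiv.eq_symm_apply, ← ha3 N N' hN hN' h,
        LinearEquiv.apply_symm_apply]

/-- `Aut^{⊗,∂}(η|_C)(R)` for a differential `B`-algebra `(R, ∂)`: the tensor automorphisms `g` with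
`g_{F_∂(N)} = F_∂(g_N)` for all `N`. -/
def DiffTensorAut (C : Obj D → Prop) (R : Type w) [CommRing R] [Algebra B R]
    (dR : Derivation ℤ R R) (hd : ∀ b, dR (algebraMap B R b) = algebraMap B R (D.der b)) :
    Subgroup (AutFamily C R) :=
  TensorAut C R ⊓
  { carrier := {g | ∀ (N : Obj D) (hN : C N) (h : C N.prol) (t : R ⊗[B] N.prol),
      prolComparison N R dR hd (g ⟨N.prol, h⟩ t) =
        Prol.map dR (g ⟨N, hN⟩).toLinearMap (prolComparison N R dR hd t)}
    one_mem' := fun _ _ _ _ => rfl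
    mul_mem' := by
      intro a b ha hb N hN h t
      change prolComparison N R dR hd (a ⟨N.prol, h⟩ (b ⟨N.prol, h⟩ t)) =
        Prol.map dR (a ⟨N, hN⟩).toLinearMap (Prol.map dR (b ⟨N, hN⟩).toLinearMap _)
      rw [ha N hN h, hb N hN h]
    inv_mem' := by
      intro a ha N hN h t
      have key := ha N hN h ((a ⟨N.prol, h⟩).symm t)
      rw [LinearEquiv.apply_symm_apply] at key
      rw [key]
      refine Prod.ext ?_ ?_
      · exact ((a ⟨N, hN⟩).symm_apply_apply _).symm
      · exact ((a ⟨N, hN⟩).symm_apply_apply _).symm }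

/-- The generic Galois group `Gal(M, η_B)`, through its group of `R`-points. -/
abbrev Gal (M : Obj D) (R : Type w) [CommRing R] [Algebra B R] : Subgroup (AutFamily (Gen M) R) :=
  TensorAut (Gen M) R

/-- The parameterized generic Galois group `Gal^∂(M, η_B)`, through its group of `R`-points for a
differential `B`-algebra `R`. -/
abbrev GalDiff (M : Obj D) (R : Type w) [CommRing R] [Algebra B R]
    (dR : Derivation ℤ R R) (hd : ∀ b, dR (algebraMap B R b) = algebraMap B R (D.der b)) :
    Subgroup (AutFamily (GenDiff M) R) :=
  DiffTensorAut (GenDiff M) R dR hd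

/-- The family `g'` over `R'` is the image of the family `g` over `R` under `f : R → R'`. -/
def IsImage {C : Obj D → Prop} {R R' : Type w} [CommRing R] [Algebra B R] [CommRing R']
    [Algebra B R'] (f : R →ₐ[B] R') (g : AutFamily C R) (g' : AutFamily C R') : Prop :=
  ∀ (N : Obj D) (hN : C N) (t : R ⊗[B] N),
    g' ⟨N, hN⟩ (f.toLinearMap.rTensor N t) = f.toLinearMap.rTensor N (g ⟨N, hN⟩ t)

end Generated

/-! ### Localization of Galois groups -/

section Localization

variable {B : Type u} [CommRing B] {D : GenDiffRing B}
variable {F : Type u} [CommRing F] [Algebra B F] {E : GenDiffRing F}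

/-- `Gal(M, η_B) ⊗ F ≃ Gal(M_F, η_F)`: an isomorphism of group-valued functors on the category of
`F`-algebras, which is the canonical identification `R ⊗_F (F ⊗_B M) = R ⊗_B M` on the action on
the module `M`. The base change to `F` of a group functor over `B` is its restriction to
`F`-algebras. -/
def GalLoc (hDE : D.IsMor E) (M : Obj D) : Prop :=
  ∃ e : ∀ (R : Type w) [CommRing R] [Algebra B R] [Algebra F R] [IsScalarTower B F R],
      Gal M R ≃* Gal (M.baseChange hDE) R,
    (∀ (R R' : Type w) [CommRing R] [Algebra B R] [Algebra F R] [IsScalarTower B F R]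
      [CommRing R'] [Algebra B R'] [Algebra F R'] [IsScalarTower B F R']
      (f : R →ₐ[F] R') (g : Gal M R) (g' : Gal M R'),
      IsImage (f.restrictScalars B) g.1 g'.1 → IsImage f (e R g).1 (e R' g').1) ∧
    ∀ (R : Type w) [CommRing R] [Algebra B R] [Algebra F R] [IsScalarTower B F R]
      (g : Gal M R) (t : R ⊗[F] (F ⊗[B] M)),
      AlgebraTensorModule.cancelBaseChange B F R R M
          ((e R g).1 ⟨M.baseChange hDE, Gen.self _⟩ t) =
        g.1 ⟨M, Gen.self M⟩ (AlgebraTensorModule.cancelBaseChange B F R R M t)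

theorem der_compat (hDE : D.IsMor E) {R : Type w} [CommRing R] [Algebra B R] [Algebra F R]
    [IsScalarTower B F R] {dR : Derivation ℤ R R}
    (hd : ∀ c, dR (algebraMap F R c) = algebraMap F R (E.der c)) (b : B) :
    dR (algebraMap B R b) = algebraMap B R (D.der b) := by
  rw [IsScalarTower.algebraMap_apply B F R, hd, ← hDE.der, ← IsScalarTower.algebraMap_apply]

/-- `Gal^∂(M, η_B) ⊗ F ≃ Gal^∂(M_F, η_F)`: an isomorphism of group-valued functors on the category
of differential `F`-algebras, which is the canonical identification `R ⊗_F (F ⊗_B M) = R ⊗_B M` on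
the action on the module `M`. -/
def GalDiffLoc (hDE : D.IsMor E) (M : Obj D) : Prop :=
  ∃ e : ∀ (R : Type w) [CommRing R] [Algebra B R] [Algebra F R] [IsScalarTower B F R]
      (dR : Derivation ℤ R R) (hd : ∀ c, dR (algebraMap F R c) = algebraMap F R (E.der c)),
      GalDiff M R dR (der_compat hDE hd) ≃* GalDiff (M.baseChange hDE) R dR hd,
    (∀ (R R' : Type w) [CommRing R] [Algebra B R] [Algebra F R] [IsScalarTower B F R]
      [CommRing R'] [Algebra B R'] [Algebra F R'] [IsScalarTower B F R']
      (dR : Derivation ℤ R R) (hd : ∀ c, dR (algebraMap F R c) = algebraMap F R (E.der c))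
      (dR' : Derivation ℤ R' R') (hd' : ∀ c, dR' (algebraMap F R' c) = algebraMap F R' (E.der c))
      (f : R →ₐ[F] R') (_ : ∀ r, f (dR r) = dR' (f r))
      (g : GalDiff M R dR (der_compat hDE hd)) (g' : GalDiff M R' dR' (der_compat hDE hd')),
      IsImage (f.restrictScalars B) g.1 g'.1 → IsImage f (e R dR hd g).1 (e R' dR' hd' g').1) ∧
    ∀ (R : Type w) [CommRing R] [Algebra B R] [Algebra F R] [IsScalarTower B F R]
      (dR : Derivation ℤ R R) (hd : ∀ c, dR (algebraMap F R c) = algebraMap F R (E.der c))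
      (g : GalDiff M R dR (der_compat hDE hd)) (t : R ⊗[F] (F ⊗[B] M)),
      AlgebraTensorModule.cancelBaseChange B F R R M
          ((e R dR hd g).1 ⟨M.baseChange hDE, GenDiff.self _⟩ t) =
        g.1 ⟨M, GenDiff.self M⟩ (AlgebraTensorModule.cancelBaseChange B F R R M t)

end Localization

/-! ### The operators `σ_q`, `δ_q` and `x d/dx` on localizations of `O[x]` -/

section Operators

variable {O : Type u} [CommRing O]

/-- `p(x) ↦ p(q x)`. -/
def shift (q : O) : O[X] →+* O[X] := Polynomial.compRingHom (C q * X)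

theorem shift_C (q a : O) : shift q (C a) = C a := by simp [shift]

theorem shift_X (q : O) : shift q X = C q * X := by simp [shift]

/-- A submonoid of `O[x]` that is stable under `σ_q`. -/
def IsStable (q : O) (S : Submonoid O[X]) : Prop := S ≤ S.comap (shift q)

theorem shift_one : shift (1 : O) = RingHom.id O[X] := by
  ext <;> simp [shift_C, shift_X]

theorem isStable_one (S : Submonoid O[X]) : IsStable 1 S := by
  intro s hs
  rw [Submonoid.mem_comap, shift_one]
  exact hs

variable (q : O) (S : Submonoid O[X]) (hS : IsStable q S)
variable (L : Type v) [CommRing L] [Algebra O[X] L] [IsLocalization S L]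

/-- `σ_q : f(x) ↦ f(q x)` on the localization `L` of `O[x]`. -/
def sigQ : L →+* L := IsLocalization.map (M := S) (T := S) L (shift q) hS

theorem sigQ_algebraMap (p : O[X]) :
    sigQ q S hS L (algebraMap O[X] L p) = algebraMap O[X] L (shift q p) :=
  IsLocalization.map_eq hS p

/-- The ring homomorphism `f ↦ f + δ_q(f) ω`, `ω² = (q - 1) ω`, on `O[x]`; it maps `x` to
`x + x ω`. -/
def delHomPoly : O[X] →+* QuadraticAlgebra L 0 (algebraMap O[X] L (C (q - 1))) :=
  Polynomial.eval₂RingHom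
    ((algebraMap L (QuadraticAlgebra L 0 (algebraMap O[X] L (C (q - 1))))).comp
      ((algebraMap O[X] L).comp C))
    ⟨algebraMap O[X] L X, algebraMap O[X] L X⟩

/-- The evaluation `ω ↦ 0`. -/
def evalZero (h : L) : QuadraticAlgebra L 0 h →+* L where
  toFun z := z.re
  map_zero' := rfl
  map_one' := rfl
  map_add' _ _ := rfl
  map_mul' x y := by simp

/-- The evaluation `ω ↦ h`. -/
def evalH (h : L) : QuadraticAlgebra L 0 h →+* L where
  toFun z := z.re + h * z.im
  map_zero' := by simp
  map_one' := by change (1 : L) + h * 0 = 1; simp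
  map_add' x y := by simp; ring
  map_mul' x y := by simp; ring

theorem evalZero_delHomPoly (p : O[X]) : (delHomPoly q L p).re = algebraMap O[X] L p := by
  have : (evalZero L _).comp (delHomPoly q L) = algebraMap O[X] L := by
    ext a
    · simp [delHomPoly, evalZero, QuadraticAlgebra.algebraMap_re]
    · simp [delHomPoly, evalZero]
  exact RingHom.congr_fun this p

theorem evalH_delHomPoly (p : O[X]) :
    (delHomPoly q L p).re + algebraMap O[X] L (C (q - 1)) * (delHomPoly q L p).im =
      algebraMap O[X] L (shift q p) := by
  have : (evalH L _).comp (delHomPoly q L) = (algebraMap O[X] L).comp (shift q) := by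
    ext a
    · simp [delHomPoly, evalH, shift_C]
    · simp [delHomPoly, evalH, shift_X]
      ring
  exact RingHom.congr_fun this p

theorem isUnit_delHomPoly (hq : IsStable q S) (s : S) : IsUnit (delHomPoly q L s) := by
  rw [QuadraticAlgebra.isUnit_iff_norm_isUnit]
  have h : (delHomPoly q L s).norm =
      algebraMap O[X] L s * algebraMap O[X] L (shift q s) := by
    rw [← evalH_delHomPoly, QuadraticAlgebra.norm_def, evalZero_delHomPoly]
    ring
  rw [h]
  exact (IsLocalization.map_units L s).mul (IsLocalization.map_units L (⟨_, hq s.2⟩ : S))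

/-- The ring homomorphism `f ↦ f + δ_q(f) ω`, `ω² = (q - 1) ω`, on `L`. -/
def delHom : L →+* QuadraticAlgebra L 0 (algebraMap O[X] L (C (q - 1))) :=
  IsLocalization.lift (M := S) (isUnit_delHomPoly q S L hS)

theorem re_delHom (f : L) : (delHom q S hS L f).re = f := by
  have : (evalZero L _).comp (delHom q S hS L) = RingHom.id L := by
    refine IsLocalization.ringHom_ext S ?_
    refine RingHom.ext fun p => ?_
    simp [delHom, evalZero, evalZero_delHomPoly]
  exact RingHom.congr_fun this f

/-- The operator `δ_q` on `L`: the additive map that vanishes on `O`, maps `x` to `x` and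
satisfies `δ_q(f g) = δ_q(f) g + σ_q(f) δ_q(g)`, so that `(q - 1) δ_q = σ_q - 1`. For `q = 1` it is
the derivation `x d/dx`. -/
def delQ : L →+ L where
  toFun f := (delHom q S hS L f).im
  map_zero' := by simp
  map_add' _ _ := by simp

theorem sigQ_eq (f : L) :
    sigQ q S hS L f = f + algebraMap O[X] L (C (q - 1)) * delQ q S hS L f := by
  have : (evalH L _).comp (delHom q S hS L) = sigQ q S hS L := by
    refine IsLocalization.ringHom_ext S ?_
    refine RingHom.ext fun p => ?_
    rw [RingHom.comp_apply, RingHom.comp_apply, RingHom.comp_apply, sigQ_algebraMap,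
      ← evalH_delHomPoly, delHom, IsLocalization.lift_eq]
    rfl
  rw [← this]
  change (delHom q S hS L f).re + _ = _
  rw [re_delHom]
  rfl

theorem delQ_mul (f g : L) :
    delQ q S hS L (f * g) = delQ q S hS L f * g + sigQ q S hS L f * delQ q S hS L g := by
  rw [sigQ_eq]
  change (delHom q S hS L (f * g)).im = _
  rw [map_mul, QuadraticAlgebra.im_mul, re_delHom, re_delHom]
  change f * delQ q S hS L g + delQ q S hS L f * g + _ * delQ q S hS L f * delQ q S hS L g = _
  ring

theorem delQ_C (a : O) : delQ q S hS L (algebraMap O[X] L (C a)) = 0 := by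
  change (delHom q S hS L (algebraMap O[X] L (C a))).im = 0
  simp [delHom, delHomPoly]

theorem delQ_X : delQ q S hS L (algebraMap O[X] L X) = algebraMap O[X] L X := by
  change (delHom q S hS L (algebraMap O[X] L X)).im = _
  simp [delHom, delHomPoly]

/-- The derivation `∂ = x d/dx` on `L`. -/
def derQ : Derivation ℤ L L :=
  Derivation.mk' (delQ 1 S (isStable_one S) L).toIntLinearMap (fun a b => by
    have h := delQ_mul 1 S (isStable_one S) L a b
    rw [sigQ_eq] at h
    simp only [sub_self, map_zero, zero_mul, add_zero] at h
    simp only [AddMonoidHom.coe_toIntLinearMap, smul_eq_mul, h]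
    ring)

theorem derQ_apply (f : L) : derQ S L f = delQ 1 S (isStable_one S) L f := rfl

theorem derQ_mul (a b : L) : derQ S L (a * b) = derQ S L a * b + a * derQ S L b := by
  rw [Derivation.leibniz, smul_eq_mul, smul_eq_mul]
  ring

theorem derQ_C (a : O) : derQ S L (algebraMap O[X] L (C a)) = 0 :=
  delQ_C 1 S (isStable_one S) L a

theorem derQ_X : derQ S L (algebraMap O[X] L X) = algebraMap O[X] L X :=
  delQ_X 1 S (isStable_one S) L

theorem derQ_algebraMap (p : O[X]) :
    derQ S L (algebraMap O[X] L p) = algebraMap O[X] L (X * derivative p) := by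
  induction p using Polynomial.induction_on' with
  | add p r hp hr => simp only [map_add, hp, hr, mul_add]
  | monomial n a =>
    rw [← C_mul_X_pow_eq_monomial, map_mul, map_pow, Derivation.leibniz, Derivation.leibniz_pow,
      derQ_apply, derQ_apply, delQ_C, delQ_X]
    simp only [derivative_C_mul, derivative_X_pow, map_mul, map_pow, smul_eq_mul, mul_zero,
      add_zero, nsmul_eq_mul, map_natCast]
    rcases n with _ | n
    · simp
    · simp; ring

/-- An additive map out of `L` that satisfies a twisted Leibniz rule and vanishes on `O` and at
`x` is zero. -/
theorem vanish {L' : Type w} [CommRing L'] (g s : L →+* L') (f : L →+ L')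
    (hmul : ∀ a b, f (a * b) = f a * g b + s a * f b)
    (hs : ∀ t : S, IsUnit (s (algebraMap O[X] L t)))
    (hC : ∀ a, f (algebraMap O[X] L (C a)) = 0) (hX : f (algebraMap O[X] L X) = 0) (z : L) :
    f z = 0 := by
  have hp : ∀ p : O[X], f (algebraMap O[X] L p) = 0 := by
    intro p
    induction p using Polynomial.induction_on' with
    | add p r hp hr => simp [hp, hr]
    | monomial n a =>
      rw [← C_mul_X_pow_eq_monomial]
      have hpow : ∀ n : ℕ, f (algebraMap O[X] L (X ^ n)) = 0 := by
        intro n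
        induction n with
        | zero => simpa using hC 1
        | succ n ih => rw [pow_succ, map_mul, hmul, ih, hX]; simp
      rw [map_mul, hmul, hC, hpow]; simp
  obtain ⟨p, t, rfl⟩ := IsLocalization.exists_mk'_eq S z
  have h := hmul (algebraMap O[X] L t) (IsLocalization.mk' L p t)
  rw [mul_comm, IsLocalization.mk'_spec, hp, hp, zero_mul, zero_add] at h
  exact ((hs t).mul_right_eq_zero).1 h.symm

theorem der_sigQ (f : L) : derQ S L (sigQ q S hS L f) = sigQ q S hS L (derQ S L f) := by
  have key := vanish S L (sigQ q S hS L) (sigQ q S hS L)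
    ((derQ S L).toLinearMap.toAddMonoidHom.comp (sigQ q S hS L).toAddMonoidHom -
      (sigQ q S hS L).toAddMonoidHom.comp (derQ S L).toLinearMap.toAddMonoidHom)
    (fun a b => by simp; ring)
    (fun t => by
      rw [sigQ_algebraMap]
      exact IsLocalization.map_units L (⟨_, hS t.2⟩ : S))
    (fun a => by
      simp [sigQ_algebraMap, shift_C, derQ_C])
    (by
      simp [sigQ_algebraMap, shift_X, derQ_C, derQ_X])
    f
  exact sub_eq_zero.1 key

theorem der_delQ (f : L) : derQ S L (delQ q S hS L f) = delQ q S hS L (derQ S L f) := by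
  have key := vanish S L (RingHom.id L) (sigQ q S hS L)
    ((derQ S L).toLinearMap.toAddMonoidHom.comp (delQ q S hS L) -
      (delQ q S hS L).comp (derQ S L).toLinearMap.toAddMonoidHom)
    (fun a b => by
      simp [delQ_mul, derQ_mul, der_sigQ, -Derivation.leibniz]; ring)
    (fun t => by
      rw [sigQ_algebraMap]
      exact IsLocalization.map_units L (⟨_, hS t.2⟩ : S))
    (fun a => by simp [derQ_C, delQ_C])
    (by simp [derQ_X, delQ_X])
    f
  exact sub_eq_zero.1 key

/-- The `q`-difference ring `(L, σ_q)`, with `∂ = x d/dx`. -/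
def qDiffRing : GenDiffRing L := GenDiffRing.ofSig (sigQ q S hS L) (derQ S L) (der_sigQ q S hS L)

/-- The generalized differential ring `(L, δ_q)`, with `∂ = x d/dx`. For `q = 1` it is the
differential ring `(L, x d/dx)`. -/
def qConnRing : GenDiffRing L where
  sig := sigQ q S hS L
  del := delQ q S hS L
  h := algebraMap O[X] L (C (q - 1))
  der := derQ S L
  sig_eq := sigQ_eq q S hS L
  del_mul := delQ_mul q S hS L
  der_sig := der_sigQ q S hS L
  der_del := der_delQ q S hS L
  der_h := by rw [derQ_apply, delQ_C]

section Functoriality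

variable {O' : Type u} [CommRing O'] (φ : O →+* O') (S' : Submonoid O'[X])
variable (hS' : IsStable (φ q) S')
variable (L' : Type w) [CommRing L'] [Algebra O'[X] L'] [IsLocalization S' L']
variable (hφ : S ≤ S'.comap (Polynomial.mapRingHom φ))

/-- The ring homomorphism between localizations of `O[x]` and `O'[x]` induced by `φ : O → O'`. -/
def locMap : L →+* L' := IsLocalization.map (M := S) (T := S') L' (Polynomial.mapRingHom φ) hφ

theorem locMap_algebraMap (p : O[X]) :
    locMap S L φ S' L' hφ (algebraMap O[X] L p) = algebraMap O'[X] L' (p.map φ) :=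
  IsLocalization.map_eq hφ p

theorem locMap_sigQ (f : L) :
    locMap S L φ S' L' hφ (sigQ q S hS L f) = sigQ (φ q) S' hS' L' (locMap S L φ S' L' hφ f) := by
  have : (locMap S L φ S' L' hφ).comp (sigQ q S hS L) =
      (sigQ (φ q) S' hS' L').comp (locMap S L φ S' L' hφ) := by
    refine IsLocalization.ringHom_ext S ?_
    ext <;> simp [sigQ_algebraMap, locMap_algebraMap, shift_C, shift_X]
  exact RingHom.congr_fun this f

theorem locMap_delQ (f : L) :
    locMap S L φ S' L' hφ (delQ q S hS L f) = delQ (φ q) S' hS' L' (locMap S L φ S' L' hφ f) := by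
  have key := vanish S L (locMap S L φ S' L' hφ)
    ((locMap S L φ S' L' hφ).comp (sigQ q S hS L))
    ((locMap S L φ S' L' hφ).toAddMonoidHom.comp (delQ q S hS L) -
      (delQ (φ q) S' hS' L').comp (locMap S L φ S' L' hφ).toAddMonoidHom)
    (fun a b => by
      simp [delQ_mul, locMap_sigQ q S hS L φ S' hS' L' hφ]; ring)
    (fun t => by
      rw [RingHom.comp_apply, sigQ_algebraMap, locMap_algebraMap]
      exact IsLocalization.map_units L' (⟨_, hφ (hS t.2)⟩ : S'))
    (fun a => by simp [locMap_algebraMap, delQ_C])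
    (by simp [locMap_algebraMap, delQ_X])
    f
  exact sub_eq_zero.1 key

theorem locMap_derQ (f : L) :
    locMap S L φ S' L' hφ (derQ S L f) = derQ S' L' (locMap S L φ S' L' hφ f) := by
  have key := vanish S L (locMap S L φ S' L' hφ) (locMap S L φ S' L' hφ)
    ((locMap S L φ S' L' hφ).toAddMonoidHom.comp (derQ S L).toLinearMap.toAddMonoidHom -
      (derQ S' L').toLinearMap.toAddMonoidHom.comp (locMap S L φ S' L' hφ).toAddMonoidHom)
    (fun a b => by simp; ring)
    (fun t => by
      rw [locMap_algebraMap]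
      exact IsLocalization.map_units L' (⟨_, hφ t.2⟩ : S'))
    (fun a => by simp [locMap_algebraMap, derQ_C])
    (by simp [locMap_algebraMap, derQ_X])
    f
  exact sub_eq_zero.1 key

theorem qDiffRing_isMor :
    letI := (locMap S L φ S' L' hφ).toAlgebra
    (qDiffRing q S hS L).IsMor (qDiffRing (φ q) S' hS' L') := by
  let _ := (locMap S L φ S' L' hφ).toAlgebra
  refine ⟨locMap_sigQ q S hS L φ S' hS' L' hφ, fun f => ?_, map_one _,
    locMap_derQ S L φ S' L' hφ⟩
  change locMap S L φ S' L' hφ (sigQ q S hS L f - f) =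
    sigQ (φ q) S' hS' L' (locMap S L φ S' L' hφ f) - locMap S L φ S' L' hφ f
  rw [map_sub, locMap_sigQ q S hS L φ S' hS' L' hφ]

theorem qConnRing_isMor :
    letI := (locMap S L φ S' L' hφ).toAlgebra
    (qConnRing q S hS L).IsMor (qConnRing (φ q) S' hS' L') := by
  let _ := (locMap S L φ S' L' hφ).toAlgebra
  refine ⟨locMap_sigQ q S hS L φ S' hS' L' hφ, locMap_delQ q S hS L φ S' hS' L' hφ, ?_,
    locMap_derQ S L φ S' L' hφ⟩
  change locMap S L φ S' L' hφ (algebraMap O[X] L (C (q - 1))) =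
    algebraMap O'[X] L' (C (φ q - 1))
  rw [locMap_algebraMap]
  simp

end Functoriality

end Operators

/-! ### The algebras `O[x, 1/P(x), 1/P(qx), …]` and their fraction fields -/

section Algebras

variable {O : Type u} [CommRing O]

/-- The multiplicative set generated by the polynomials `P(x), P(qx), P(q²x), …`. -/
def denoms (q : O) (P : O[X]) : Submonoid O[X] :=
  Submonoid.closure (Set.range fun i : ℕ => shift (q ^ i) P)

theorem shift_shift (q r : O) (p : O[X]) : shift q (shift r p) = shift (q * r) p := by
  have : (shift q).comp (shift r) = shift (q * r) := by
    ext
    · simp [shift_C]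
    · simp [shift_C, shift_X, mul_assoc, mul_left_comm]
  exact RingHom.congr_fun this p

theorem isStable_denoms (q : O) (P : O[X]) : IsStable q (denoms q P) := by
  refine (Submonoid.closure_le).2 ?_
  rintro _ ⟨i, rfl⟩
  refine Submonoid.subset_closure ⟨i + 1, ?_⟩
  simp only [shift_shift, pow_succ']

/-- The algebra `O[x, 1/P(x), 1/P(qx), …]`. -/
def QAlg (q : O) (P : O[X]) : Type u := Localization (denoms q P)

namespace QAlg

variable (q : O) (P : O[X])

instance : CommRing (QAlg q P) := inferInstanceAs (CommRing (Localization (denoms q P)))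

instance : Algebra O[X] (QAlg q P) := inferInstanceAs (Algebra O[X] (Localization (denoms q P)))

instance : IsLocalization (denoms q P) (QAlg q P) :=
  inferInstanceAs (IsLocalization (denoms q P) (Localization (denoms q P)))

/-- `σ_q` on `O[x, 1/P(x), 1/P(qx), …]`. -/
def sig : QAlg q P →+* QAlg q P := sigQ q (denoms q P) (isStable_denoms q P) (QAlg q P)

/-- The `q`-difference algebra `(O[x, 1/P(x), 1/P(qx), …], σ_q)`, with `∂ = x d/dx`. -/
def diffRing : GenDiffRing (QAlg q P) := qDiffRing q (denoms q P) (isStable_denoms q P) (QAlg q P)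

/-- The generalized differential ring `(O[x, 1/P(x), 1/P(qx), …], δ_q)`, with `∂ = x d/dx`. -/
def connRing : GenDiffRing (QAlg q P) := qConnRing q (denoms q P) (isStable_denoms q P) (QAlg q P)

/-- The `q`-difference module `(M, Σ)` over `O[x, 1/P(x), 1/P(qx), …]`. -/
def ofSemilinear (M : Type u) [AddCommGroup M] [Module (QAlg q P) M] [Module.Finite (QAlg q P) M]
    [Module.Projective (QAlg q P) M] (S : M →ₛₗ[sig q P] M)
    (hS : Submodule.span (QAlg q P) (Set.range S) = ⊤) : Obj (diffRing q P) :=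
  Obj.ofSemilinear (sig q P) (derQ (denoms q P) (QAlg q P))
    (der_sigQ q (denoms q P) (isStable_denoms q P) (QAlg q P)) M S hS

end QAlg

/-! #### Specialization -/

section Specialization

variable {O' : Type u} [CommRing O'] (φ : O →+* O') (q : O) (P : O[X])

theorem map_shift (p : O[X]) : (shift q p).map φ = shift (φ q) (p.map φ) := by
  have : (Polynomial.mapRingHom φ).comp (shift q) = (shift (φ q)).comp (Polynomial.mapRingHom φ) := by
    ext <;> simp [shift_C, shift_X]
  exact RingHom.congr_fun this p

theorem map_denoms : (denoms q P).map (Polynomial.mapRingHom φ) = denoms (φ q) (P.map φ) := by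
  rw [denoms, denoms, MonoidHom.map_mclosure, ← Set.range_comp]
  congr 2
  ext1 i
  simp [map_shift]

theorem denoms_le_comap :
    denoms q P ≤ (denoms (φ q) (P.map φ)).comap (Polynomial.mapRingHom φ) := by
  rw [← Submonoid.map_le_iff_le_comap, map_denoms]

/-- The canonical map from `A = O[x, 1/P(x), 1/P(qx), …]` to the corresponding algebra over `O'`,
which is `A ⊗_O O'`. -/
def specMap : QAlg q P →+* QAlg (φ q) (P.map φ) :=
  locMap (denoms q P) (QAlg q P) φ (denoms (φ q) (P.map φ)) (QAlg (φ q) (P.map φ))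
    (denoms_le_comap φ q P)

/-- The specialization `M ⊗_A A_v` of a module with connection over `(A, σ_q)`. -/
def specDiff (M : Obj (QAlg.diffRing q P)) : Obj (QAlg.diffRing (φ q) (P.map φ)) :=
  letI := (specMap φ q P).toAlgebra
  M.baseChange (qDiffRing_isMor q (denoms q P) (isStable_denoms q P) (QAlg q P) φ
    (denoms (φ q) (P.map φ)) (isStable_denoms (φ q) (P.map φ)) (QAlg (φ q) (P.map φ))
    (denoms_le_comap φ q P))

/-- The specialization `M ⊗_A A_v` of a module with connection over `(A, δ_q)`. -/
def specConn (M : Obj (QAlg.connRing q P)) : Obj (QAlg.connRing (φ q) (P.map φ)) :=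
  letI := (specMap φ q P).toAlgebra
  M.baseChange (qConnRing_isMor q (denoms q P) (isStable_denoms q P) (QAlg q P) φ
    (denoms (φ q) (P.map φ)) (isStable_denoms (φ q) (P.map φ)) (QAlg (φ q) (P.map φ))
    (denoms_le_comap φ q P))

/-- `specMap` identifies the algebra over `O'` with `O' ⊗_O A`. -/
theorem specMap_isPushout :
    letI := φ.toAlgebra
    letI := (specMap φ q P).toAlgebra
    letI : Algebra O (QAlg q P) := ((algebraMap O[X] (QAlg q P)).comp C).toAlgebra
    letI : Algebra O' (QAlg (φ q) (P.map φ)) :=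
      ((algebraMap O'[X] (QAlg (φ q) (P.map φ))).comp C).toAlgebra
    letI : Algebra O (QAlg (φ q) (P.map φ)) :=
      (((algebraMap O'[X] (QAlg (φ q) (P.map φ))).comp C).comp φ).toAlgebra
    ∃ (_ : IsScalarTower O O' (QAlg (φ q) (P.map φ)))
      (_ : IsScalarTower O (QAlg q P) (QAlg (φ q) (P.map φ))),
      Algebra.IsPushout O O' (QAlg q P) (QAlg (φ q) (P.map φ)) := by
  let _ := φ.toAlgebra
  let _ := (specMap φ q P).toAlgebra
  let _ : Algebra O (QAlg q P) := ((algebraMap O[X] (QAlg q P)).comp C).toAlgebra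
  let _ : Algebra O' (QAlg (φ q) (P.map φ)) :=
    ((algebraMap O'[X] (QAlg (φ q) (P.map φ))).comp C).toAlgebra
  let _ : Algebra O (QAlg (φ q) (P.map φ)) :=
    (((algebraMap O'[X] (QAlg (φ q) (P.map φ))).comp C).comp φ).toAlgebra
  let _ : Algebra O[X] O'[X] := (Polynomial.mapRingHom φ).toAlgebra
  let _ : Algebra O[X] (QAlg (φ q) (P.map φ)) :=
    ((algebraMap O'[X] (QAlg (φ q) (P.map φ))).comp (Polynomial.mapRingHom φ)).toAlgebra
  have h1 : IsScalarTower O O' (QAlg (φ q) (P.map φ)) := .of_algebraMap_eq fun _ => rfl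
  have hl : ∀ p : O[X], specMap φ q P (algebraMap O[X] (QAlg q P) p) =
      algebraMap O'[X] (QAlg (φ q) (P.map φ)) (p.map φ) := fun p => locMap_algebraMap _ _ _ _ _ _ p
  have h2 : IsScalarTower O (QAlg q P) (QAlg (φ q) (P.map φ)) := .of_algebraMap_eq fun a => by
    change _ = specMap φ q P (algebraMap O[X] (QAlg q P) (C a))
    rw [hl, Polynomial.map_C]
    rfl
  have h3 : IsScalarTower O O[X] (QAlg q P) := .of_algebraMap_eq fun _ => rfl
  have h4 : IsScalarTower O' O'[X] (QAlg (φ q) (P.map φ)) := .of_algebraMap_eq fun _ => rfl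
  have h5 : IsScalarTower O[X] O'[X] (QAlg (φ q) (P.map φ)) := .of_algebraMap_eq fun _ => rfl
  have h6 : IsScalarTower O[X] (QAlg q P) (QAlg (φ q) (P.map φ)) :=
    .of_algebraMap_eq fun p => (hl p).symm
  have h7 : IsScalarTower O O[X] O'[X] := .of_algebraMap_eq fun a => (Polynomial.map_C φ).symm
  have h8 : IsScalarTower O O[X] (QAlg (φ q) (P.map φ)) := .of_algebraMap_eq fun a => by
    change _ = algebraMap O'[X] (QAlg (φ q) (P.map φ)) ((C a).map φ)
    rw [Polynomial.map_C]
    rfl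
  have h9 : IsScalarTower O O' O'[X] := inferInstance
  have h10 : IsScalarTower O O'[X] (QAlg (φ q) (P.map φ)) := .of_algebraMap_eq fun _ => rfl
  have hloc : IsLocalization (Algebra.algebraMapSubmonoid O'[X] (denoms q P))
      (QAlg (φ q) (P.map φ)) := by
    have : Algebra.algebraMapSubmonoid O'[X] (denoms q P) = denoms (φ q) (P.map φ) :=
      map_denoms φ q P
    rw [this]
    infer_instance
  have p2 : Algebra.IsPushout O[X] O'[X] (QAlg q P) (QAlg (φ q) (P.map φ)) :=
    (Algebra.isLocalization_iff_isPushout (denoms q P) (QAlg q P)).1 hloc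
  have p1 : Algebra.IsPushout O O' O[X] O'[X] := inferInstance
  refine ⟨h1, h2, ?_⟩
  have := (Algebra.IsPushout.comp_iff O O[X] O' O'[X] (T := QAlg q P)
    (T' := QAlg (φ q) (P.map φ))).2 p2.symm
  exact this.symm

end Specialization

/-! #### Localization -/

section FractionField

variable {κ : Type u} [CommRing κ] [IsDomain κ]

theorem shift_ne_zero {q : κ} (hq : q ≠ 0) {p : κ[X]} (hp : p ≠ 0) : shift q p ≠ 0 := by
  intro h
  apply hp
  ext n
  have hc : (shift q p).coeff n = p.coeff n * q ^ n := by
    simp [shift, Polynomial.comp_C_mul_X_coeff]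
  rw [h] at hc
  have := mul_eq_zero.1 hc.symm
  simpa [pow_ne_zero n hq] using this

theorem isStable_nonZeroDivisors {q : κ} (hq : q ≠ 0) : IsStable q (nonZeroDivisors κ[X]) := by
  intro p hp
  rw [Submonoid.mem_comap]
  rw [mem_nonZeroDivisors_iff_ne_zero] at hp ⊢
  exact shift_ne_zero hq hp

/-- The `q`-difference field `(κ(x), σ_q)`, with `∂ = x d/dx`. -/
def ratDiffRing {q : κ} (hq : q ≠ 0) : GenDiffRing (RatFunc κ) :=
  qDiffRing q (nonZeroDivisors κ[X]) (isStable_nonZeroDivisors hq) (RatFunc κ)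

/-- The generalized differential field `(κ(x), δ_q)`, with `∂ = x d/dx`. -/
def ratConnRing {q : κ} (hq : q ≠ 0) : GenDiffRing (RatFunc κ) :=
  qConnRing q (nonZeroDivisors κ[X]) (isStable_nonZeroDivisors hq) (RatFunc κ)

variable (φ : O →+* κ) (q : O) (P : O[X]) (hq : φ q ≠ 0) (hP : P.map φ ≠ 0)

theorem denoms_le_comap_nonZeroDivisors (hq : φ q ≠ 0) (hP : P.map φ ≠ 0) :
    denoms q P ≤ (nonZeroDivisors κ[X]).comap (Polynomial.mapRingHom φ) := by
  refine (Submonoid.closure_le).2 ?_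
  rintro _ ⟨i, rfl⟩
  change (shift (q ^ i) P).map φ ∈ nonZeroDivisors κ[X]
  rw [map_shift, mem_nonZeroDivisors_iff_ne_zero, map_pow]
  exact shift_ne_zero (pow_ne_zero i hq) hP

/-- The canonical map `O[x, 1/P(x), 1/P(qx), …] → κ(x)` induced by `φ : O → κ`. -/
def toRat : QAlg q P →+* RatFunc κ :=
  locMap (denoms q P) (QAlg q P) φ (nonZeroDivisors κ[X]) (RatFunc κ)
    (denoms_le_comap_nonZeroDivisors φ q P hq hP)

theorem toRat_isMor_diff :
    letI := (toRat φ q P hq hP).toAlgebra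
    (QAlg.diffRing q P).IsMor (ratDiffRing hq) :=
  qDiffRing_isMor q (denoms q P) (isStable_denoms q P) (QAlg q P) φ (nonZeroDivisors κ[X])
    (isStable_nonZeroDivisors hq) (RatFunc κ) (denoms_le_comap_nonZeroDivisors φ q P hq hP)

theorem toRat_isMor_conn :
    letI := (toRat φ q P hq hP).toAlgebra
    (QAlg.connRing q P).IsMor (ratConnRing hq) :=
  qConnRing_isMor q (denoms q P) (isStable_denoms q P) (QAlg q P) φ (nonZeroDivisors κ[X])
    (isStable_nonZeroDivisors hq) (RatFunc κ) (denoms_le_comap_nonZeroDivisors φ q P hq hP)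

/-- `Gal(M, η_A) ⊗ κ(x) ≃ Gal(M_{κ(x)}, η_{κ(x)})` for a `q`-difference module `M` over
`A = O[x, 1/P(x), 1/P(qx), …]`. -/
def DiffGalLoc (M : Obj (QAlg.diffRing q P)) : Prop :=
  letI := (toRat φ q P hq hP).toAlgebra
  GalLoc.{u, w} (toRat_isMor_diff φ q P hq hP) M

/-- `Gal^∂(M, η_A) ⊗ κ(x) ≃ Gal^∂(M_{κ(x)}, η_{κ(x)})` for a `q`-difference module `M` over
`A = O[x, 1/P(x), 1/P(qx), …]`. -/
def DiffGalDiffLoc (M : Obj (QAlg.diffRing q P)) : Prop :=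
  letI := (toRat φ q P hq hP).toAlgebra
  GalDiffLoc.{u, w} (toRat_isMor_diff φ q P hq hP) M

/-- `Gal(M, η_A) ⊗ κ(x) ≃ Gal(M_{κ(x)}, η_{κ(x)})` for a module with connection `M` over `(A, δ_q)`,
`A = O[x, 1/P(x), 1/P(qx), …]`. -/
def ConnGalLoc (M : Obj (QAlg.connRing q P)) : Prop :=
  letI := (toRat φ q P hq hP).toAlgebra
  GalLoc.{u, w} (toRat_isMor_conn φ q P hq hP) M

/-- `Gal^∂(M, η_A) ⊗ κ(x) ≃ Gal^∂(M_{κ(x)}, η_{κ(x)})` for a module with connection `M` over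
`(A, δ_q)`, `A = O[x, 1/P(x), 1/P(qx), …]`. -/
def ConnGalDiffLoc (M : Obj (QAlg.connRing q P)) : Prop :=
  letI := (toRat φ q P hq hP).toAlgebra
  GalDiffLoc.{u, w} (toRat_isMor_conn φ q P hq hP) M

end FractionField

/-! #### Localization of the specializations -/

section SpecLoc

theorem id_ne_zero {κ : Type u} [CommRing κ] {a : κ} (ha : a ≠ 0) : RingHom.id κ a ≠ 0 := ha

theorem map_id_ne_zero {κ : Type u} [CommRing κ] {P : κ[X]} (hP : P ≠ 0) :
    P.map (RingHom.id κ) ≠ 0 := by rwa [Polynomial.map_id]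

variable (q : O) (P : O[X]) (v : Ideal O) [v.IsPrime]
variable (hq : Ideal.Quotient.mk v q ≠ 0) (hP : P.map (Ideal.Quotient.mk v) ≠ 0)

/-- `Gal(M ⊗_A A_v, η_{A_v}) ⊗ k_v(x) ≃ Gal(M_{k_v(x)}, η_{k_v(x)})` for a `q`-difference module
`M` over `A = O[x, 1/P(x), 1/P(qx), …]`, with `k_v = O / v` and `A_v = A ⊗_O k_v`. -/
def SpecDiffGalLoc (M : Obj (QAlg.diffRing q P)) : Prop :=
  DiffGalLoc.{u, w} (RingHom.id (O ⧸ v)) (Ideal.Quotient.mk v q) (P.map (Ideal.Quotient.mk v))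
    (id_ne_zero hq) (map_id_ne_zero hP) (specDiff (Ideal.Quotient.mk v) q P M)

/-- `Gal^∂(M ⊗_A A_v, η_{A_v}) ⊗ k_v(x) ≃ Gal^∂(M_{k_v(x)}, η_{k_v(x)})` for a `q`-difference
module `M` over `A`. -/
def SpecDiffGalDiffLoc (M : Obj (QAlg.diffRing q P)) : Prop :=
  DiffGalDiffLoc.{u, w} (RingHom.id (O ⧸ v)) (Ideal.Quotient.mk v q)
    (P.map (Ideal.Quotient.mk v)) (id_ne_zero hq) (map_id_ne_zero hP)
    (specDiff (Ideal.Quotient.mk v) q P M)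

/-- `Gal(M ⊗_A A_v, η_{A_v}) ⊗ k_v(x) ≃ Gal(M_{k_v(x)}, η_{k_v(x)})` for a module with connection
`M` over `(A, δ_q)`. If `q_v = 1`, then `M ⊗_A A_v` is a differential module over
`(A_v, x d/dx)`. -/
def SpecConnGalLoc (M : Obj (QAlg.connRing q P)) : Prop :=
  ConnGalLoc.{u, w} (RingHom.id (O ⧸ v)) (Ideal.Quotient.mk v q) (P.map (Ideal.Quotient.mk v))
    (id_ne_zero hq) (map_id_ne_zero hP) (specConn (Ideal.Quotient.mk v) q P M)

/-- `Gal^∂(M ⊗_A A_v, η_{A_v}) ⊗ k_v(x) ≃ Gal^∂(M_{k_v(x)}, η_{k_v(x)})` for a module with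
connection `M` over `(A, δ_q)`. -/
def SpecConnGalDiffLoc (M : Obj (QAlg.connRing q P)) : Prop :=
  ConnGalDiffLoc.{u, w} (RingHom.id (O ⧸ v)) (Ideal.Quotient.mk v q)
    (P.map (Ideal.Quotient.mk v)) (id_ne_zero hq) (map_id_ne_zero hP)
    (specConn (Ideal.Quotient.mk v) q P M)

end SpecLoc

end Algebras

/-! ### The function field `K / k(q)` -/

section FunctionField

open FunctionField

variable (k : Type v) (K : Type u) [Field k] [Field K] [Algebra k[X] K]

/-- The integral closure `O_K` of `k[q]` in `K`. -/
abbrev OK : Type u := ringOfIntegers k K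

/-- The element `q` of `O_K`. -/
def qOK : OK k K := algebraMap k[X] (OK k K) X

theorem qOK_ne_zero [Algebra (RatFunc k) K] [IsScalarTower k[X] (RatFunc k) K] :
    algebraMap (OK k K) K (qOK k K) ≠ 0 := by
  rw [qOK, ← IsScalarTower.algebraMap_apply]
  exact (map_ne_zero_iff _ (FunctionField.algebraMap_injective k K)).2 X_ne_zero

theorem map_ne_zero_of_ne_zero {P : (OK k K)[X]} (hP : P ≠ 0) :
    P.map (algebraMap (OK k K) K) ≠ 0 :=
  (Polynomial.map_ne_zero_iff Subtype.val_injective).2 hP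

end FunctionField

end

end QDiff

namespace QDiff

noncomputable section

/-! ### Flatness over polynomial rings -/

section Flatness

/-! Let $B$ be $\mathcal A$ or $\mathcal A_v$ and let $F$ be its fraction field. For an $F$-algebra
$R$ one has $R\otimes_B N=R\otimes_F(F\otimes_B N)$. So the Galois groups agree once base change
$N\mapsto F\otimes_B N$ is understood well enough: every object of the category generated by $M_F$
must come from the category generated by $M$, and every morphism over $F$ must be a fraction of
morphisms over $B$. Both facts rest on one statement (`HasLattices`, `Obj.exists_lattice`): a
subobject $V$ of $F\otimes N$ is the base change of $L=N\cap V$, and $L$ is itself an object over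
$B$. Quotients are reduced to subobjects by duality (`isTannakian_bcImage`), and a morphism is
recovered from the lattice in its graph (`exists_correspondence`). The prolongation commutes with
base change (`Prol.comparison_bijective`), so the parameterized case runs along the same lines.

The lattice $L$ is saturated and stable under $\Delta$. Two things have to be shown about it.

Projectivity (`projective_of_isSaturated`): $T/L$ is torsion-free, hence flat, over the Dedekind
domain $O$. It then has a flat resolution of length one over $O[x]$, which makes $L$ flat over
$O[x]$, hence over the localization, where finitely generated flat modules are projective. That
$\mathcal O_K$ is Dedekind is proved without separability by an argument of Krull–Akizuki type.

Generation by $\Sigma(L)$ (`le_span_sig_image`): this needs care because $q$ need not be invertible,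
so that $\sigma_q$ is far from surjective. Let $K$ be the span of $\Sigma(L)$. Inverting $q$ gives
$q^n l\in K$ for every $l\in L$. Modulo $x$ the operator $\sigma_q$ is the identity, so $\Sigma$ is
linear there, and a Noetherian argument together with Nakayama gives $(1+xc)L\subseteq K$ for some
$c$. Finally $1+xc$ is a nonzerodivisor modulo $q$, because $P(qx)\equiv P(0)$ modulo $q$ makes the
constant terms of all denominators units there. Comparing coordinates of $q^n l$ and $(1+xc)l$
yields $l\in K$. -/

theorem flat_of_exact_of_flat {R : Type*} [CommRing R] {M N P : Type*} [AddCommGroup M]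
    [AddCommGroup N] [AddCommGroup P] [Module R M] [Module R N] [Module R P]
    (g : M →ₗ[R] N) (f : N →ₗ[R] P) (hg : Function.Injective g) (hf : Function.Surjective f)
    (H : Function.Exact g f) [Module.Flat R M] [Module.Flat R P] : Module.Flat R N := by
  rw [Module.Flat.iff_rTensor_preserves_injective_linearMap]
  intro I X _ _ _ _ i hi
  rw [injective_iff_map_eq_zero]
  intro z hz
  have hzP : f.lTensor I z = 0 := by
    refine Module.Flat.rTensor_preserves_injective_linearMap (M := P) i hi ?_
    rw [map_zero, ← LinearMap.comp_apply, LinearMap.rTensor_comp_lTensor,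
      ← LinearMap.lTensor_comp_rTensor, LinearMap.comp_apply, hz, map_zero]
  obtain ⟨y, rfl⟩ := (lTensor_exact I H hf z).1 hzP
  have hy : y = 0 := by
    refine Module.Flat.rTensor_preserves_injective_linearMap (M := M) i hi ?_
    refine LinearMap.lTensor_injective_of_exact_of_flat f hf g hg H X ?_
    rw [map_zero, map_zero, ← LinearMap.comp_apply, LinearMap.lTensor_comp_rTensor,
      ← LinearMap.rTensor_comp_lTensor, LinearMap.comp_apply, hz]
  rw [hy, map_zero]

/-- Flatness of $P$ keeps $M\to N$ injective after tensoring, so $I\otimes M$ embeds into $I\otimes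
N$ and from there into $X\otimes N$. -/
theorem flat_of_exact_of_flat_right {R : Type*} [CommRing R] {M N P : Type*} [AddCommGroup M]
    [AddCommGroup N] [AddCommGroup P] [Module R M] [Module R N] [Module R P]
    (g : M →ₗ[R] N) (f : N →ₗ[R] P) (hg : Function.Injective g) (hf : Function.Surjective f)
    (H : Function.Exact g f) [Module.Flat R N] [Module.Flat R P] : Module.Flat R M := by
  rw [Module.Flat.iff_rTensor_preserves_injective_linearMap]
  intro I X _ _ _ _ i hi
  have h1 := LinearMap.lTensor_injective_of_exact_of_flat f hf g hg H I
  have h2 := Module.Flat.rTensor_preserves_injective_linearMap (M := N) i hi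
  have h3 := h2.comp h1
  rw [← LinearMap.coe_comp, LinearMap.rTensor_comp_lTensor, ← LinearMap.lTensor_comp_rTensor,
    LinearMap.coe_comp] at h3
  exact h3.of_comp

/-- A submodule `L` of a flat module `T` is flat if `T ⧸ L` has a flat resolution of length one. -/
theorem flat_submodule_of_resolution {R : Type*} [CommRing R] {T Q₀ Q₁ : Type*} [AddCommGroup T]
    [AddCommGroup Q₀] [AddCommGroup Q₁] [Module R T] [Module R Q₀] [Module R Q₁]
    [Module.Flat R T] [Module.Flat R Q₀] [Module.Flat R Q₁] (L : Submodule R T)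
    (d : Q₁ →ₗ[R] Q₀) (π : Q₀ →ₗ[R] T ⧸ L) (hd : Function.Injective d)
    (hπ : Function.Surjective π) (H : Function.Exact d π) : Module.Flat R L := by
  -- Schanuel's argument: the kernel of `f` is an extension of $T$ by $Q_1$, hence flat, and also an
  -- extension of $Q_0$ by $L$, which passes flatness on to $L$.
  let f : T × Q₀ →ₗ[R] (T ⧸ L) := L.mkQ.coprod π
  have hE : Module.Flat R (LinearMap.ker f) := by
    refine flat_of_exact_of_flat (M := Q₁) (P := T)
      ((LinearMap.inr R T Q₀ ∘ₗ d).codRestrict (LinearMap.ker f) fun z => ?_)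
      (LinearMap.fst R T Q₀ ∘ₗ (LinearMap.ker f).subtype) ?_ ?_ ?_
    · simpa [f] using (H _).2 ⟨z, rfl⟩
    · intro x y hxy
      refine hd ?_
      simpa [Subtype.ext_iff] using hxy
    · intro t
      obtain ⟨y, hy⟩ := hπ (- L.mkQ t)
      exact ⟨⟨(t, y), by simp [f, hy]⟩, rfl⟩
    · rintro ⟨⟨t, y⟩, h⟩
      constructor
      · rintro (rfl : t = 0)
        obtain ⟨z, hz⟩ := (H y).1 (by simpa [f] using h)
        exact ⟨z, by ext <;> simp [hz]⟩
      · rintro ⟨z, hz⟩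
        exact (congrArg (fun w : LinearMap.ker f => w.1.1) hz).symm
  refine flat_of_exact_of_flat_right (N := LinearMap.ker f) (P := Q₀)
    ((LinearMap.inl R T Q₀ ∘ₗ L.subtype).codRestrict (LinearMap.ker f) fun z => ?_)
    (LinearMap.snd R T Q₀ ∘ₗ (LinearMap.ker f).subtype) ?_ ?_ ?_
  · simp [f]
  · intro x y hxy
    exact Subtype.ext (congrArg (fun w : LinearMap.ker f => w.1.1) hxy)
  · intro y
    obtain ⟨t, ht⟩ := L.mkQ_surjective (- π y)
    exact ⟨⟨(t, y), by simp only [f, LinearMap.mem_ker, LinearMap.coprod_apply, ht]; simp⟩, rfl⟩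
  · rintro ⟨⟨t, y⟩, h⟩
    constructor
    · rintro (rfl : y = 0)
      have ht : t ∈ L := by simpa [f] using h
      exact ⟨⟨t, ht⟩, rfl⟩
    · rintro ⟨z, hz⟩
      exact (congrArg (fun w : LinearMap.ker f => w.1.2) hz).symm

variable {O : Type*} [CommRing O] (N : Type*) [AddCommGroup N] [Module O N]

/-- The `i`-th coefficient of an element of `O[X] ⊗ N = N[X]`. -/
def polyCoeff (i : ℕ) : O[X] ⊗[O] N →ₗ[O] N :=
  (TensorProduct.lid O N).toLinearMap ∘ₗ (Polynomial.lcoeff O i).rTensor N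

@[simp] theorem polyCoeff_tmul (i : ℕ) (p : O[X]) (n : N) :
    polyCoeff N i (p ⊗ₜ[O] n) = p.coeff i • n := by
  simp [polyCoeff]

/-- The expansion is claimed for every large `M`, not just one, so that the expansions of two
summands can be added with a common bound. -/
theorem polyCoeff_expansion (z : O[X] ⊗[O] N) : ∃ m : ℕ, (∀ i, m ≤ i → polyCoeff N i z = 0) ∧
    ∀ M, m ≤ M → z = ∑ i ∈ Finset.range M, (X ^ i : O[X]) ⊗ₜ[O] polyCoeff N i z := by
  induction z using TensorProduct.induction_on with
  | zero => exact ⟨0, by simp⟩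
  | tmul p n =>
    refine ⟨p.natDegree + 1, fun i hi => ?_, fun M hM => ?_⟩
    · rw [polyCoeff_tmul, Polynomial.coeff_eq_zero_of_natDegree_lt (by omega), zero_smul]
    · conv_lhs => rw [p.as_sum_range' M (by omega), TensorProduct.sum_tmul]
      refine Finset.sum_congr rfl fun i _ => ?_
      rw [polyCoeff_tmul, ← TensorProduct.smul_tmul, smul_X_eq_monomial]
  | add x y hx hy =>
    obtain ⟨m, hm, hm'⟩ := hx
    obtain ⟨k, hk, hk'⟩ := hy
    refine ⟨max m k, fun i hi => ?_, fun M hM => ?_⟩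
    · rw [map_add, hm i (by omega), hk i (by omega), add_zero]
    · conv_lhs => rw [hm' M (by omega), hk' M (by omega)]
      simp only [map_add, TensorProduct.tmul_add, Finset.sum_add_distrib]

variable [Module O[X] N] [IsScalarTower O O[X] N]

/-- The action map `O[X] ⊗ N → N`. -/
def polyAct : O[X] ⊗[O] N →ₗ[O[X]] N := LinearMap.liftBaseChange O[X] LinearMap.id

@[simp] theorem polyAct_tmul (p : O[X]) (n : N) : polyAct N (p ⊗ₜ[O] n) = p • n := by
  simp [polyAct]

/-- The map `p ⊗ n ↦ X p ⊗ n - p ⊗ X n`. -/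
def polyDiff : O[X] ⊗[O] N →ₗ[O[X]] O[X] ⊗[O] N :=
  (LinearMap.lsmul O[X] _ (X : O[X])) -
    LinearMap.baseChange O[X] ((LinearMap.lsmul O[X] N (X : O[X])).restrictScalars O)

@[simp] theorem polyDiff_tmul (p : O[X]) (n : N) :
    polyDiff N (p ⊗ₜ[O] n) = (X * p) ⊗ₜ n - p ⊗ₜ ((X : O[X]) • n) := by
  simp [polyDiff, TensorProduct.smul_tmul']

/-- If $z=\sum X^i\otimes z_i$ is in the kernel, then $z_i=Xz_{i+1}$ for all $i$. The $z_i$ vanish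
for large $i$, so descending induction kills them all. -/
theorem polyDiff_injective : Function.Injective (polyDiff (O := O) N) := by
  rw [injective_iff_map_eq_zero]
  intro z hz
  have hs : ∀ (z : O[X] ⊗[O] N) (i : ℕ), polyCoeff N (i + 1) (polyDiff N z) =
      polyCoeff N i z - (X : O[X]) • polyCoeff N (i + 1) z := by
    intro z i
    induction z using TensorProduct.induction_on with
    | zero => simp
    | tmul p n => 
      simp only [polyDiff_tmul, map_sub, polyCoeff_tmul, coeff_X_mul]
      rw [smul_comm]
    | add x y hx hy => simp only [map_add, hx, hy, smul_add]; abel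
  obtain ⟨m, hm, hm'⟩ := polyCoeff_expansion N z
  have h0 : ∀ j i, m ≤ i + j → polyCoeff N i z = 0 := by
    intro j
    induction j with
    | zero => exact hm
    | succ j ih =>
      intro i hi
      have := hs z i
      rw [hz, map_zero, ih (i + 1) (by omega), smul_zero, sub_zero] at this
      exact this.symm
  rw [hm' m le_rfl]
  exact Finset.sum_eq_zero fun i _ => by rw [h0 m i (by omega), TensorProduct.tmul_zero]

/-- Modulo the image of `polyDiff`, a factor $X$ can be moved across the tensor sign, so every $z$
is congruent to $1\otimes$ its image under the action map. -/
theorem polyDiff_exact : Function.Exact (polyDiff (O := O) N) (polyAct N) := by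
  intro z
  constructor
  · intro hz
    have key : ∀ z : O[X] ⊗[O] N, z - 1 ⊗ₜ polyAct N z ∈ LinearMap.range (polyDiff (O := O) N) := by
      intro z
      induction z using TensorProduct.induction_on with
      | zero => simp
      | tmul p n =>
        rw [polyAct_tmul]
        induction p using Polynomial.induction_on' generalizing n with
        | add p r hp hr =>
          have := add_mem (hp n) (hr n)
          rw [add_smul, TensorProduct.add_tmul, TensorProduct.tmul_add]
          convert! this using 1
          abel
        | monomial k a =>
          induction k generalizing n with
          | zero =>
            rw [monomial_zero_left, ← mul_one (C a), ← smul_eq_C_mul, smul_assoc, one_smul,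
              TensorProduct.smul_tmul, sub_self]
            exact zero_mem _
          | succ k ih =>
            have h1 := ih ((X : O[X]) • n)
            have h2 : polyDiff N ((monomial k a) ⊗ₜ n) ∈ LinearMap.range (polyDiff (O := O) N) :=
              ⟨_, rfl⟩
            have := add_mem h1 h2
            rw [polyDiff_tmul, X_mul_monomial, smul_smul, monomial_mul_X] at this
            convert! this using 1
            abel
      | add x y hx hy =>
        have := add_mem hx hy
        rw [map_add, TensorProduct.tmul_add]
        convert! this using 1
        abel
    have := key z
    rwa [hz, TensorProduct.tmul_zero, sub_zero] at this
  · rintro ⟨y, rfl⟩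
    induction y using TensorProduct.induction_on with
    | zero => simp
    | tmul p n => simp [smul_smul, mul_comm]
    | add x y hx hy => simp [hx, hy]

/-- A submodule `L` of a flat `O[X]`-module `T` is flat if `T ⧸ L` is flat over `O`. -/
theorem flat_submodule_of_flat_quotient {T : Type*} [AddCommGroup T] [Module O[X] T] [Module O T]
    [IsScalarTower O O[X] T] [Module.Flat O[X] T] (L : Submodule O[X] T)
    [Module.Flat O (T ⧸ L)] : Module.Flat O[X] L :=
  -- Both terms of this resolution are $O[X]\otimes_O(T/L)$, which is flat over $O[X]$ because $T/L$
  -- is flat over $O$.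
  flat_submodule_of_resolution L (polyDiff (O := O) (T ⧸ L)) (polyAct (T ⧸ L))
    (polyDiff_injective _) (fun n => ⟨1 ⊗ₜ n, by simp⟩) (polyDiff_exact _)

end Flatness

/-! ### Saturated submodules over localizations of polynomial rings -/

/-- `L` is saturated in `T`: the quotient `T ⧸ L` is torsion-free. -/
def IsSaturated {B : Type*} [CommRing B] {T : Type*} [AddCommGroup T] [Module B T]
    (L : Submodule B T) : Prop := ∀ (b : B) (t : T), b ≠ 0 → b • t ∈ L → t ∈ L

/-- A saturated submodule of a finitely generated projective module over a localization of `O[X]`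
is projective if `O` is a Dedekind domain. -/
theorem projective_of_isSaturated {O : Type*} [CommRing O] [IsDedekindDomain O]
    (S : Submonoid O[X]) {A : Type*} [CommRing A] [IsNoetherianRing A] [Algebra O[X] A]
    [IsLocalization S A] (hS : S ≤ nonZeroDivisors O[X])
    {T : Type*} [AddCommGroup T] [Module A T] [Module.Finite A T] [Module.Projective A T]
    {L : Submodule A T} (hL : IsSaturated L) : Module.Projective A L := by
  let _ : Module O[X] T := Module.compHom T (algebraMap O[X] A)
  have : IsScalarTower O[X] A T := IsScalarTower.of_algebraMap_smul fun _ _ => rfl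
  let _ : Module O T := Module.compHom T (C : O →+* O[X])
  have : IsScalarTower O O[X] T := IsScalarTower.of_algebraMap_smul fun _ _ => rfl
  have hA : Module.Flat O[X] A := IsLocalization.flat A S
  have hT : Module.Flat O[X] T := Module.Flat.trans O[X] A T
  -- Saturation is applied to constants only. Over the Dedekind domain $O$, torsion-free modules are
  -- flat.
  have htf : Module.IsTorsionFree O (T ⧸ L.restrictScalars O[X]) := by
    refine Module.isTorsionFree_iff_smul_eq_zero.2 fun c m hm => ?_
    obtain ⟨t, rfl⟩ := Submodule.Quotient.mk_surjective _ m
    by_cases hc : c = 0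
    · exact Or.inl hc
    · right
      rw [← Submodule.Quotient.mk_smul, Submodule.Quotient.mk_eq_zero] at hm
      rw [Submodule.Quotient.mk_eq_zero]
      refine hL (algebraMap O[X] A (C c)) t ?_ hm
      rwa [Ne, map_eq_zero_iff _ (IsLocalization.injective A hS), C_eq_zero]
  have : Module.Flat O[X] (L.restrictScalars O[X]) := flat_submodule_of_flat_quotient _
  have hLO : Module.Flat O[X] L := this
  -- Flatness over $O[X]$ and over its localization are the same for an $A$-module; over the
  -- Noetherian ring $A$ the finite flat module $L$ is finitely presented, hence projective.
  have hLA : Module.Flat A L := (Module.flat_iff_of_isLocalization A S L).2 hLO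
  have : Module.FinitePresentation A L := Module.finitePresentation_of_finite A L
  exact Module.Flat.projective_of_finitePresentation

/-! ### Rings of integers of function fields -/

section Integers

variable {k : Type*} [Field k] {O : Type*} [CommRing O] [Algebra k[X] O] [Algebra k O]
  [IsScalarTower k k[X] O]

/-- Division with remainder by $a$ reduces each coefficient to degree below $\deg a$ without
changing the class modulo $aO$. -/
theorem mk_mem_span_monomials (a : k[X]) (ha : a ≠ 0) {ι : Type*} [Fintype ι] (e : ι → O) (b : O)
    (hb : b ∈ Submodule.span k[X] (Set.range e)) :
    Submodule.Quotient.mk b ∈ Submodule.span k (Set.range fun x : ι × Fin a.natDegree =>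
      (Submodule.Quotient.mk ((X ^ (x.2 : ℕ) : k[X]) • e x.1) :
        O ⧸ Ideal.span {algebraMap k[X] O a})) := by
  obtain ⟨c, rfl⟩ := (Submodule.mem_span_range_iff_exists_fun k[X]).1 hb
  have hmod : (Submodule.Quotient.mk (∑ i, c i • e i) : O ⧸ Ideal.span {algebraMap k[X] O a}) =
      Submodule.Quotient.mk (∑ i, (c i % a) • e i) := by
    rw [Submodule.Quotient.eq, ← Finset.sum_sub_distrib]
    refine Submodule.sum_mem _ fun i _ => ?_
    rw [← sub_smul]
    have : c i - c i % a = a * (c i / a) := by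
      rw [sub_eq_iff_eq_add, EuclideanDomain.div_add_mod]
    rw [this, mul_smul, Algebra.smul_def]
    exact Ideal.mul_mem_right _ _ (Ideal.mem_span_singleton_self _)
  rw [hmod]
  have : (∑ i, (c i % a) • e i) = ∑ i, ∑ j : Fin a.natDegree,
      (c i % a).coeff j • ((X ^ (j : ℕ) : k[X]) • e i) := by
    refine Finset.sum_congr rfl fun i _ => ?_
    -- A constant $a$ is a unit, so all remainders are zero and the inner sum is empty; the degree
    -- bound on remainders is available only in positive degree.
    by_cases hdeg : a.natDegree = 0
    · have h0 : c i % a = 0 := by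
        obtain ⟨u, hu⟩ := natDegree_eq_zero.1 hdeg
        have hu0 : u ≠ 0 := by rintro rfl; exact ha (by simpa using hu.symm)
        exact EuclideanDomain.mod_eq_zero.2 (IsUnit.dvd (hu ▸ isUnit_C.2 hu0.isUnit))
      simp [h0]
    · conv_lhs => rw [(c i % a).as_sum_range' a.natDegree (natDegree_mod_lt _ hdeg), Finset.sum_smul,
        Finset.sum_range]
      refine Finset.sum_congr rfl fun j _ => ?_
      rw [← smul_assoc, smul_X_eq_monomial]
  rw [this]
  rw [← Submodule.mkQ_apply, map_sum]
  refine Submodule.sum_mem _ fun i _ => ?_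
  rw [map_sum]
  refine Submodule.sum_mem _ fun j _ => ?_
  rw [Submodule.mkQ_apply, Submodule.Quotient.mk_smul]
  exact Submodule.smul_mem _ _ (Submodule.subset_span ⟨(i, j), rfl⟩)

/-- If `O` is a torsion-free `k[X]`-algebra of rank at most `n`, then `O / a O` is finite-dimensional
over `k` for every nonzero `a` in `k[X]`. -/
theorem finite_quotient_of_rank_le [Module.IsTorsionFree k[X] O] (n : ℕ)
    (hn : ∀ (r : ℕ) (e : Fin r → O), LinearIndependent k[X] e → r ≤ n) (a : k[X]) (ha : a ≠ 0) :
    Module.Finite k (O ⧸ Ideal.span {algebraMap k[X] O a}) := by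
  rw [← Module.rank_lt_aleph0_iff]
  refine lt_of_le_of_lt (rank_le (n := n * a.natDegree) fun s hs => ?_) Cardinal.natCast_lt_aleph0
  choose b hb using fun i : s => Submodule.Quotient.mk_surjective _ i.1
  -- The lifts of an independent set $s$ span a finitely generated torsion-free, hence free, module
  -- over the principal ideal domain $k[X]$. Its rank is at most $n$, whatever the size of $s$, so
  -- the span of $s$ over $k$ has dimension at most $n\deg a$.
  let N := Submodule.span k[X] (Set.range b)
  have hNf : Module.Finite k[X] N := Module.Finite.span_of_finite _ (Set.finite_range b)
  let e := Module.finBasis k[X] N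
  have hcard := hn _ _ (e.linearIndependent.map' N.subtype N.ker_subtype)
  let w : Fin (Module.finrank k[X] N) × Fin a.natDegree → O ⧸ Ideal.span {algebraMap k[X] O a} :=
    fun x => Submodule.Quotient.mk ((X ^ (x.2 : ℕ) : k[X]) • (e x.1 : O))
  have hle : Submodule.span k (s : Set (O ⧸ Ideal.span {algebraMap k[X] O a})) ≤
      Submodule.span k (Set.range w) := by
    refine Submodule.span_le.2 fun x hx => ?_
    have h1 : (⟨b ⟨x, hx⟩, Submodule.subset_span ⟨_, rfl⟩⟩ : N) ∈
        Submodule.span k[X] (Set.range e) := by rw [e.span_eq]; trivial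
    have h2 := Submodule.mem_map_of_mem (f := N.subtype) h1
    rw [Submodule.map_span, ← Set.range_comp] at h2
    have h3 := mk_mem_span_monomials a ha (fun i => (e i : O)) (b ⟨x, hx⟩) h2
    rw [hb] at h3
    exact h3
  have h1 : Module.finrank k
      (Submodule.span k (s : Set (O ⧸ Ideal.span {algebraMap k[X] O a}))) = s.card :=
    finrank_span_finset_eq_card hs
  have h3 : Module.finrank k (Submodule.span k (Set.range w)) ≤ _ := finrank_range_le_card w
  rw [Fintype.card_prod, Fintype.card_fin, Fintype.card_fin] at h3
  have hfd : Module.Finite k (Submodule.span k (Set.range w)) :=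
    Module.Finite.span_of_finite _ (Set.finite_range _)
  rw [← h1]
  exact ((Submodule.finrank_mono hle).trans h3).trans (Nat.mul_le_mul_right _ hcard)

/-- By integrality a nonzero ideal contains a nonzero polynomial $a$. As $O/aO$ is
finite-dimensional over $k$, the ideal is generated by $a$ and finitely many lifts. This
Krull–Akizuki argument does not need $O$ to be finite over $k[X]$, nor a nondegenerate trace form.
-/
theorem isNoetherianRing_of_rank_le [IsDomain O] [Module.IsTorsionFree k[X] O]
    [Algebra.IsIntegral k[X] O] (n : ℕ)
    (hn : ∀ (r : ℕ) (e : Fin r → O), LinearIndependent k[X] e → r ≤ n) : IsNoetherianRing O := by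
  refine isNoetherianRing_iff_ideal_fg _ |>.2 fun I => ?_
  by_cases hI : I = ⊥
  · rw [hI]; exact Submodule.fg_bot
  obtain ⟨x, hx, hx0⟩ := Submodule.exists_mem_ne_zero_of_ne_bot hI
  have hcom := Ideal.comap_ne_bot_of_integral_mem hx0 hx (Algebra.IsIntegral.isIntegral (R := k[X]) x)
  obtain ⟨a, haI, ha⟩ := Submodule.exists_mem_ne_zero_of_ne_bot hcom
  have hfin := finite_quotient_of_rank_le n hn a ha
  refine Submodule.fg_of_fg_map_of_fg_inf_ker (Ideal.span {algebraMap k[X] O a}).mkQ ?_ ?_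
  · exact Submodule.FG.of_restrictScalars k (IsNoetherian.noetherian _)
  · rw [Submodule.ker_mkQ, inf_eq_right.2]
    · exact ⟨{algebraMap k[X] O a}, by simp [Ideal.span]⟩
    · rw [Ideal.span_singleton_le_iff_mem]
      exact haI

-- Elements of $\mathcal O_K$ independent over $k[q]$ stay independent over $k(q)$ in $K$, so their
-- number is at most $[K:k(q)]$. This supplies the rank bound behind the Noetherian property;
-- dimension at most one comes from integrality over $k[q]$.
open FunctionField in
theorem isDedekindDomain_OK (k : Type v) (K : Type u) [Field k] [Field K]
    [Algebra k[X] K] [Algebra (RatFunc k) K] [IsScalarTower k[X] (RatFunc k) K]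
    [FunctionField k K] : IsDedekindDomain (OK k K) := by
  let _ : Algebra k (OK k K) := ((algebraMap k[X] (OK k K)).comp C).toAlgebra
  have : IsScalarTower k k[X] (OK k K) := IsScalarTower.of_algebraMap_eq fun _ => rfl
  have : Module.IsTorsionFree k[X] (OK k K) :=
    Module.isTorsionFree_iff_algebraMap_injective.2 (ringOfIntegers.algebraMap_injective k K)
  have hfin : FiniteDimensional (RatFunc k) K := inferInstance
  have hint : Algebra.IsIntegral k[X] (OK k K) := IsIntegralClosure.isIntegral_algebra k[X] K
  have := isNoetherianRing_of_rank_le (k := k) (O := OK k K) (Module.finrank (RatFunc k) K)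
    fun r e he => by
      have h2 := he.map' (IsScalarTower.toAlgHom k[X] (OK k K) K).toLinearMap
        (LinearMap.ker_eq_bot.2 Subtype.val_injective)
      have := ((LinearIndependent.iff_fractionRing k[X] (RatFunc k)).1 h2).fintype_card_le_finrank
      rwa [Fintype.card_fin] at this
  have h1 : Ring.DimensionLEOne (OK k K) := Ring.DimensionLEOne.of_isIntegral k[X] (OK k K)
  exact { toIsDedekindRing := { h1, (inferInstance : IsIntegrallyClosed (OK k K)) with } }

end Integers

/-! ### Semilinear operators over a domain -/

section Semilinear

/-- The images of a basis under $S$ span and have the right number, so they form a basis again. This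
gives injectivity, and $\varphi$ can be prescribed on the new basis. -/
theorem exists_linearMap_of_semilinear_field {F V : Type*} [Field F] (s : F →+* F) [AddCommGroup V]
    [Module F V] [FiniteDimensional F V] (S : V →ₛₗ[s] V)
    (hS : Submodule.span F (Set.range S) = ⊤) :
    Function.Injective S ∧ ∀ ψ : V →ₛₗ[s] F, ∃ φ : V →ₗ[F] F, ∀ v, φ (S v) = ψ v := by
  let b := Module.finBasis F V
  have hspan : ⊤ ≤ Submodule.span F (Set.range (S ∘ b)) := by
    rw [← hS, Submodule.span_le]
    rintro _ ⟨v, rfl⟩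
    rw [← b.sum_repr v, map_sum]
    refine Submodule.sum_mem _ fun i _ => ?_
    rw [map_smulₛₗ]
    exact Submodule.smul_mem _ _ (Submodule.subset_span ⟨i, rfl⟩)
  let b' := basisOfTopLeSpanOfCardEqFinrank (S ∘ b) hspan (Fintype.card_fin _)
  have hb' : ∀ i, b' i = S (b i) := fun i => by simp [b']
  refine ⟨?_, fun ψ => ⟨b'.constr F (fun i => ψ (b i)), fun v => ?_⟩⟩
  · rw [injective_iff_map_eq_zero]
    intro v hv
    rw [← b.sum_repr v, map_sum] at hv
    simp only [map_smulₛₗ, ← hb'] at hv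
    have h0 := Fintype.linearIndependent_iff.1 b'.linearIndependent _ hv
    rw [← b.sum_repr v]
    refine Finset.sum_eq_zero fun i _ => ?_
    rw [(map_eq_zero s).1 (h0 i), zero_smul]
  · conv_lhs => rw [← b.sum_repr v]
    conv_rhs => rw [← b.sum_repr v]
    simp only [map_sum, map_smulₛₗ, ← hb', Module.Basis.constr_basis, RingHom.id_apply]

variable {B : Type*} [CommRing B] {F : Type*} [Field F] [Algebra B F] {s : B →+* B} {N : Type*}
  [AddCommGroup N] [Module B N]

/-- The additive map `c ⊗ n ↦ σ(c) ⊗ S n`. -/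
def semilinearBaseChangeAdd (s' : F →+* F)
    (hs : ∀ b, s' (algebraMap B F b) = algebraMap B F (s b))
    {N' : Type*} [AddCommGroup N'] [Module B N'] (S : N →ₛₗ[s] N') :
    F ⊗[B] N →+ F ⊗[B] N' :=
  TensorProduct.liftAddHom
    (AddMonoidHom.mk' (fun c => AddMonoidHom.mk' (fun n => s' c ⊗ₜ[B] S n)
      (fun x y => by simp only [map_add, TensorProduct.tmul_add]))
      (fun x y => by
        ext n
        simp only [map_add, TensorProduct.add_tmul, AddMonoidHom.mk'_apply,
          AddMonoidHom.add_apply]))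
    (fun b c n => by
      simp only [AddMonoidHom.mk'_apply, map_smulₛₗ]
      rw [Algebra.smul_def, map_mul, hs, ← Algebra.smul_def, TensorProduct.smul_tmul])

theorem semilinearBaseChangeAdd_tmul (s' : F →+* F)
    (hs : ∀ b, s' (algebraMap B F b) = algebraMap B F (s b)) {N' : Type*} [AddCommGroup N']
    [Module B N'] (S : N →ₛₗ[s] N') (c : F) (n : N) :
    semilinearBaseChangeAdd s' hs S (c ⊗ₜ n) = s' c ⊗ₜ S n := rfl

/-- The extension of a `σ`-semilinear operator on `N` to `F ⊗ N`. -/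
def semilinearBaseChange (s' : F →+* F) (hs : ∀ b, s' (algebraMap B F b) = algebraMap B F (s b))
    {N' : Type*} [AddCommGroup N'] [Module B N'] (S : N →ₛₗ[s] N') :
    F ⊗[B] N →ₛₗ[s'] F ⊗[B] N' where
  toFun := semilinearBaseChangeAdd s' hs S
  map_add' := map_add _
  map_smul' c t := by
    induction t using TensorProduct.induction_on with
    | zero => simp
    | tmul a n =>
      rw [TensorProduct.smul_tmul', semilinearBaseChangeAdd_tmul, semilinearBaseChangeAdd_tmul,
        smul_eq_mul, map_mul, TensorProduct.smul_tmul', smul_eq_mul]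
    | add x y hx hy => rw [smul_add, map_add, hx, hy, map_add, smul_add]

@[simp] theorem semilinearBaseChange_tmul (s' : F →+* F)
    (hs : ∀ b, s' (algebraMap B F b) = algebraMap B F (s b)) {N' : Type*} [AddCommGroup N']
    [Module B N'] (S : N →ₛₗ[s] N') (c : F) (n : N) :
    semilinearBaseChange s' hs S (c ⊗ₜ n) = s' c ⊗ₜ S n := rfl

variable [IsFractionRing B F]

/-- The image of $S$ is only required to span up to nonzero multiples, because this is to be applied
to a lattice $L$ for which it is not yet known that $\Sigma(L)$ generates $L$. -/
theorem span_range_semilinearBaseChange (s' : F →+* F)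
    (hs : ∀ b, s' (algebraMap B F b) = algebraMap B F (s b)) (S : N →ₛₗ[s] N)
    (hS : ∀ n : N, ∃ b : B, b ≠ 0 ∧ b • n ∈ Submodule.span B (Set.range S)) :
    Submodule.span F (Set.range (semilinearBaseChange s' hs S)) = ⊤ := by
  have h1 : Submodule.span B (Set.range S) ≤ Submodule.comap (TensorProduct.mk B F N 1)
      ((Submodule.span F (Set.range (semilinearBaseChange s' hs S))).restrictScalars B) := by
    rw [Submodule.span_le]
    rintro _ ⟨n, rfl⟩
    exact Submodule.subset_span ⟨1 ⊗ₜ n, by simp⟩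
  rw [eq_top_iff]
  rintro t -
  induction t using TensorProduct.induction_on with
  | zero => exact Submodule.zero_mem _
  | tmul c n =>
    obtain ⟨b, hb, hn⟩ := hS n
    have hb' : algebraMap B F b ≠ 0 := by
      rwa [Ne, map_eq_zero_iff _ (IsFractionRing.injective B F)]
    have := Submodule.smul_mem (Submodule.span F (Set.range (semilinearBaseChange s' hs S)))
      (c * (algebraMap B F b)⁻¹) (h1 hn)
    rwa [TensorProduct.mk_apply, TensorProduct.tmul_smul, TensorProduct.smul_tmul',
      TensorProduct.smul_tmul', smul_eq_mul, Algebra.smul_def b, mul_one, mul_assoc,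
      inv_mul_cancel₀ hb', mul_one] at this
  | add x y hx hy => exact Submodule.add_mem _ hx hy

variable [IsDomain B]

variable (F) in
theorem exists_fractionRing_extension (hs : Function.Injective s) :
    ∃ s' : F →+* F, ∀ b, s' (algebraMap B F b) = algebraMap B F (s b) :=
  ⟨IsLocalization.map (M := nonZeroDivisors B) (T := nonZeroDivisors B) F s
    (nonZeroDivisors_le_comap_nonZeroDivisors_of_injective s hs), fun b => IsLocalization.map_eq _ b⟩

variable (F) in
/-- A functional `φ` with `φ ∘ Σ = ψ` for a `σ`-semilinear `ψ`. -/
theorem exists_linearMap_of_semilinear [Module.Finite B N] (hs : Function.Injective s)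
    (S : N →ₛₗ[s] N) (hS : ∀ n : N, ∃ b : B, b ≠ 0 ∧ b • n ∈ Submodule.span B (Set.range S))
    (ψ : N →ₛₗ[s] B) : ∃ φ : N →ₗ[B] F, ∀ n, φ (S n) = algebraMap B F (ψ n) := by
  obtain ⟨s', hs'⟩ := exists_fractionRing_extension F hs
  obtain ⟨φ, hφ⟩ := (exists_linearMap_of_semilinear_field s' (semilinearBaseChange s' hs' S)
    (span_range_semilinearBaseChange s' hs' S hS)).2
    ((TensorProduct.AlgebraTensorModule.rid B F F).toLinearMap.comp
      (semilinearBaseChange s' hs' ψ))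
  refine ⟨φ.restrictScalars B ∘ₗ TensorProduct.mk B F N 1, fun n => ?_⟩
  have := hφ (1 ⊗ₜ n)
  simpa [Algebra.smul_def] using this

/-- A torsion-free module embeds into its extension to the fraction field, where the extended
operator is injective. -/
theorem injective_of_semilinear [Module.Finite B N] [Module.IsTorsionFree B N]
    (hs : Function.Injective s) (S : N →ₛₗ[s] N)
    (hS : ∀ n : N, ∃ b : B, b ≠ 0 ∧ b • n ∈ Submodule.span B (Set.range S)) :
    Function.Injective S := by
  obtain ⟨s', hs'⟩ := exists_fractionRing_extension (FractionRing B) hs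
  have h := (exists_linearMap_of_semilinear_field s' (semilinearBaseChange s' hs' S)
    (span_range_semilinearBaseChange s' hs' S hS)).1
  have hN : Function.Injective (TensorProduct.mk B (FractionRing B) N 1) := by
    rw [injective_iff_map_eq_zero]
    intro n hn
    have : IsLocalizedModule (nonZeroDivisors B) (TensorProduct.mk B (FractionRing B) N 1) :=
      (isLocalizedModule_iff_isBaseChange (nonZeroDivisors B) (FractionRing B) _).2
        (TensorProduct.isBaseChange B N (FractionRing B))
    obtain ⟨c, hc⟩ := (IsLocalizedModule.eq_zero_iff (nonZeroDivisors B)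
      (TensorProduct.mk B (FractionRing B) N 1)).1 hn
    exact (smul_eq_zero.1 hc).resolve_left (nonZeroDivisors.ne_zero c.2)
  intro x y hxy
  exact hN (h (by simp [hxy]))

end Semilinear

/-! ### Arithmetic of `O[x, 1/P(x), 1/P(qx), …]` -/

section Arithmetic

/-- Multiply the $n$-th coefficient of $gf=0$ by $g_0^n$: the terms with $f_j$, $j<n$, are killed by
$g_0^{j+1}$ by induction, and $g_0^{n+1}f_n$ remains. Hence a polynomial with unit constant term is
a nonzerodivisor over any ring, which is used over $O/q$. -/
theorem coeff_zero_pow_mul_coeff_eq_zero {R : Type*} [CommRing R] {g f : R[X]} (h : g * f = 0)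
    (n : ℕ) : g.coeff 0 ^ (n + 1) * f.coeff n = 0 := by
  induction n using Nat.strong_induction_on with
  | _ n ih =>
    have h1 := congrArg (fun p : R[X] => g.coeff 0 ^ n * p.coeff n) h
    simp only [coeff_mul, coeff_zero, mul_zero] at h1
    rw [Finset.mul_sum, Finset.sum_eq_single (0, n)] at h1
    · rw [pow_succ, mul_assoc]; exact h1
    · rintro ⟨i, j⟩ hij hne
      have hij' := Finset.HasAntidiagonal.mem_antidiagonal.1 hij
      have hj : j < n := by
        by_contra hj
        exact hne (by ext <;> simp only at hij' ⊢ <;> omega)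
      obtain ⟨r, hr⟩ : ∃ r, n = j + 1 + r := ⟨n - (j + 1), by omega⟩
      have := ih j hj
      calc g.coeff 0 ^ n * (g.coeff i * f.coeff j)
          = g.coeff 0 ^ r * g.coeff i * (g.coeff 0 ^ (j + 1) * f.coeff j) := by
            rw [hr, pow_add]; ring
        _ = 0 := by rw [this, mul_zero]
    · intro h
      exact absurd (Finset.HasAntidiagonal.mem_antidiagonal.2 (zero_add n)) h

variable {O : Type u} [CommRing O] (q : O) (P : O[X])

theorem coeff_shift (p : O[X]) (n : ℕ) : (shift q p).coeff n = p.coeff n * q ^ n := by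
  simp [shift, Polynomial.comp_C_mul_X_coeff]

/-- A power of `q` times a polynomial is in the image of `σ_q`. -/
theorem exists_pow_mul_eq_shift (p : O[X]) : ∃ (n : ℕ) (p' : O[X]), C (q ^ n) * p = shift q p' := by
  -- The shift multiplies the $i$-th coefficient by $q^i$, so the $i$-th coefficient of the preimage
  -- carries the missing factor $q^{\deg p-i}$.
  refine ⟨p.natDegree, ∑ i ∈ Finset.range (p.natDegree + 1),
    monomial i (p.coeff i * q ^ (p.natDegree - i)), ?_⟩
  ext n
  rw [coeff_shift, finsetSum_coeff, coeff_C_mul]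
  simp only [coeff_monomial]
  rw [Finset.sum_ite_eq']
  split_ifs with h
  · have : q ^ p.natDegree = q ^ (p.natDegree - n) * q ^ n := by
      rw [← pow_add]; congr 1; have := Finset.mem_range.1 h; omega
    rw [this]; ring
  · rw [coeff_eq_zero_of_natDegree_lt (by simpa using h)]; simp

variable {q P}

theorem sig_algebraMap (p : O[X]) : QAlg.sig q P (algebraMap O[X] (QAlg q P) p) =
    algebraMap O[X] (QAlg q P) (shift q p) := sigQ_algebraMap _ _ _ _ p

/-- The element `x` of `O[x, 1/P(x), 1/P(qx), …]`. -/
abbrev QAlg.varX (q : O) (P : O[X]) : QAlg q P := algebraMap O[X] (QAlg q P) X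

/-- The element `q` of `O[x, 1/P(x), 1/P(qx), …]`. -/
abbrev QAlg.constQ (q : O) (P : O[X]) : QAlg q P := algebraMap O[X] (QAlg q P) (C q)

/-- The substitution $x\mapsto qx$ fixes constant terms, which settles polynomials. For $a=p/s$ one
has $(\sigma a-a)\,\sigma s=(\sigma p-p)-a(\sigma s-s)$, and $\sigma s$ is a unit. -/
theorem x_dvd_sig_sub (a : QAlg q P) : QAlg.varX q P ∣ QAlg.sig q P a - a := by
  have hp : ∀ p : O[X], QAlg.varX q P ∣ algebraMap O[X] (QAlg q P) (shift q p) -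
      algebraMap O[X] (QAlg q P) p := by
    intro p
    rw [← map_sub]
    refine map_dvd _ (X_dvd_iff.2 ?_)
    rw [coeff_sub, coeff_shift]
    simp
  obtain ⟨p, s, rfl⟩ := IsLocalization.exists_mk'_eq (denoms q P) a
  set a := IsLocalization.mk' (QAlg q P) p s
  have hs : a * algebraMap O[X] (QAlg q P) s = algebraMap O[X] (QAlg q P) p :=
    IsLocalization.mk'_spec (QAlg q P) p s
  have hu : IsUnit (algebraMap O[X] (QAlg q P) (shift q s)) :=
    IsLocalization.map_units (QAlg q P) (⟨_, isStable_denoms q P s.2⟩ : denoms q P)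
  have h1 : QAlg.sig q P a * algebraMap O[X] (QAlg q P) (shift q s) =
      algebraMap O[X] (QAlg q P) (shift q p) := by
    rw [← sig_algebraMap, ← sig_algebraMap, ← map_mul, hs]
  refine hu.dvd_mul_right.1 ?_
  have : (QAlg.sig q P a - a) * algebraMap O[X] (QAlg q P) (shift q s) =
      (algebraMap O[X] (QAlg q P) (shift q p) - algebraMap O[X] (QAlg q P) p) -
      a * (algebraMap O[X] (QAlg q P) (shift q s) - algebraMap O[X] (QAlg q P) s) := by
    rw [sub_mul, h1, mul_sub, hs]; ring
  rw [this]
  exact dvd_sub (hp p) (Dvd.dvd.mul_left (hp s) a)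

/-- All $P(q^ix)$ have constant term $P(0)$. Modulo $q$ this constant equals $P(qx)$, which is
inverted in the algebra. -/
theorem isUnit_mk_coeff_zero {s : O[X]} (hs : s ∈ denoms q P) :
    IsUnit (Ideal.Quotient.mk (Ideal.span {QAlg.constQ q P})
      (algebraMap O[X] (QAlg q P) (C (s.coeff 0)))) := by
  induction hs using Submonoid.closure_induction with
  | mem y hy =>
    obtain ⟨i, rfl⟩ := hy
    simp only [coeff_shift, pow_zero, mul_one]
    have hu : IsUnit (algebraMap O[X] (QAlg q P) (shift q P)) :=
      IsLocalization.map_units (QAlg q P)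
        (⟨_, Submonoid.subset_closure ⟨1, by simp⟩⟩ : denoms q P)
    have : Ideal.Quotient.mk (Ideal.span {QAlg.constQ q P}) (algebraMap O[X] (QAlg q P) (C (P.coeff 0)))
        = Ideal.Quotient.mk (Ideal.span {QAlg.constQ q P})
          (algebraMap O[X] (QAlg q P) (shift q P)) := by
      rw [eq_comm, Ideal.Quotient.mk_eq_mk_iff_sub_mem, Ideal.mem_span_singleton, ← map_sub]
      refine map_dvd _ ((C_dvd_iff_dvd_coeff _ _).2 fun n => ?_)
      rw [coeff_sub, coeff_shift, coeff_C]
      rcases n with _ | n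
      · simp
      · simp only [Nat.succ_ne_zero, if_false, sub_zero]
        exact Dvd.dvd.mul_left (dvd_pow_self q (Nat.succ_ne_zero n)) _
    rw [this]
    exact hu.map _
  | one => simp
  | mul a b _ _ ha hb =>
    rw [mul_coeff_zero, C_mul, map_mul, map_mul]
    exact ha.mul hb

variable (q P)

variable [IsDomain O]

theorem denoms_le_nonZeroDivisors (hq : q ≠ 0) (hP : P ≠ 0) :
    denoms q P ≤ nonZeroDivisors O[X] := by
  refine (Submonoid.closure_le).2 ?_
  rintro _ ⟨i, rfl⟩
  exact mem_nonZeroDivisors_of_ne_zero (shift_ne_zero (pow_ne_zero i hq) hP)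


variable {q P}

theorem algebraMap_QAlg_injective (hq : q ≠ 0) (hP : P ≠ 0) :
    Function.Injective (algebraMap O[X] (QAlg q P)) :=
  IsLocalization.injective _ (denoms_le_nonZeroDivisors q P hq hP)

theorem isDomain_QAlg (hq : q ≠ 0) (hP : P ≠ 0) : IsDomain (QAlg q P) :=
  IsLocalization.isDomain_of_le_nonZeroDivisors _ (denoms_le_nonZeroDivisors q P hq hP)

theorem sig_injective (hq : q ≠ 0) (hP : P ≠ 0) : Function.Injective (QAlg.sig q P) := by
  have := isDomain_QAlg hq hP
  rw [injective_iff_map_eq_zero]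
  intro a ha
  obtain ⟨p, s, rfl⟩ := IsLocalization.exists_mk'_eq (denoms q P) a
  have h1 : QAlg.sig q P (algebraMap O[X] (QAlg q P) p) = 0 := by
    rw [← IsLocalization.mk'_spec (QAlg q P) p s, map_mul, ha, zero_mul]
  rw [sig_algebraMap, map_eq_zero_iff _ (algebraMap_QAlg_injective hq hP)] at h1
  have hp : p = 0 := by
    by_contra hp
    exact shift_ne_zero hq hp h1
  rw [hp, IsLocalization.mk'_zero]

/-- `1 + x c` is a nonzerodivisor modulo `q`. -/
theorem q_dvd_of_dvd_mul (hq : q ≠ 0) (hP : P ≠ 0) {a c : QAlg q P}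
    (h : QAlg.constQ q P ∣ (1 + QAlg.varX q P * c) * a) : QAlg.constQ q P ∣ a := by
  obtain ⟨p, s, rfl⟩ := IsLocalization.exists_mk'_eq (denoms q P) c
  obtain ⟨f, s', rfl⟩ := IsLocalization.exists_mk'_eq (denoms q P) a
  obtain ⟨y, hy⟩ := h
  obtain ⟨f₂, s₂, rfl⟩ := IsLocalization.exists_mk'_eq (denoms q P) y
  have e1 := IsLocalization.mk'_spec (QAlg q P) p s
  have e2 := IsLocalization.mk'_spec (QAlg q P) f s'
  have e3 := IsLocalization.mk'_spec (QAlg q P) f₂ s₂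
  set c := IsLocalization.mk' (QAlg q P) p s
  set a := IsLocalization.mk' (QAlg q P) f s'
  set y := IsLocalization.mk' (QAlg q P) f₂ s₂
  -- Clearing denominators turns the divisibility into an identity of polynomials. The factor `g`
  -- below has the constant term of the denominator $s_2s$, which is a unit modulo $q$ in the
  -- algebra although not necessarily in $O/q$.
  have hpoly : ((s₂ : O[X]) * ((s : O[X]) + X * p)) * f = C q * ((s * s' : O[X]) * f₂) := by
    refine algebraMap_QAlg_injective hq hP ?_
    simp only [map_mul, map_add]
    rw [← e1, ← e2, ← e3]
    linear_combination (algebraMap O[X] (QAlg q P) s) * (algebraMap O[X] (QAlg q P) s') *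
      (algebraMap O[X] (QAlg q P) s₂) * hy
  set g := (s₂ : O[X]) * ((s : O[X]) + X * p)
  have hg0 : g.coeff 0 = ((s₂ * s : denoms q P) : O[X]).coeff 0 := by
    simp [g, mul_coeff_zero]
  have hmod : (g.map (Ideal.Quotient.mk (Ideal.span {q}))) *
      (f.map (Ideal.Quotient.mk (Ideal.span {q}))) = 0 := by
    rw [← Polynomial.map_mul, hpoly, Polynomial.map_mul, Polynomial.map_C,
      Ideal.Quotient.eq_zero_iff_mem.2 (Ideal.mem_span_singleton_self q), C_0, zero_mul]
  -- The exponent $\deg f+1$ is large enough for all nonzero coefficients of $f$ at once.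
  have hdvd : C q ∣ C (g.coeff 0 ^ (f.natDegree + 1)) * f := by
    rw [C_dvd_iff_dvd_coeff]
    intro n
    rw [coeff_C_mul]
    by_cases hn : n ≤ f.natDegree
    · have := coeff_zero_pow_mul_coeff_eq_zero hmod n
      rw [coeff_map, coeff_map, ← map_pow, ← map_mul, Ideal.Quotient.eq_zero_iff_mem,
        Ideal.mem_span_singleton] at this
      obtain ⟨r, hr⟩ := Nat.exists_eq_add_of_le hn
      rw [hr, add_right_comm, pow_add, mul_right_comm]
      exact Dvd.dvd.mul_right this _
    · rw [coeff_eq_zero_of_natDegree_lt (p := f) (by omega), mul_zero]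
      exact dvd_zero _
  have hdvd' := map_dvd (algebraMap O[X] (QAlg q P)) hdvd
  rw [map_mul] at hdvd'
  have hu : IsUnit (Ideal.Quotient.mk (Ideal.span {QAlg.constQ q P})
      (algebraMap O[X] (QAlg q P) (C (g.coeff 0 ^ (f.natDegree + 1))))) := by
    rw [C_pow, map_pow, map_pow, hg0]
    exact (isUnit_mk_coeff_zero (s₂ * s).2).pow _
  have hf : QAlg.constQ q P ∣ algebraMap O[X] (QAlg q P) f := by
    rw [← Ideal.mem_span_singleton, ← Ideal.Quotient.eq_zero_iff_mem, map_mul] at hdvd'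
    rw [← Ideal.mem_span_singleton, ← Ideal.Quotient.eq_zero_iff_mem]
    exact hu.mul_right_eq_zero.1 hdvd'
  rw [← e2] at hf
  exact (IsLocalization.map_units (QAlg q P) s').dvd_mul_right.1 hf

theorem q_pow_dvd_of_dvd_mul (hq : q ≠ 0) (hP : P ≠ 0) {a c : QAlg q P} (n : ℕ)
    (h : QAlg.constQ q P ^ n ∣ (1 + QAlg.varX q P * c) * a) : QAlg.constQ q P ^ n ∣ a := by
  have := isDomain_QAlg hq hP
  have hq0 : QAlg.constQ q P ≠ 0 := by
    rwa [Ne, map_eq_zero_iff _ (algebraMap_QAlg_injective hq hP), C_eq_zero]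
  induction n generalizing a with
  | zero => simp
  | succ n ih =>
    obtain ⟨b, rfl⟩ := q_dvd_of_dvd_mul hq hP ((dvd_pow_self _ n.succ_ne_zero).trans h)
    rw [pow_succ'] at h ⊢
    rw [mul_left_comm] at h
    exact mul_dvd_mul_left _ (ih ((mul_dvd_mul_iff_left hq0).1 h))

end Arithmetic

/-! ### Lattices -/

theorem exists_dualBasis (R M : Type*) [CommRing R] [AddCommGroup M] [Module R M]
    [Module.Finite R M] [Module.Projective R M] :
    ∃ (m : ℕ) (e : Fin m → M) (g : Fin m → M →ₗ[R] R), ∀ x, x = ∑ i, g i x • e i := by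
  obtain ⟨m, f, g, -, -, hfg⟩ := Module.Finite.exists_comp_eq_id_of_projective R M
  refine ⟨m, fun i => f fun j => if i = j then 1 else 0, fun i => LinearMap.proj i ∘ₗ g,
    fun x => ?_⟩
  exact (LinearMap.congr_fun hfg x).symm.trans (LinearMap.pi_apply_eq_sum_univ f (g x))

/-- The operator `Σ` as a semilinear map. -/
def Obj.sigLin {B : Type u} [CommRing B] {D : GenDiffRing B} (N : Obj D) : N →ₛₗ[D.sig] N where
  toFun := N.sig
  map_add' := map_add _
  map_smul' := N.sig_smul

@[simp] theorem Obj.sigLin_apply {B : Type u} [CommRing B] {D : GenDiffRing B} (N : Obj D) (n : N) :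
    N.sigLin n = N.sig n := rfl

theorem Obj.span_range_sigLin {B : Type u} [CommRing B] {D : GenDiffRing B} (N : Obj D) :
    Submodule.span B (Set.range N.sigLin) = ⊤ := N.span_eq_top

/-- Every saturated submodule `L` of a module with connection that is stable under `Δ` is
projective, and `Σ(L)` generates `L`. -/
def HasLattices {B : Type u} [CommRing B] (D : GenDiffRing B) : Prop :=
  ∀ (T : Obj D) (L : Submodule B T), IsSaturated L → (∀ t ∈ L, T.del t ∈ L) →
    Module.Projective B L ∧ L ≤ Submodule.span B (T.sig '' L)

/-! ### Generation of saturated stable submodules by $\Sigma$ -/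

section QAlg

variable {O : Type u} [CommRing O] {q : O} {P : O[X]} {D : GenDiffRing (QAlg q P)}

/-- Up to a power of `q` and a denominator, every element of `T` is in `Σ(T)`. -/
theorem exists_smul_eq_sig (hD : D.sig = QAlg.sig q P) (T : Obj D) (t : T) :
    ∃ (n : ℕ) (s : denoms q P) (t' : T),
      (QAlg.constQ q P ^ n * algebraMap O[X] (QAlg q P) s) • t = T.sig t' := by
  -- A polynomial factor can be moved inside $\Sigma$ at the cost of a power of $q$; this is what
  -- allows linear combinations of values of $\Sigma$ to be written as single values.
  have key : ∀ (p : O[X]) (t : T), ∃ (n : ℕ) (t' : T),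
      (QAlg.constQ q P ^ n * algebraMap O[X] (QAlg q P) p) • T.sig t = T.sig t' := by
    intro p t
    obtain ⟨n, p', hp⟩ := exists_pow_mul_eq_shift q p
    refine ⟨n, algebraMap O[X] (QAlg q P) p' • t, ?_⟩
    rw [T.sig_smul, hD, sig_algebraMap, ← hp, map_mul, C_pow, map_pow]
  have ht : t ∈ Submodule.span (QAlg q P) (Set.range T.sigLin) := by
    rw [T.span_range_sigLin]; trivial
  induction ht using Submodule.span_induction with
  | mem x hx =>
    obtain ⟨y, rfl⟩ := hx
    exact ⟨0, 1, y, by simp⟩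
  | zero => exact ⟨0, 1, 0, by simp⟩
  | add x y _ _ hx hy =>
    obtain ⟨n, s, x', hx'⟩ := hx
    obtain ⟨m, r, y', hy'⟩ := hy
    obtain ⟨i, x'', hx''⟩ := key r x'
    obtain ⟨j, y'', hy''⟩ := key s y'
    refine ⟨n + m + i + j, s * r, QAlg.constQ q P ^ (m + j) • x'' +
      QAlg.constQ q P ^ (n + i) • y'', ?_⟩
    have hqs : ∀ k, D.sig (QAlg.constQ q P ^ k) = QAlg.constQ q P ^ k := fun k => by
      rw [hD, map_pow, sig_algebraMap, shift_C]
    rw [map_add, T.sig_smul, T.sig_smul, hqs, hqs, ← hx'', ← hy'', ← hx', ← hy', smul_add,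
      smul_smul, smul_smul, smul_smul, smul_smul, Submonoid.coe_mul, map_mul]
    congr 2 <;> ring
  | smul a x _ hx =>
    obtain ⟨n, s, x', hx'⟩ := hx
    obtain ⟨p, r, rfl⟩ := IsLocalization.exists_mk'_eq (denoms q P) a
    obtain ⟨m, y, hy⟩ := key p x'
    refine ⟨n + m, s * r, y, ?_⟩
    rw [← hy, ← hx', smul_smul, smul_smul, Submonoid.coe_mul, map_mul,
      ← IsLocalization.mk'_spec (QAlg q P) p r]
    congr 1
    ring

section Sub

variable {T : Obj D} {L : Submodule (QAlg q P) T}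

theorem sig_mem_of_del_mem (hΔ : ∀ t ∈ L, T.del t ∈ L) {t : T} (ht : t ∈ L) : T.sig t ∈ L :=
  L.add_mem ht (L.smul_mem _ (hΔ t ht))

/-- This is the generation statement modulo $x$: there $\Sigma$ becomes a linear surjective
endomorphism of $T/xT$ that preserves the image of $L$, and such an endomorphism maps the image of
$L$ onto itself. -/
theorem exists_sig_add_smul [IsNoetherianRing (QAlg q P)] (hD : D.sig = QAlg.sig q P)
    (hΔ : ∀ t ∈ L, T.del t ∈ L) {l : T} (hl : l ∈ L) :
    ∃ l' ∈ L, ∃ t, l = T.sig l' + QAlg.varX q P • t := by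
  let J : Submodule (QAlg q P) T := LinearMap.range (LinearMap.lsmul _ T (QAlg.varX q P))
  have hJ : ∀ t, t ∈ J ↔ ∃ t', t = QAlg.varX q P • t' := fun t =>
    ⟨fun ⟨t', h⟩ => ⟨t', h.symm⟩, fun ⟨t', h⟩ => ⟨t', h.symm⟩⟩
  -- Linearity holds because $\sigma$ is the identity modulo $x$; the map descends because
  -- $\Sigma(xt)=qx\,\Sigma(t)$.
  let S : (T ⧸ J) →ₗ[QAlg q P] (T ⧸ J) :=
    J.liftQ { toFun := fun t => Submodule.Quotient.mk (T.sig t)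
              map_add' := fun x y => by rw [map_add, Submodule.Quotient.mk_add]
              map_smul' := fun a t => by
                rw [T.sig_smul, RingHom.id_apply, ← Submodule.Quotient.mk_smul,
                  Submodule.Quotient.eq, ← sub_smul, hJ, hD]
                obtain ⟨c, hc⟩ := x_dvd_sig_sub a
                exact ⟨c • T.sig t, by rw [hc, mul_smul]⟩ } (by
      intro t ht
      obtain ⟨t', rfl⟩ := (hJ t).1 ht
      rw [LinearMap.mem_ker]
      refine (Submodule.Quotient.mk_eq_zero J).2 ((hJ _).2 ?_)
      rw [T.sig_smul, hD, sig_algebraMap, shift_X, map_mul, mul_comm, mul_smul]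
      exact ⟨_, rfl⟩)
  have hSmk : ∀ t : T, S (Submodule.Quotient.mk t) = Submodule.Quotient.mk (T.sig t) := fun _ => rfl
  have hsurj : Function.Surjective S := by
    rw [← LinearMap.range_eq_top, eq_top_iff]
    have h1 : Submodule.span (QAlg q P) (Set.range T.sigLin) ≤ (LinearMap.range S).comap J.mkQ := by
      rw [Submodule.span_le]
      rintro _ ⟨t, rfl⟩
      exact ⟨Submodule.Quotient.mk t, rfl⟩
    rw [T.span_range_sigLin] at h1
    rintro x -
    obtain ⟨t, rfl⟩ := Submodule.Quotient.mk_surjective _ x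
    exact h1 (Submodule.mem_top (x := t))
  have hinj : Function.Injective S := IsNoetherian.injective_of_surjective_endomorphism S hsurj
  let L₀ := L.map J.mkQ
  have hL₀ : L₀ ≤ L₀.comap S := by
    rintro _ ⟨l, hl, rfl⟩
    exact ⟨T.sig l, sig_mem_of_del_mem hΔ hl, rfl⟩
  -- The preimages of $L_0$ under the powers of $S$ form an ascending chain. Once it is stationary
  -- at $n$, an element $y$ with $S^{n+1}y=\bar l$ already satisfies $S^ny\in L_0$, and $S^ny$ is
  -- the required preimage of $\bar l$ under $S$.
  have hmono : Monotone fun n : ℕ => L₀.comap (S ^ n) := by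
    refine monotone_nat_of_le_succ fun n x hx => ?_
    rw [Submodule.mem_comap, pow_succ']
    exact hL₀ hx
  obtain ⟨n, hn⟩ := monotone_stabilizes_iff_noetherian.2
    (inferInstance : IsNoetherian (QAlg q P) (T ⧸ J)) ⟨_, hmono⟩
  have hn' : L₀.comap (S ^ n) = L₀.comap (S ^ (n + 1)) := hn (n + 1) (Nat.le_succ n)
  have hsn : Function.Surjective (S ^ (n + 1)) := by
    rw [Module.End.coe_pow]; exact hsurj.iterate _
  obtain ⟨y, hy⟩ := hsn (Submodule.Quotient.mk l)
  have hy' : y ∈ L₀.comap (S ^ n) := by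
    rw [hn', Submodule.mem_comap, hy]
    exact ⟨l, hl, rfl⟩
  obtain ⟨l', hl', hl''⟩ := hy'
  rw [pow_succ', Module.End.mul_apply, ← hl'', Submodule.mkQ_apply, hSmk, eq_comm,
    Submodule.Quotient.eq, hJ] at hy
  obtain ⟨t, ht⟩ := hy
  exact ⟨l', hl', t, by rw [← ht]; abel⟩

variable [IsDomain O]

/-- The operator induced by $\Sigma$ on the torsion-free quotient $T/L$ has spanning image, so it is
injective. -/
theorem mem_of_sig_mem (hD : D.sig = QAlg.sig q P) (hq : q ≠ 0) (hP : P ≠ 0)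
    (hL : IsSaturated L) (hΔ : ∀ t ∈ L, T.del t ∈ L) {t : T} (ht : T.sig t ∈ L) : t ∈ L := by
  have := isDomain_QAlg hq hP
  have htf : Module.IsTorsionFree (QAlg q P) (T ⧸ L) := by
    refine Module.isTorsionFree_iff_smul_eq_zero.2 fun c m hm => ?_
    obtain ⟨t, rfl⟩ := Submodule.Quotient.mk_surjective _ m
    by_cases hc : c = 0
    · exact Or.inl hc
    · right
      rw [← Submodule.Quotient.mk_smul, Submodule.Quotient.mk_eq_zero] at hm
      rw [Submodule.Quotient.mk_eq_zero]
      exact hL c t hc hm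
  let S := L.mapQ L T.sigLin fun t ht => sig_mem_of_del_mem hΔ ht
  have hS : Submodule.span (QAlg q P) (Set.range S) = ⊤ := by
    have h1 : Submodule.map L.mkQ (Submodule.span (QAlg q P) (Set.range T.sigLin)) ≤
        Submodule.span (QAlg q P) (Set.range S) := by
      rw [Submodule.map_span, Submodule.span_le]
      rintro _ ⟨_, ⟨t, rfl⟩, rfl⟩
      exact Submodule.subset_span ⟨L.mkQ t, rfl⟩
    rw [T.span_range_sigLin, Submodule.map_top, Submodule.range_mkQ, top_le_iff] at h1
    exact h1
  have hinj := injective_of_semilinear (hD ▸ sig_injective hq hP) S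
    fun n => ⟨1, one_ne_zero, by rw [hS]; trivial⟩
  rw [← Submodule.Quotient.mk_eq_zero]
  refine hinj ?_
  rw [map_zero]
  exact (Submodule.Quotient.mk_eq_zero L).2 ht

/-- Each $l\in L$ reaches the span $K$ of $\Sigma(L)$ after multiplication by a power of $q$, and
also after multiplication by a fixed $1+xc$. Since $1+xc$ is a nonzerodivisor modulo $q$, the power
of $q$ can be divided out in coordinates. -/
theorem le_span_sig_image [IsNoetherianRing (QAlg q P)] (hD : D.sig = QAlg.sig q P) (hq : q ≠ 0) (hP : P ≠ 0)
    (hL : IsSaturated L) (hΔ : ∀ t ∈ L, T.del t ∈ L) [Module.Projective (QAlg q P) L] :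
    L ≤ Submodule.span (QAlg q P) (T.sig '' L) := by
  have := isDomain_QAlg hq hP
  set K := Submodule.span (QAlg q P) (T.sig '' L)
  have hq0 : QAlg.constQ q P ≠ 0 := by
    rwa [Ne, map_eq_zero_iff _ (algebraMap_QAlg_injective hq hP), C_eq_zero]
  have hx : QAlg.varX q P ≠ 0 := by
    rw [Ne, map_eq_zero_iff _ (algebraMap_QAlg_injective hq hP)]
    exact X_ne_zero
  -- Write $q^ns\,l=\Sigma(t)$ with a denominator $s$, which is a unit. The element $t$ of $T$ lies
  -- in $L$ because $\Sigma(t)$ does.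
  have hpow : ∀ l ∈ L, ∃ n : ℕ, QAlg.constQ q P ^ n • l ∈ K := by
    intro l hl
    obtain ⟨n, s, t, ht⟩ := exists_smul_eq_sig hD T l
    have htL : t ∈ L := mem_of_sig_mem hD hq hP hL hΔ (ht ▸ L.smul_mem _ hl)
    refine ⟨n, ?_⟩
    obtain ⟨u, hu⟩ := IsLocalization.map_units (QAlg q P) s
    have h1 : QAlg.constQ q P ^ n • l = (↑u⁻¹ : QAlg q P) • T.sig t := by
      rw [← ht, smul_smul, ← hu, mul_comm (QAlg.constQ q P ^ n), ← mul_assoc, Units.inv_mul, one_mul]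
    rw [h1]
    exact K.smul_mem _ (Submodule.subset_span ⟨t, htL, rfl⟩)
  -- Saturation moves the error term from $xT$ into $xL$, so $L\subseteq K+xL$, and Nakayama's lemma
  -- for the image of $L$ in $T/K$ gives an annihilator congruent to $1$ modulo $x$.
  obtain ⟨c, hc⟩ : ∃ c : QAlg q P, ∀ l ∈ L, (1 + QAlg.varX q P * c) • l ∈ K := by
    obtain ⟨r, hr, hr'⟩ := Submodule.exists_sub_one_mem_and_smul_eq_zero_of_fg_of_le_smul
      (Ideal.span {QAlg.varX q P}) (L.map K.mkQ) (IsNoetherian.noetherian _) (by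
        rintro _ ⟨l, hl, rfl⟩
        obtain ⟨l', hl', t, rfl⟩ := exists_sig_add_smul hD hΔ hl
        have htL : t ∈ L := hL _ t hx
          ((L.add_mem_iff_right (sig_mem_of_del_mem hΔ hl')).1 hl)
        rw [map_add, map_smul, Submodule.mkQ_apply _ (T.sig l'),
          (Submodule.Quotient.mk_eq_zero K).2 (Submodule.subset_span ⟨l', hl', rfl⟩), zero_add]
        exact Submodule.smul_mem_smul (Ideal.mem_span_singleton_self _) ⟨t, htL, rfl⟩)
    obtain ⟨c, hc⟩ := Ideal.mem_span_singleton.1 hr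
    refine ⟨c, fun l hl => ?_⟩
    rw [← hc, add_sub_cancel, ← Submodule.Quotient.mk_eq_zero]
    exact hr' _ ⟨l, hl, rfl⟩
  let S : L →ₛₗ[D.sig] L := T.sigLin.restrict fun t ht => sig_mem_of_del_mem hΔ ht
  have hKS : K = (Submodule.span (QAlg q P) (Set.range S)).map L.subtype := by
    rw [Submodule.map_span, ← Set.range_comp]
    refine congrArg (Submodule.span _) (Set.ext fun t => ⟨?_, ?_⟩)
    · rintro ⟨l, hl, rfl⟩
      exact ⟨⟨l, hl⟩, rfl⟩
    · rintro ⟨l, rfl⟩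
      exact ⟨l.1, l.2, rfl⟩
  have hmem : ∀ l : L, (l : T) ∈ K → l ∈ Submodule.span (QAlg q P) (Set.range S) := by
    intro l hl
    rw [hKS] at hl
    obtain ⟨l', hl', h⟩ := hl
    rwa [← Subtype.ext h]
  have hS : ∀ l : L, ∃ b : QAlg q P, b ≠ 0 ∧
      b • l ∈ Submodule.span (QAlg q P) (Set.range S) := fun l => by
    obtain ⟨n, hn⟩ := hpow l l.2
    exact ⟨_, pow_ne_zero n hq0, hmem _ hn⟩
  obtain ⟨m, e, g, hdual⟩ := exists_dualBasis (QAlg q P) L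
  let ψ : Fin m → (L →ₛₗ[D.sig] QAlg q P) := fun i =>
    { toFun := fun l => D.sig (g i l)
      map_add' := by simp
      map_smul' := by simp }
  -- The functionals $\varphi_i$, with values in the fraction field, satisfy $\varphi_i(\Sigma
  -- l)=\sigma(g_i(l))$. On the span of $\Sigma(L)$ they take values in $B$ and give linear
  -- coordinates with respect to the generators $\Sigma(e_i)$.
  choose φ hφ using fun i => exists_linearMap_of_semilinear (FractionRing (QAlg q P))
    (hD ▸ sig_injective hq hP) S hS (ψ i)
  have hspan : ∀ l ∈ Submodule.span (QAlg q P) (Set.range S), ∃ a : Fin m → QAlg q P,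
      (∀ i, φ i l = algebraMap _ _ (a i)) ∧ l = ∑ i, a i • S (e i) := by
    intro l hl
    induction hl using Submodule.span_induction with
    | mem y hy =>
      obtain ⟨l, rfl⟩ := hy
      refine ⟨fun i => D.sig (g i l), fun i => hφ i l, ?_⟩
      conv_lhs => rw [hdual l, map_sum]
      refine Finset.sum_congr rfl fun i _ => ?_
      rw [map_smulₛₗ]
    | zero => exact ⟨0, by simp, by simp⟩
    | add y z _ _ hy hz =>
      obtain ⟨a, ha, ha'⟩ := hy
      obtain ⟨b, hb, hb'⟩ := hz
      refine ⟨a + b, fun i => by simp [ha, hb], ?_⟩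
      conv_lhs => rw [ha', hb']
      simp [add_smul, Finset.sum_add_distrib]
    | smul c y _ hy =>
      obtain ⟨a, ha, ha'⟩ := hy
      refine ⟨c • a, fun i => by simp [ha, Algebra.smul_def], ?_⟩
      conv_lhs => rw [ha']
      simp [Finset.smul_sum, smul_smul]
  intro l hl
  obtain ⟨n, hn⟩ := hpow l hl
  obtain ⟨a, ha, ha'⟩ := hspan (QAlg.constQ q P ^ n • ⟨l, hl⟩) (hmem _ hn)
  obtain ⟨b, hb, -⟩ := hspan ((1 + QAlg.varX q P * c) • ⟨l, hl⟩) (hmem _ (hc l hl))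
  -- With $a_i=\varphi_i(q^nl)$ and $b_i=\varphi_i((1+xc)l)$, linearity gives $(1+xc)a_i=q^nb_i$.
  have hdvd : ∀ i, QAlg.constQ q P ^ n ∣ a i := by
    intro i
    refine q_pow_dvd_of_dvd_mul hq hP (c := c) n ⟨b i, ?_⟩
    refine IsFractionRing.injective (QAlg q P) (FractionRing (QAlg q P)) ?_
    rw [map_mul, map_mul, ← ha, ← hb, map_smul, map_smul, Algebra.smul_def, Algebra.smul_def]
    ring
  choose d hd using hdvd
  have hl' : (⟨l, hl⟩ : L) = ∑ i, d i • S (e i) := by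
    have h1 : QAlg.constQ q P ^ n • (⟨l, hl⟩ : L) =
        QAlg.constQ q P ^ n • ∑ i, d i • S (e i) := by
      rw [ha', Finset.smul_sum]
      refine Finset.sum_congr rfl fun i _ => ?_
      rw [hd, mul_smul]
    exact smul_right_injective L (pow_ne_zero n hq0) h1
  have : (⟨l, hl⟩ : L) ∈ Submodule.span (QAlg q P) (Set.range S) := by
    rw [hl']
    exact Submodule.sum_mem _ fun i _ => Submodule.smul_mem _ _ (Submodule.subset_span ⟨_, rfl⟩)
  rw [hKS]
  exact ⟨_, this, rfl⟩

end Sub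

theorem hasLattices_of_isDedekindDomain [IsDedekindDomain O] (hD : D.sig = QAlg.sig q P)
    (hq : q ≠ 0) (hP : P ≠ 0) : HasLattices D := by
  have := isDomain_QAlg hq hP
  have : IsNoetherianRing (QAlg q P) := IsLocalization.isNoetherianRing (denoms q P) _ inferInstance
  intro T L hL hΔ
  have h1 := projective_of_isSaturated (denoms q P) (denoms_le_nonZeroDivisors q P hq hP) hL
  exact ⟨h1, le_span_sig_image hD hq hP hL hΔ⟩

end QAlg

/-! ### Isomorphisms and duals -/

namespace Obj

section Basic

variable {B : Type u} [CommRing B] {D : GenDiffRing B}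

/-- The objects `N` and `N'` are isomorphic. -/
def IsIso (N N' : Obj D) : Prop := ∃ e : N ≃ₗ[B] N', IsHom N N' e.toLinearMap

theorem IsHom.comp {N N' N'' : Obj D} {g : N' →ₗ[B] N''} {f : N →ₗ[B] N'} (hg : IsHom N' N'' g)
    (hf : IsHom N N' f) : IsHom N N'' (g ∘ₗ f) := fun n => by
  rw [LinearMap.comp_apply, LinearMap.comp_apply, hf, hg]

theorem IsHom.symm {N N' : Obj D} {e : N ≃ₗ[B] N'} (he : IsHom N N' e.toLinearMap) :
    IsHom N' N e.symm.toLinearMap := fun n => by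
  apply e.injective
  have := he (e.symm n)
  simp only [LinearEquiv.coe_coe, LinearEquiv.apply_symm_apply] at this ⊢
  exact this.symm

theorem IsHom.sig {N N' : Obj D} {f : N →ₗ[B] N'} (hf : IsHom N N' f) (n : N) :
    f (N.sig n) = N'.sig (f n) := by
  rw [sig_apply, sig_apply, map_add, map_smul, hf]

theorem IsIso.refl (N : Obj D) : IsIso N N := ⟨LinearEquiv.refl B N, fun _ => rfl⟩

theorem IsIso.symm {N N' : Obj D} (h : IsIso N N') : IsIso N' N :=
  let ⟨e, he⟩ := h
  ⟨e.symm, he.symm⟩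

theorem IsIso.trans {N N' N'' : Obj D} (h : IsIso N N') (h' : IsIso N' N'') : IsIso N N'' :=
  let ⟨e, he⟩ := h
  let ⟨e', he'⟩ := h'
  ⟨e.trans e', he'.comp he⟩

theorem isHom_fst (N N' : Obj D) : IsHom (N.prod N') N (LinearMap.fst B N N') := fun _ => rfl

theorem isHom_snd (N N' : Obj D) : IsHom (N.prod N') N' (LinearMap.snd B N N') := fun _ => rfl

theorem IsIso.prod {N N' M M' : Obj D} (h : IsIso N M) (h' : IsIso N' M') :
    IsIso (N.prod N') (M.prod M') := by
  obtain ⟨e, he⟩ := h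
  obtain ⟨e', he'⟩ := h'
  exact ⟨LinearEquiv.prodCongr e e', fun n => Prod.ext (he n.1) (he' n.2)⟩

theorem IsHom.tensor {N N' M M' : Obj D} {f : N →ₗ[B] M} {f' : N' →ₗ[B] M'} (hf : IsHom N M f)
    (hf' : IsHom N' M' f') : IsHom (N.tensor N') (M.tensor M') (TensorProduct.map f f') := by
  intro t
  change TensorProduct.map f f' (tensorDel N N' t) = tensorDel M M' (TensorProduct.map f f' t)
  induction t using TensorProduct.induction_on with
  | zero => simp
  | tmul n n' => simp only [tensorDel_tmul, map_add, TensorProduct.map_tmul, hf n, hf' n', hf.sig]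
  | add x y hx hy => simp only [map_add, hx, hy]

theorem IsIso.tensor {N N' M M' : Obj D} (h : IsIso N M) (h' : IsIso N' M') :
    IsIso (N.tensor N') (M.tensor M') := by
  obtain ⟨e, he⟩ := h
  obtain ⟨e', he'⟩ := h'
  exact ⟨TensorProduct.congr e e', he.tensor he'⟩

theorem IsHom.prol {N M : Obj D} {f : N →ₗ[B] M} (hf : IsHom N M f) :
    IsHom N.prol M.prol (Prol.map D.der f) := fun n => Prod.ext (hf n.1) (hf n.2)

theorem IsIso.prol {N M : Obj D} (h : IsIso N M) : IsIso N.prol M.prol := by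
  obtain ⟨e, he⟩ := h
  refine ⟨LinearEquiv.ofLinearMap (Prol.map D.der e.toLinearMap)
    (Prol.map D.der e.symm.toLinearMap) ?_ ?_, he.prol⟩
  · ext x
    exact Prod.ext (e.apply_symm_apply x.1) (e.apply_symm_apply x.2)
  · ext x
    exact Prod.ext (e.symm_apply_apply x.1) (e.symm_apply_apply x.2)

/-- Two linear maps that agree on the image of `Σ` are equal. -/
theorem ext_sig {N : Obj D} {X : Type*} [AddCommGroup X] [Module B X] {f g : N →ₗ[B] X}
    (h : ∀ n, f (N.sig n) = g (N.sig n)) : f = g := by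
  refine LinearMap.ext_on_range (v := N.sig) N.span_eq_top h

/-- The compatibility of a pairing with the connections. -/
def IsFlat {N N' : Obj D} (p : N' →ₗ[B] N →ₗ[B] B) : Prop :=
  ∀ (f : N') (n : N), D.del (p f n) = p (N'.del f) n + p (N'.sig f) (N.del n)

/-- Since $\Sigma f=f+h\Delta f$, the term $h\,p(\Delta f,\Delta n)$ can be absorbed into $p(\Delta
f,\Sigma n)$. In this form the connection on the dual is determined by the one on $N$, because
$\Sigma(N)$ generates $N$. -/
theorem isFlat_iff {N N' : Obj D} {p : N' →ₗ[B] N →ₗ[B] B} :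
    IsFlat p ↔ ∀ (f : N') (n : N), p (N'.del f) (N.sig n) = D.del (p f n) - p f (N.del n) := by
  refine forall₂_congr fun f n => ?_
  rw [sig_apply, sig_apply, map_add, map_add, LinearMap.add_apply, map_smul, map_smul,
    LinearMap.smul_apply, eq_sub_iff_add_eq, eq_comm (a := D.del _), ← add_assoc]
  constructor <;> intro h <;> rw [← h] <;> abel

theorem IsDual.symm {N N' : Obj D} (h : IsDual N N') : IsDual N' N := by
  obtain ⟨p, hp, hp'⟩ := h
  refine ⟨p.flip, hp.flip, fun n f => ?_⟩
  have := isFlat_iff.1 hp' f n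
  rw [LinearMap.flip_apply, LinearMap.flip_apply, LinearMap.flip_apply, this]
  abel

theorem IsDual.of_isIso {N N' M : Obj D} (h : IsDual N N') (e : IsIso M N) : IsDual M N' := by
  obtain ⟨p, hp, hp'⟩ := h
  obtain ⟨e, he⟩ := e
  refine ⟨p.compl₁₂ (LinearEquiv.refl B N').toLinearMap e.toLinearMap, inferInstance,
    fun f n => ?_⟩
  have := hp' f (e n)
  simp only [LinearMap.compl₁₂_apply, LinearEquiv.coe_coe, LinearEquiv.refl_apply]
  rw [this]
  congr 2
  exact (he n).symm

/-- The transpose of a morphism. -/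
theorem exists_transpose {N N' M M' : Obj D} {p : N' →ₗ[B] N →ₗ[B] B} {r : M' →ₗ[B] M →ₗ[B] B}
    (hp : p.IsPerfPair) (hp' : IsFlat p) (hr' : IsFlat r) {f : N →ₗ[B] M} (hf : IsHom N M f) :
    ∃ t : M' →ₗ[B] N', IsHom M' N' t ∧ ∀ m n, p (t m) n = r m (f n) := by
  let t : M' →ₗ[B] N' := p.toPerfPair.symm.toLinearMap ∘ₗ (LinearMap.lcomp B B f) ∘ₗ r
  have ht : ∀ m n, p (t m) n = r m (f n) := fun m n => by simp [t]
  refine ⟨t, fun m => ?_, ht⟩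
  apply hp.bijective_left.1
  refine ext_sig fun n => ?_
  rw [ht, isFlat_iff.1 hp', ht, ht, hf.sig, isFlat_iff.1 hr', hf]

/-- The isomorphism and its inverse are the transposes of the identity of $N$ for the two pairings.
-/
theorem IsDual.unique {N N' N'' : Obj D} (h : IsDual N N') (h' : IsDual N N'') : IsIso N' N'' := by
  obtain ⟨p, hp, hp'⟩ := h
  obtain ⟨r, hr, hr'⟩ := h'
  obtain ⟨t, ht, hpt⟩ := exists_transpose hr hr' hp' (f := LinearMap.id) fun _ => rfl
  obtain ⟨t', _, hpt'⟩ := exists_transpose hp hp' hr' (f := LinearMap.id) fun _ => rfl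
  refine ⟨LinearEquiv.ofLinearMap t t' ?_ ?_, ht⟩
  · ext x
    apply hr.bijective_left.1
    ext n
    simp [hpt, hpt']
  · ext x
    apply hp.bijective_left.1
    ext n
    simp [hpt, hpt']

end Basic

/-! #### Existence of duals -/

section Dual

variable {B : Type u} [CommRing B] [IsDomain B] {D : GenDiffRing B}

/-- The right-hand side is semilinear in $n$, as the terms $\delta(b)f(n)$ cancel. A solution
therefore exists with values in the fraction field, and it takes values in $B$ because it does so on
$\Sigma(N)$, which generates $N$. The solution serves as $\Delta f$ on the dual. -/
theorem exists_dualDel (hσ : Function.Injective D.sig) (N : Obj D) (f : Module.Dual B N) :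
    ∃ φ : Module.Dual B N, ∀ n, φ (N.sig n) = D.del (f n) - f (N.del n) := by
  let ψ : N →ₛₗ[D.sig] B :=
    { toFun := fun n => D.del (f n) - f (N.del n)
      map_add' := fun x y => by simp only [map_add]; abel
      map_smul' := fun b n => by
        rw [map_smul, smul_eq_mul, D.del_mul, N.leibniz, map_add, map_smul, map_smul, smul_eq_mul,
          smul_eq_mul, smul_eq_mul]
        ring }
  obtain ⟨φ, hφ⟩ := exists_linearMap_of_semilinear (FractionRing B) hσ N.sigLin
    (fun n => ⟨1, one_ne_zero, by rw [N.span_range_sigLin]; trivial⟩) ψ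
  have hmem : ∀ n, φ n ∈ LinearMap.range (Algebra.linearMap B (FractionRing B)) := by
    have h1 : Submodule.span B (Set.range N.sigLin) ≤
        (LinearMap.range (Algebra.linearMap B (FractionRing B))).comap φ := by
      rw [Submodule.span_le]
      rintro _ ⟨n, rfl⟩
      exact ⟨ψ n, (hφ n).symm⟩
    rw [N.span_range_sigLin] at h1
    exact fun n => h1 Submodule.mem_top
  have hinj : Function.Injective (Algebra.linearMap B (FractionRing B)) :=
    IsFractionRing.injective B (FractionRing B)
  refine ⟨(LinearEquiv.ofInjective _ hinj).symm.toLinearMap ∘ₗ φ.codRestrict _ hmem, fun n => ?_⟩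
  apply hinj
  rw [LinearMap.comp_apply]
  have := LinearEquiv.apply_symm_apply (LinearEquiv.ofInjective _ hinj)
    (φ.codRestrict _ hmem (N.sig n))
  exact (congrArg Subtype.val this).trans (hφ n)

theorem exists_isDual (hσ : Function.Injective D.sig) (N : Obj D) : ∃ N' : Obj D, IsDual N N' := by
  choose d hd using exists_dualDel hσ N
  -- This is the expected formula $(\Sigma f)(\Sigma n)=\sigma(f(n))$ for the contragredient
  -- operator.
  have hsig : ∀ f n, (f + D.h • d f) (N.sig n) = D.sig (f n) := by
    intro f n
    rw [LinearMap.add_apply, LinearMap.smul_apply, hd, sig_apply, map_add, map_smul, D.sig_eq]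
    simp only [smul_eq_mul]
    ring
  let N' : Obj D :=
    { carrier := Module.Dual B N
      del := AddMonoidHom.mk' d fun f g => ext_sig fun n => by
        rw [LinearMap.add_apply, hd, hd, hd, LinearMap.add_apply, LinearMap.add_apply, map_add]
        abel
      leibniz := fun b f => ext_sig fun n => by
        change d (b • f) (N.sig n) = (D.del b • f + D.sig b • d f) (N.sig n)
        rw [hd, LinearMap.add_apply, LinearMap.smul_apply, LinearMap.smul_apply,
          LinearMap.smul_apply, LinearMap.smul_apply, hd, sig_apply, map_add, map_smul f, D.sig_eq]
        simp only [smul_eq_mul, D.del_mul, D.sig_eq]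
        ring
      span_eq_top := by
        rw [eq_top_iff]
        rintro f -
        obtain ⟨m, e, g, hg⟩ := exists_dualBasis B N
        -- If $(e_i,g_i)$ is a dual basis of $N$, then $(\Sigma e_i,\Sigma g_i)$ is one too, so the
        -- $\Sigma g_i$ generate the dual.
        have hf : f = ∑ i, f (N.sig (e i)) • (g i + D.h • d (g i)) := ext_sig fun n => by
          rw [LinearMap.sum_apply]
          simp only [LinearMap.smul_apply, hsig]
          conv_lhs => rw [hg n, map_sum, map_sum]
          refine Finset.sum_congr rfl fun i _ => ?_
          rw [N.sig_smul, map_smul, smul_eq_mul, smul_eq_mul, mul_comm]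
        rw [hf]
        exact Submodule.sum_mem _ fun i _ =>
          Submodule.smul_mem _ _ (Submodule.subset_span ⟨g i, rfl⟩) }
  refine ⟨N', LinearMap.id, inferInstanceAs (LinearMap.id (R := B)
    (M := Module.Dual B N)).IsPerfPair, isFlat_iff.2 fun f n => hd f n⟩

end Dual

end Obj

/-! ### Base change -/

namespace Prol

section Basic

variable {B : Type u} [CommRing B] {d : Derivation ℤ B B} {V : Type v}

variable (d) in
/-- The element `a + ∂(b)`. -/
def mk (a b : V) : Prol d V := ((a, b) : V × V)

theorem ext {x y : Prol d V} (h1 : x.1 = y.1) (h2 : x.2 = y.2) : x = y := Prod.ext h1 h2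

theorem mk_fst (a b : V) : (mk d a b).1 = a := rfl

theorem mk_snd (a b : V) : (mk d a b).2 = b := rfl

variable [AddCommGroup V]

theorem mk_add_mk (a b a' b' : V) : mk d a b + mk d a' b' = mk d (a + a') (b + b') := rfl

variable [Module B V]

theorem smul_mk (r : B) (a b : V) : r • mk d a b = mk d (r • a - d r • b) (r • b) := rfl

theorem map_mk {W : Type w} [AddCommGroup W] [Module B W] (f : V →ₗ[B] W) (a b : V) :
    map d f (mk d a b) = mk d (f a) (f b) := rfl

end Basic

variable {B : Type u} [CommRing B] {d : Derivation ℤ B B} {V : Type v} [AddCommGroup V]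
  [Module B V] {R : Type w} [CommRing R] [Algebra B R] {dR : Derivation ℤ R R}
  (hd : ∀ b, dR (algebraMap B R b) = algebraMap B R (d b))

theorem comparison_one_tmul (x : Prol d V) :
    comparison d dR hd ((1 : R) ⊗ₜ[B] x) = mk dR ((1 : R) ⊗ₜ[B] x.1) ((1 : R) ⊗ₜ[B] x.2) := by
  let _ : Module B (Prol dR (R ⊗[B] V)) := Module.compHom _ (algebraMap B R)
  have _ : IsScalarTower B R (Prol dR (R ⊗[B] V)) :=
    ⟨fun b r x => by rw [Algebra.smul_def, mul_smul]; rfl⟩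
  have : comparison d dR hd ((1 : R) ⊗ₜ[B] x) =
      (1 : R) • mk dR ((1 : R) ⊗ₜ[B] x.1) ((1 : R) ⊗ₜ[B] x.2) :=
    LinearMap.liftBaseChange_tmul _ _ _ _
  rw [this, one_smul]

theorem comparison_tmul (c : R) (x : Prol d V) :
    comparison d dR hd (c ⊗ₜ[B] x) = mk dR (c ⊗ₜ x.1 - dR c ⊗ₜ x.2) (c ⊗ₜ x.2) := by
  have : c ⊗ₜ[B] x = c • ((1 : R) ⊗ₜ[B] x) := by
    rw [TensorProduct.smul_tmul', smul_eq_mul, mul_one]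
  rw [this, map_smul, comparison_one_tmul, smul_mk]
  simp only [TensorProduct.smul_tmul', smul_eq_mul, mul_one]

/-- The prolongation is an extension of $V$ by $V$, and the comparison map is the identity on both
the subobject and the quotient after tensoring. For surjectivity, $\partial(c\otimes x)$ is obtained
from $c\otimes\partial(x)$ by adding the correction $\partial(c)\otimes x$. -/
theorem comparison_bijective : Function.Bijective (comparison (V := V) d dR hd) := by
  constructor
  · rw [injective_iff_map_eq_zero]
    intro z hz
    have h2 : ∀ z : R ⊗[B] Prol d V, (comparison d dR hd z).2 = (Prol.snd d V).lTensor R z := by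
      intro z
      induction z using TensorProduct.induction_on with
      | zero => rw [map_zero, map_zero]; rfl
      | tmul c x => rw [comparison_tmul]; rfl
      | add x y hx hy => rw [map_add, map_add, ← hx, ← hy]; rfl
    have hex : Function.Exact (Prol.inl d V) (Prol.snd d V) := by
      intro x
      constructor
      · intro (hx : x.2 = 0)
        exact ⟨x.1, ext rfl hx.symm⟩
      · rintro ⟨y, rfl⟩
        rfl
    obtain ⟨y, rfl⟩ := (lTensor_exact R hex (fun v => ⟨mk d 0 v, rfl⟩) z).1
      (by rw [← h2, hz]; rfl)
    have h1 : ∀ y : R ⊗[B] V, (comparison d dR hd ((Prol.inl d V).lTensor R y)).1 = y := by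
      intro y
      induction y using TensorProduct.induction_on with
      | zero => rw [map_zero, map_zero]; rfl
      | tmul c x =>
        rw [LinearMap.lTensor_tmul, comparison_tmul, mk_fst]
        change c ⊗ₜ[B] x - dR c ⊗ₜ[B] (0 : V) = _
        rw [TensorProduct.tmul_zero, sub_zero]
      | add x y hx hy =>
        rw [map_add, map_add]
        exact congrArg₂ (· + ·) hx hy
    have hy : y = 0 := by rw [← h1 y, hz]; rfl
    rw [hy, map_zero]
  · have h1 : ∀ y : R ⊗[B] V, mk dR y 0 ∈ LinearMap.range (comparison (V := V) d dR hd) := by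
      intro y
      induction y using TensorProduct.induction_on with
      | zero => exact zero_mem _
      | tmul c x =>
        refine ⟨c ⊗ₜ mk d x 0, ?_⟩
        rw [comparison_tmul, mk_fst, mk_snd, TensorProduct.tmul_zero, TensorProduct.tmul_zero,
          sub_zero]
      | add x y hx hy =>
        have := add_mem hx hy
        rwa [mk_add_mk, add_zero] at this
    have h2 : ∀ y : R ⊗[B] V, mk dR 0 y ∈ LinearMap.range (comparison (V := V) d dR hd) := by
      intro y
      induction y using TensorProduct.induction_on with
      | zero => exact zero_mem _
      | tmul c x =>
        have h3 : comparison d dR hd (c ⊗ₜ mk d 0 x) ∈ LinearMap.range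
          (comparison (V := V) d dR hd) := ⟨_, rfl⟩
        rw [comparison_tmul] at h3
        have := add_mem h3 (h1 (dR c ⊗ₜ x))
        rwa [mk_add_mk, mk_fst, mk_snd, TensorProduct.tmul_zero, add_zero, zero_sub,
          neg_add_cancel] at this
      | add x y hx hy =>
        have := add_mem hx hy
        rwa [mk_add_mk, add_zero] at this
    intro x
    have := add_mem (h1 x.1) (h2 x.2)
    rw [mk_add_mk, add_zero, zero_add] at this
    exact this

end Prol

namespace Obj

variable {B : Type u} [CommRing B] {D : GenDiffRing B}

/-- The pure tensor `n ⊗ n'`, as an element of the object `N ⊗ N'`. -/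
def tm {N N' : Obj D} (n : N) (n' : N') : N.tensor N' := (n ⊗ₜ[B] n' : N ⊗[B] N')

theorem tensor_del_tm {N N' : Obj D} (n : N) (n' : N') :
    (N.tensor N').del (tm n n') = tm (N.del n) n' + tm (N.sig n) (N'.del n') := rfl

theorem tensor_induction {N N' : Obj D} {p : N.tensor N' → Prop} (t : N.tensor N')
    (zero : p 0) (tmul : ∀ n n', p (tm n n')) (add : ∀ x y, p x → p y → p (x + y)) : p t :=
  TensorProduct.induction_on (motive := p) t zero tmul add

variable {F : Type u} [CommRing F] [Algebra B F] {E : GenDiffRing F} (hDE : D.IsMor E)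

/-- The canonical map `N → F ⊗ N`. -/
def inc (N : Obj D) : N →+ N.baseChange hDE := (TensorProduct.mk B F N 1).toAddMonoidHom

theorem smul_inc {N : Obj D} (c : F) (n : N) : c • inc hDE N n = (c ⊗ₜ[B] n : F ⊗[B] N) := by
  change c • ((1 : F) ⊗ₜ[B] n) = _
  rw [TensorProduct.smul_tmul', smul_eq_mul, mul_one]

theorem inc_smul {N : Obj D} (b : B) (n : N) :
    inc hDE N (b • n) = algebraMap B F b • inc hDE N n := by
  rw [smul_inc]
  change (1 : F) ⊗ₜ[B] (b • n) = _
  rw [← TensorProduct.smul_tmul, Algebra.smul_def, mul_one]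

theorem del_inc {N : Obj D} (n : N) :
    (N.baseChange hDE).del (inc hDE N n) = inc hDE N (N.del n) := by
  change E.del 1 ⊗ₜ[B] n + E.sig 1 ⊗ₜ[B] N.del n = (1 : F) ⊗ₜ[B] N.del n
  rw [E.del_one, map_one, TensorProduct.zero_tmul, zero_add]

theorem sig_inc {N : Obj D} (n : N) :
    (N.baseChange hDE).sig (inc hDE N n) = inc hDE N (N.sig n) := by
  rw [sig_apply, sig_apply, del_inc, map_add, inc_smul, hDE.h]

theorem bc_induction {N : Obj D} {p : N.baseChange hDE → Prop} (t : N.baseChange hDE)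
    (zero : p 0) (smul : ∀ (c : F) n, p (c • inc hDE N n)) (add : ∀ x y, p x → p y → p (x + y)) :
    p t :=
  TensorProduct.induction_on (motive := p) t zero (fun c n => by rw [← smul_inc]; exact smul c n) add

theorem bc_ext {N : Obj D} {X : Type*} [AddCommGroup X] [Module F X]
    {f g : N.baseChange hDE →ₗ[F] X} (h : ∀ n, f (inc hDE N n) = g (inc hDE N n)) : f = g := by
  ext t
  induction t using bc_induction hDE with
  | zero => rw [map_zero, map_zero]
  | smul c n => rw [map_smul, map_smul, h]
  | add x y hx hy => rw [map_add, map_add, hx, hy]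

theorem isHom_of_inc {N : Obj D} {V : Obj E} (f : N.baseChange hDE →ₗ[F] V)
    (h : ∀ n, f (inc hDE N (N.del n)) = V.del (f (inc hDE N n))) :
    IsHom (N.baseChange hDE) V f := by
  intro t
  induction t using bc_induction hDE with
  | zero => simp only [map_zero]
  | smul c n =>
    rw [(N.baseChange hDE).leibniz, map_add, map_smul, map_smul, map_smul, V.leibniz, del_inc, h]
  | add x y hx hy => simp only [map_add, hx, hy]

/-- The base change of a morphism. -/
def bcMap {N N' : Obj D} (f : N →ₗ[B] N') : N.baseChange hDE →ₗ[F] N'.baseChange hDE :=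
  f.baseChange F

theorem bcMap_inc {N N' : Obj D} (f : N →ₗ[B] N') (n : N) :
    bcMap hDE f (inc hDE N n) = inc hDE N' (f n) := LinearMap.baseChange_tmul ..

theorem isHom_bcMap {N N' : Obj D} {f : N →ₗ[B] N'} (hf : IsHom N N' f) :
    IsHom (N.baseChange hDE) (N'.baseChange hDE) (bcMap hDE f) :=
  isHom_of_inc hDE _ fun n => by rw [bcMap_inc, bcMap_inc, del_inc, hf]

/-- `F ⊗ B = F`. -/
def unitIso : (unit D).baseChange hDE ≃ₗ[F] unit E := AlgebraTensorModule.rid B F F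

theorem unitIso_inc (b : B) : unitIso hDE (inc hDE (unit D) b) = algebraMap B F b := by
  have : AlgebraTensorModule.rid B F F ((1 : F) ⊗ₜ[B] b) = algebraMap B F b := by
    simp [Algebra.smul_def]
  exact this

theorem isHom_unitIso : IsHom _ _ (unitIso hDE).toLinearMap :=
  isHom_of_inc hDE _ fun b => (unitIso_inc hDE (D.del b)).trans
    ((hDE.del b).trans (congrArg E.del (unitIso_inc hDE b)).symm)

/-- `F ⊗ (N × N') = (F ⊗ N) × (F ⊗ N')`. -/
def prodIso (N N' : Obj D) :
    (N.prod N').baseChange hDE ≃ₗ[F] (N.baseChange hDE).prod (N'.baseChange hDE) :=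
  TensorProduct.prodRight B F F N N'

theorem isHom_prodIso (N N' : Obj D) : IsHom _ _ (prodIso hDE N N').toLinearMap :=
  isHom_of_inc hDE _ fun n => Prod.ext (del_inc hDE n.1).symm (del_inc hDE n.2).symm

/-- `F ⊗ (N ⊗ N') = (F ⊗ N) ⊗ (F ⊗ N')`. -/
def tensorIso (N N' : Obj D) :
    (N.tensor N').baseChange hDE ≃ₗ[F] (N.baseChange hDE).tensor (N'.baseChange hDE) :=
  AlgebraTensorModule.distribBaseChange B F N N'

theorem tensorIso_inc {N N' : Obj D} (n : N) (n' : N') :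
    tensorIso hDE N N' (inc hDE _ (tm n n')) = tm (inc hDE N n) (inc hDE N' n') :=
  AlgebraTensorModule.distribBaseChange_tmul ..

theorem isHom_tensorIso (N N' : Obj D) : IsHom _ _ (tensorIso hDE N N').toLinearMap := by
  refine isHom_of_inc hDE _ fun t => ?_
  change tensorIso hDE N N' _ = Obj.del _ (tensorIso hDE N N' _)
  induction t using tensor_induction with
  | zero => simp only [map_zero]
  | tmul n n' =>
    rw [tensorIso_inc, tensor_del_tm, tensor_del_tm, map_add, map_add, tensorIso_inc,
      tensorIso_inc, del_inc, del_inc, sig_inc]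
  | add x y hx hy => simp only [map_add, hx, hy]

/-- `F ⊗ F_∂(N) = F_∂(F ⊗ N)`. -/
def prolIso (N : Obj D) : N.prol.baseChange hDE ≃ₗ[F] (N.baseChange hDE).prol :=
  LinearEquiv.ofBijective (Prol.comparison D.der E.der fun b => (hDE.der b).symm)
    (Prol.comparison_bijective _)

theorem prolIso_inc {N : Obj D} (a b : N) :
    prolIso hDE N (inc hDE N.prol (Prol.mk D.der a b)) =
      Prol.mk E.der (inc hDE N a) (inc hDE N b) :=
  Prol.comparison_one_tmul (fun b => (hDE.der b).symm) _

theorem isHom_prolIso (N : Obj D) : IsHom _ _ (prolIso hDE N).toLinearMap := by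
  refine isHom_of_inc hDE _ fun x => ?_
  refine (prolIso_inc hDE (N.del x.1) (N.del x.2)).trans ?_
  rw [← del_inc, ← del_inc]
  exact (congrArg (N.baseChange hDE).prol.del (prolIso_inc hDE x.1 x.2)).symm

end Obj

/-- The extension of scalars of a bilinear pairing. -/
def pairingBaseChange {B : Type u} [CommRing B] (F : Type v) [CommRing F] [Algebra B F]
    {N N' : Type w} [AddCommGroup N] [Module B N] [AddCommGroup N'] [Module B N']
    (p : N' →ₗ[B] N →ₗ[B] B) : F ⊗[B] N' →ₗ[F] F ⊗[B] N →ₗ[F] F :=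
  LinearMap.liftBaseChange F
    { toFun := fun f => LinearMap.liftBaseChange F (Algebra.linearMap B F ∘ₗ p f)
      map_add' := fun f f' => by ext; simp
      map_smul' := fun b f => by ext; simp [Algebra.smul_def] }

theorem pairingBaseChange_one_tmul {B : Type u} [CommRing B] {F : Type v} [CommRing F]
    [Algebra B F] {N N' : Type w} [AddCommGroup N] [Module B N] [AddCommGroup N'] [Module B N']
    (p : N' →ₗ[B] N →ₗ[B] B) (f : N') (n : N) :
    pairingBaseChange F p ((1 : F) ⊗ₜ[B] f) ((1 : F) ⊗ₜ[B] n) = algebraMap B F (p f n) := by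
  simp [pairingBaseChange]

namespace Obj

variable {B : Type u} [CommRing B] {D : GenDiffRing B} {F : Type u} [Field F] [Algebra B F]
  {E : GenDiffRing F} (hDE : D.IsMor E)

/-! #### Duals and base change -/

/-- The extension of a pairing to `F`. -/
def bcPairing {N N' : Obj D} (p : N' →ₗ[B] N →ₗ[B] B) :
    N'.baseChange hDE →ₗ[F] N.baseChange hDE →ₗ[F] F :=
  pairingBaseChange F p

theorem bcPairing_inc {N N' : Obj D} (p : N' →ₗ[B] N →ₗ[B] B) (f : N') (n : N) :
    bcPairing hDE p (inc hDE N' f) (inc hDE N n) = algebraMap B F (p f n) :=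
  pairingBaseChange_one_tmul p f n

theorem isFlat_bcPairing {N N' : Obj D} {p : N' →ₗ[B] N →ₗ[B] B} (hp : IsFlat p)
    (z : N'.baseChange hDE) (y : N.baseChange hDE) :
    E.del (bcPairing hDE p z y) = bcPairing hDE p ((N'.baseChange hDE).del z) y +
      bcPairing hDE p ((N'.baseChange hDE).sig z) ((N.baseChange hDE).del y) := by
  induction z using bc_induction hDE with
  | zero => simp only [map_zero, LinearMap.zero_apply, add_zero]
  | add x x' hx hx' => simp only [map_add, LinearMap.add_apply, hx, hx']; abel
  | smul c f =>
    induction y using bc_induction hDE with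
    | zero => simp only [map_zero, add_zero]
    | add x x' hx hx' => simp only [map_add, hx, hx']; abel
    | smul c' n =>
      have h1 := congrArg (algebraMap B F) (hp f n)
      have h2 : algebraMap B F (p (N'.sig f) n) = algebraMap B F (p f n) +
          E.h * algebraMap B F (p (N'.del f) n) := by
        rw [sig_apply, map_add, map_smul, LinearMap.add_apply, LinearMap.smul_apply, smul_eq_mul,
          map_add, map_mul, hDE.h]
      rw [map_add, hDE.del] at h1
      simp only [Obj.leibniz, sig_smul, map_smul, map_add, LinearMap.add_apply,
        LinearMap.smul_apply, smul_eq_mul, del_inc, sig_inc, bcPairing_inc, E.del_mul, h1, h2,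
        E.sig_eq c, E.sig_eq c']
      ring

/-- Perfectness supplies dual families $e_i$ of $N$ and $f_i$ of $N'$. Their expansion formulas
survive the extension of scalars, so the extended pairing has no kernel on either side; over the
field $F$ this is enough. -/
theorem IsDual.baseChange {N N' : Obj D} (h : IsDual N N') :
    IsDual (N.baseChange hDE) (N'.baseChange hDE) := by
  obtain ⟨p, hp, hp'⟩ := h
  obtain ⟨m, e, g, hg⟩ := exists_dualBasis B N
  let f : Fin m → N' := fun i => p.toPerfPair.symm (g i)
  have hf : ∀ i n, p (f i) n = g i n := fun i n => by simp [f]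
  have hf' : ∀ x : N', x = ∑ i, p x (e i) • f i := by
    intro x
    apply hp.bijective_left.1
    ext n
    simp only [map_sum, map_smul, LinearMap.sum_apply, LinearMap.smul_apply, hf, smul_eq_mul]
    conv_lhs => rw [hg n, map_sum]
    simp only [map_smul, smul_eq_mul, mul_comm]
  refine ⟨bcPairing hDE p, LinearMap.IsPerfPair.of_injective ?_ ?_, isFlat_bcPairing hDE hp'⟩
  · have key : ∀ z, z = ∑ i, bcPairing hDE p z (inc hDE N (e i)) • inc hDE N' (f i) := by
      intro z
      induction z using bc_induction hDE with
      | zero => simp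
      | add x y hx hy =>
        conv_lhs => rw [hx, hy]
        simp only [map_add, LinearMap.add_apply, add_smul, Finset.sum_add_distrib]
      | smul c x =>
        conv_lhs => rw [hf' x, map_sum]
        simp only [map_smul, LinearMap.smul_apply, bcPairing_inc, inc_smul, smul_eq_mul, mul_smul,
          Finset.smul_sum]
    rw [injective_iff_map_eq_zero]
    intro z hz
    rw [key z, hz]
    simp
  · have key : ∀ y, y = ∑ i, bcPairing hDE p (inc hDE N' (f i)) y • inc hDE N (e i) := by
      intro z
      induction z using bc_induction hDE with
      | zero => simp
      | add x y hx hy =>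
        conv_lhs => rw [hx, hy]
        simp only [map_add, add_smul, Finset.sum_add_distrib]
      | smul c x =>
        conv_lhs => rw [hg x, map_sum]
        simp only [map_smul, bcPairing_inc, inc_smul, smul_eq_mul, mul_smul,
          Finset.smul_sum, hf]
    rw [injective_iff_map_eq_zero]
    intro z hz
    have hz' : ∀ x, bcPairing hDE p x z = 0 := fun x => LinearMap.congr_fun hz x
    rw [key z]
    simp [hz']

/-! #### Subobjects and base change -/

section Sub

theorem bcMap_surjective {N N' : Obj D} {f : N →ₗ[B] N'} (hf : Function.Surjective f) :
    Function.Surjective (bcMap hDE f) :=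
  LinearMap.lTensor_surjective F hf

variable [IsFractionRing B F]

theorem bcMap_injective {N N' : Obj D} {f : N →ₗ[B] N'} (hf : Function.Injective f) :
    Function.Injective (bcMap hDE f) := by
  have : Module.Flat B F := IsLocalization.flat F (nonZeroDivisors B)
  exact Module.Flat.lTensor_preserves_injective_linearMap (M := F) f hf

variable [IsDomain B]

theorem exists_inc_eq_smul {N : Obj D} (z : N.baseChange hDE) :
    ∃ (b : B) (n : N), b ≠ 0 ∧ algebraMap B F b • z = inc hDE N n := by
  induction z using bc_induction hDE with
  | zero => exact ⟨1, 0, one_ne_zero, by simp⟩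
  | smul c n =>
    obtain ⟨a, b, rfl⟩ := IsLocalization.exists_mk'_eq (nonZeroDivisors B) c
    refine ⟨b, a • n, nonZeroDivisors.ne_zero b.2, ?_⟩
    rw [smul_smul, mul_comm, IsLocalization.mk'_spec, inc_smul]
  | add x y hx hy =>
    obtain ⟨a, n, ha, hn⟩ := hx
    obtain ⟨b, m, hb, hm⟩ := hy
    refine ⟨a * b, b • n + a • m, mul_ne_zero ha hb, ?_⟩
    rw [map_add, inc_smul, inc_smul, ← hn, ← hm, smul_add, smul_smul, smul_smul, map_mul, mul_comm]

/-- A subobject of `F ⊗ N` comes from a subobject of `N`. -/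
theorem exists_lattice [IsNoetherianRing B] (hlat : HasLattices D) {N : Obj D} {V : Obj E}
    {j : V →ₗ[F] N.baseChange hDE} (hj : IsHom V (N.baseChange hDE) j)
    (hinj : Function.Injective j) :
    ∃ (L : Obj D) (i : L →ₗ[B] N) (e : L.baseChange hDE ≃ₗ[F] V), IsHom L N i ∧
      Function.Injective i ∧ IsHom _ _ e.toLinearMap ∧ ∀ z, j (e z) = bcMap hDE i z := by
  have hinjB : Function.Injective (algebraMap B F) := IsFractionRing.injective B F
  -- This is $N\cap V$ inside $F\otimes N$. It is saturated because $V$ is an $F$-subspace, and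
  -- stable under $\Delta$ because $V$ is.
  let L : Submodule B N :=
    { carrier := {n | inc hDE N n ∈ LinearMap.range j}
      add_mem' := fun {a b} ha hb => by
        rw [Set.mem_ofPred_eq, map_add]
        exact add_mem ha hb
      zero_mem' := by
        rw [Set.mem_ofPred_eq, map_zero]
        exact zero_mem _
      smul_mem' := fun c n hn => by
        rw [Set.mem_ofPred_eq, inc_smul]
        exact Submodule.smul_mem _ _ hn }
  have hmem : ∀ n, n ∈ L ↔ inc hDE N n ∈ LinearMap.range j := fun n => Iff.rfl
  have hsat : IsSaturated L := by
    intro b n hb hn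
    rw [hmem, inc_smul] at hn
    have hb' : algebraMap B F b ≠ 0 := by rwa [Ne, map_eq_zero_iff _ hinjB]
    have := Submodule.smul_mem _ (algebraMap B F b)⁻¹ hn
    rwa [smul_smul, inv_mul_cancel₀ hb', one_smul] at this
  have hdel : ∀ n ∈ L, N.del n ∈ L := by
    rintro n ⟨v, hv⟩
    exact ⟨V.del v, by rw [hj, hv, del_inc]⟩
  obtain ⟨hproj, hspan⟩ := hlat N L hsat hdel
  let L' : Obj D :=
    { carrier := L
      del := AddMonoidHom.mk' (fun l => ⟨N.del l, hdel l l.2⟩) fun x y => Subtype.ext (map_add _ _ _)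
      leibniz := fun b l => Subtype.ext (N.leibniz b l)
      span_eq_top := by
        rw [eq_top_iff]
        rintro l -
        have hl := hspan l.2
        have himg : N.sig '' L = L.subtype '' Set.range fun l : L =>
            l + D.h • (⟨N.del l, hdel l l.2⟩ : L) := by
          ext x
          constructor
          · rintro ⟨n, hn, rfl⟩
            exact ⟨_, ⟨⟨n, hn⟩, rfl⟩, rfl⟩
          · rintro ⟨_, ⟨n, rfl⟩, rfl⟩
            exact ⟨n, n.2, rfl⟩
        rw [himg, ← Submodule.map_span] at hl
        obtain ⟨l', hl', h⟩ := hl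
        rw [← Subtype.ext h]
        exact hl' }
  let i : L' →ₗ[B] N := L.subtype
  have hi : IsHom L' N i := fun _ => rfl
  have hii : Function.Injective i := L.injective_subtype
  have hrange : LinearMap.range (bcMap hDE i) = LinearMap.range j := by
    apply le_antisymm
    · rintro _ ⟨z, rfl⟩
      induction z using bc_induction hDE with
      | zero => rw [map_zero]; exact zero_mem _
      | smul c l =>
        rw [map_smul, bcMap_inc]
        exact Submodule.smul_mem _ _ l.2
      | add x y hx hy => rw [map_add]; exact add_mem hx hy
    -- Every vector of $V$ becomes an element coming from $N$ after multiplication by a nonzero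
    -- denominator, and then it comes from $L$; so $L$ spans $V$ over $F$.
    · intro y hy
      obtain ⟨b, n, hb, hn⟩ := exists_inc_eq_smul hDE y
      have hb' : algebraMap B F b ≠ 0 := by rwa [Ne, map_eq_zero_iff _ hinjB]
      have hnL : n ∈ L := by
        rw [hmem, ← hn]
        exact Submodule.smul_mem _ _ hy
      refine ⟨(algebraMap B F b)⁻¹ • inc hDE L' ⟨n, hnL⟩, ?_⟩
      rw [map_smul, bcMap_inc]
      change _ • inc hDE N n = y
      rw [← hn, smul_smul, inv_mul_cancel₀ hb', one_smul]
  let e : L'.baseChange hDE ≃ₗ[F] V := (LinearEquiv.ofInjective _ (bcMap_injective hDE hii)).trans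
    ((LinearEquiv.ofEq _ _ hrange).trans (LinearEquiv.ofInjective j hinj).symm)
  have he : ∀ z, j (e z) = bcMap hDE i z := by
    intro z
    have := LinearEquiv.apply_symm_apply (LinearEquiv.ofInjective j hinj)
      (LinearEquiv.ofEq _ _ hrange (LinearEquiv.ofInjective _ (bcMap_injective hDE hii) z))
    exact congrArg Subtype.val this
  refine ⟨L', i, e, hi, hii, fun z => hinj ?_, he⟩
  change j (e _) = j (V.del (e z))
  rw [he, isHom_bcMap hDE hi, hj, he]

end Sub

end Obj

/-! ### Tannakian subcategories and base change -/

section Tannakian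

section Closure

variable {B : Type u} [CommRing B] {D : GenDiffRing B}

theorem IsTannakian.of_isIso {C : Obj D → Prop} (hC : IsTannakian C) {N N' : Obj D} (hN : C N)
    (e : Obj.IsIso N N') : C N' := by
  obtain ⟨e, he⟩ := e
  exact hC.quot N N' e.toLinearMap hN he e.surjective

theorem isTannakian_gen (M : Obj D) : IsTannakian (Gen M) where
  unit := fun _ hC _ => hC.unit
  prod N N' h h' := fun C hC hM => hC.prod N N' (h C hC hM) (h' C hC hM)
  tensor N N' h h' := fun C hC hM => hC.tensor N N' (h C hC hM) (h' C hC hM)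
  dual N N' h h' := fun C hC hM => hC.dual N N' (h C hC hM) h'
  sub N N' f h hf hi := fun C hC hM => hC.sub N N' f (h C hC hM) hf hi
  quot N N' f h hf hi := fun C hC hM => hC.quot N N' f (h C hC hM) hf hi

theorem isDiffTannakian_genDiff (M : Obj D) : IsDiffTannakian (GenDiff M) where
  unit := fun _ hC _ => hC.unit
  prod N N' h h' := fun C hC hM => hC.prod N N' (h C hC hM) (h' C hC hM)
  tensor N N' h h' := fun C hC hM => hC.tensor N N' (h C hC hM) (h' C hC hM)
  dual N N' h h' := fun C hC hM => hC.dual N N' (h C hC hM) h'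
  sub N N' f h hf hi := fun C hC hM => hC.sub N N' f (h C hC hM) hf hi
  quot N N' f h hf hi := fun C hC hM => hC.quot N N' f (h C hC hM) hf hi
  prol N h := fun C hC hM => hC.prol N (h C hC hM)

end Closure

variable {B : Type u} [CommRing B] {D : GenDiffRing B} {F : Type u} [Field F] [Algebra B F]
  [IsFractionRing B F] {E : GenDiffRing F} (hDE : D.IsMor E)

/-- By minimality of the generated category, this shows that base change maps $\langle
M\rangle^\otimes$ into $\langle M_F\rangle^\otimes$. Stability under subobjects uses that $F$ is
flat over $B$. -/
theorem isTannakian_preimage {C : Obj E → Prop} (hC : IsTannakian C) :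
    IsTannakian fun N : Obj D => C (N.baseChange hDE) where
  unit := hC.of_isIso hC.unit (Obj.IsIso.symm ⟨_, Obj.isHom_unitIso hDE⟩)
  prod N N' h h' := hC.of_isIso (hC.prod _ _ h h') (Obj.IsIso.symm ⟨_, Obj.isHom_prodIso hDE N N'⟩)
  tensor N N' h h' :=
    hC.of_isIso (hC.tensor _ _ h h') (Obj.IsIso.symm ⟨_, Obj.isHom_tensorIso hDE N N'⟩)
  dual _ _ h h' := hC.dual _ _ h (h'.baseChange hDE)
  sub _ _ f h hf hi := hC.sub _ _ (Obj.bcMap hDE f) h (Obj.isHom_bcMap hDE hf)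
    (Obj.bcMap_injective hDE hi)
  quot _ _ f h hf hi := hC.quot _ _ (Obj.bcMap hDE f) h (Obj.isHom_bcMap hDE hf)
    (Obj.bcMap_surjective hDE hi)

theorem isDiffTannakian_preimage {C : Obj E → Prop} (hC : IsDiffTannakian C) :
    IsDiffTannakian fun N : Obj D => C (N.baseChange hDE) where
  toIsTannakian := isTannakian_preimage hDE hC.toIsTannakian
  prol N h := hC.of_isIso (hC.prol _ h) (Obj.IsIso.symm ⟨_, Obj.isHom_prolIso hDE N⟩)

/-- The objects that come from an object of `C` by base change. -/
def bcImage (C : Obj D → Prop) (V : Obj E) : Prop :=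
  ∃ N : Obj D, C N ∧ Obj.IsIso (N.baseChange hDE) V

variable [IsDomain B] [IsNoetherianRing B]

/-- By minimality this shows that every object of $\langle M_F\rangle^\otimes$ comes from $\langle
M\rangle^\otimes$. Only subobjects use the lattices; duals are lifted by existence over $B$ and
uniqueness over $F$. -/
theorem isTannakian_bcImage (hlat : HasLattices D) {C : Obj D → Prop} (hC : IsTannakian C) :
    IsTannakian (bcImage hDE C) := by
  have hσE : Function.Injective E.sig := E.sig.injective
  have hσD : Function.Injective D.sig := by
    have h1 := hσE.comp (IsFractionRing.injective B F)
    refine Function.Injective.of_comp (f := algebraMap B F) ?_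
    convert h1 using 1
    ext b
    exact hDE.sig b
  have hdual : ∀ V V' : Obj E, bcImage hDE C V → V.IsDual V' → bcImage hDE C V' := by
    rintro V V' ⟨N, hN, e⟩ hV
    obtain ⟨N', hN'⟩ := Obj.exists_isDual hσD N
    exact ⟨N', hC.dual _ _ hN hN', (hN'.baseChange hDE).unique (hV.of_isIso e)⟩
  have hsub : ∀ (V V' : Obj E) (f : V' →ₗ[F] V), bcImage hDE C V → Obj.IsHom V' V f →
      Function.Injective f → bcImage hDE C V' := by
    rintro V V' f ⟨N, hN, e, he⟩ hf hi
    obtain ⟨L, i, e', hi', hii, he', -⟩ := Obj.exists_lattice hDE hlat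
      (j := e.symm.toLinearMap ∘ₗ f) (he.symm.comp hf) (e.symm.injective.comp hi)
    exact ⟨L, hC.sub _ _ i hN hi' hii, e', he'⟩
  refine ⟨⟨_, hC.unit, _, Obj.isHom_unitIso hDE⟩, ?_, ?_, hdual, hsub, ?_⟩
  · rintro V V' ⟨N, hN, e⟩ ⟨N', hN', e'⟩
    exact ⟨_, hC.prod _ _ hN hN', Obj.IsIso.trans ⟨_, Obj.isHom_prodIso hDE N N'⟩ (e.prod e')⟩
  · rintro V V' ⟨N, hN, e⟩ ⟨N', hN', e'⟩
    exact ⟨_, hC.tensor _ _ hN hN', Obj.IsIso.trans ⟨_, Obj.isHom_tensorIso hDE N N'⟩ (e.tensor e')⟩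
  -- A quotient $V\to V'$ is dualized to an injection of the dual of $V'$ into the dual of $V$. That
  -- subobject has a model, and dualizing once more gives a model of $V'$.
  · intro V V' f hV hf hs
    obtain ⟨W, hW⟩ := Obj.exists_isDual hσE V
    obtain ⟨W', hW'⟩ := Obj.exists_isDual hσE V'
    have hWC := hdual _ _ hV hW
    obtain ⟨p, hp, hp'⟩ := hW
    obtain ⟨r, hr, hr'⟩ := id hW'
    obtain ⟨t, ht, htp⟩ := Obj.exists_transpose hp hp' hr' hf
    refine hdual _ _ (hsub _ _ t hWC ht ?_) hW'.symm
    intro x y hxy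
    apply hr.bijective_left.1
    ext v
    obtain ⟨v, rfl⟩ := hs v
    rw [← htp, ← htp, hxy]

theorem isDiffTannakian_bcImage (hlat : HasLattices D) {C : Obj D → Prop}
    (hC : IsDiffTannakian C) : IsDiffTannakian (bcImage hDE C) where
  toIsTannakian := isTannakian_bcImage hDE hlat hC.toIsTannakian
  prol := by
    rintro V ⟨N, hN, e⟩
    exact ⟨_, hC.prol _ hN, Obj.IsIso.trans ⟨_, Obj.isHom_prolIso hDE N⟩ e.prol⟩

end Tannakian

/-! ### Tensor automorphisms and base change -/

section Module

variable {B : Type u} [CommRing B] {F : Type u} [CommRing F] [Algebra B F]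
  (R : Type w) [CommRing R] [Algebra B R] [Algebra F R] [IsScalarTower B F R]
  {N W : Type u} [AddCommGroup N] [Module B N] [AddCommGroup W] [Module F W]

/-- The map `R ⊗ N = R ⊗ (F ⊗ N) → R ⊗ W` induced by an `F`-linear map `F ⊗ N → W`. -/
def extendScalars (β : F ⊗[B] N →ₗ[F] W) : R ⊗[B] N →ₗ[R] R ⊗[F] W :=
  β.baseChange R ∘ₗ (AlgebraTensorModule.cancelBaseChange B F R R N).symm.toLinearMap

theorem extendScalars_bijective {β : F ⊗[B] N →ₗ[F] W} (h : Function.Bijective β) :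
    Function.Bijective (extendScalars R β) :=
  ((LinearEquiv.ofBijective β h).baseChange F R _ _).bijective.comp
    (AlgebraTensorModule.cancelBaseChange B F R R N).symm.bijective

end Module

namespace Obj

variable {B : Type u} [CommRing B] {D : GenDiffRing B} {F : Type u} [CommRing F] [Algebra B F]
  {E : GenDiffRing F} (hDE : D.IsMor E)
  (R : Type w) [CommRing R] [Algebra B R] [Algebra F R] [IsScalarTower B F R]

/-- The map `R ⊗ N → R ⊗ V` induced by an `F`-linear map `F ⊗ N → V`. -/
def theta {N : Obj D} {V : Obj E} (β : N.baseChange hDE →ₗ[F] V) : R ⊗[B] N →ₗ[R] R ⊗[F] V :=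
  extendScalars R β

theorem theta_tmul {N : Obj D} {V : Obj E} (β : N.baseChange hDE →ₗ[F] V) (r : R) (n : N) :
    theta hDE R β (r ⊗ₜ n) = r ⊗ₜ β (inc hDE N n) := rfl

theorem theta_bijective {N : Obj D} {V : Obj E} {β : N.baseChange hDE →ₗ[F] V}
    (h : Function.Bijective β) : Function.Bijective (theta hDE R β) :=
  extendScalars_bijective R h

theorem theta_baseChange {N N' : Obj D} {V : Obj E} (β : N'.baseChange hDE →ₗ[F] V)
    (f : N →ₗ[B] N') (t : R ⊗[B] N) :
    theta hDE R β (f.baseChange R t) = theta hDE R (β ∘ₗ bcMap hDE f) t := by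
  induction t using TensorProduct.induction_on with
  | zero => simp only [map_zero]
  | tmul r n =>
    rw [LinearMap.baseChange_tmul, theta_tmul, theta_tmul, LinearMap.comp_apply, bcMap_inc]
  | add x y hx hy => simp only [map_add, hx, hy]

theorem baseChange_theta {N : Obj D} {V V' : Obj E} (β : N.baseChange hDE →ₗ[F] V)
    (f : V →ₗ[F] V') (t : R ⊗[B] N) :
    f.baseChange R (theta hDE R β t) = theta hDE R (f ∘ₗ β) t := by
  induction t using TensorProduct.induction_on with
  | zero => simp only [map_zero]
  | tmul r n => rw [theta_tmul, theta_tmul, LinearMap.baseChange_tmul, LinearMap.comp_apply]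
  | add x y hx hy => simp only [map_add, hx, hy]

theorem tensorComparison_tmul {N N' : Obj D} (r : R) (n : N) (n' : N') :
    tensorComparison N N' R (r ⊗ₜ[B] tm n n') = (r ⊗ₜ[B] n) ⊗ₜ[R] ((1 : R) ⊗ₜ[B] n') := rfl

theorem tensorComparison_theta {N N' : Obj D} {V V' : Obj E} (β : N.baseChange hDE →ₗ[F] V)
    (β' : N'.baseChange hDE →ₗ[F] V') (γ : (N.tensor N').baseChange hDE →ₗ[F] V.tensor V')
    (hγ : ∀ n n', γ (inc hDE _ (tm n n')) = tm (β (inc hDE N n)) (β' (inc hDE N' n')))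
    (t : R ⊗[B] (N.tensor N')) :
    tensorComparison V V' R (theta hDE R γ t) =
      TensorProduct.map (theta hDE R β) (theta hDE R β') (tensorComparison N N' R t) := by
  induction t using TensorProduct.induction_on with
  | zero => simp only [map_zero]
  | tmul r x =>
    induction x using tensor_induction with
    | zero => simp only [TensorProduct.tmul_zero, map_zero]
    | tmul n n' =>
      rw [theta_tmul, hγ, tensorComparison_tmul, tensorComparison_tmul, TensorProduct.map_tmul,
        theta_tmul, theta_tmul]
    | add x y hx hy => simp only [TensorProduct.tmul_add, map_add, hx, hy]
  | add x y hx hy => simp only [map_add, hx, hy]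

theorem prolComparison_theta {N : Obj D} {V : Obj E} (β : N.baseChange hDE →ₗ[F] V)
    (γ : N.prol.baseChange hDE →ₗ[F] V.prol)
    (hγ : ∀ a b, γ (inc hDE N.prol (Prol.mk D.der a b)) =
      Prol.mk E.der (β (inc hDE N a)) (β (inc hDE N b)))
    (dR : Derivation ℤ R R) (hd : ∀ c, dR (algebraMap F R c) = algebraMap F R (E.der c))
    (t : R ⊗[B] N.prol) :
    prolComparison V R dR hd (theta hDE R γ t) =
      Prol.map dR (theta hDE R β) (prolComparison N R dR (der_compat hDE hd) t) := by
  induction t using TensorProduct.induction_on with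
  | zero => simp only [map_zero]
  | tmul r x =>
    have h1 : prolComparison N R dR (der_compat hDE hd) (r ⊗ₜ x) =
        Prol.mk dR (r ⊗ₜ x.1 - dR r ⊗ₜ x.2) (r ⊗ₜ x.2) := Prol.comparison_tmul _ r x
    have h2 := Prol.comparison_tmul hd r (Prol.mk E.der (β (inc hDE N x.1)) (β (inc hDE N x.2)))
    rw [h1, Prol.map_mk, map_sub, theta_tmul, theta_tmul, theta_tmul, theta_tmul]
    exact (congrArg (fun y => prolComparison V R dR hd (r ⊗ₜ y)) (hγ x.1 x.2)).trans h2
  | add x y hx hy => simp only [map_add, hx, hy]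

theorem rTensor_theta {R} {R' : Type w} [CommRing R] [Algebra B R] [Algebra F R]
    [IsScalarTower B F R] [CommRing R'] [Algebra B R'] [Algebra F R']
    [IsScalarTower B F R'] (f : R →ₐ[F] R') {N : Obj D} {V : Obj E}
    (β : N.baseChange hDE →ₗ[F] V) (t : R ⊗[B] N) :
    f.toLinearMap.rTensor V (theta hDE R β t) =
      theta hDE R' β ((f.restrictScalars B).toLinearMap.rTensor N t) := by
  induction t using TensorProduct.induction_on with
  | zero => simp only [map_zero]
  | tmul r n => rfl
  | add x y hx hy => simp only [map_add, hx, hy]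

end Obj

/-! ### Matching families of automorphisms over $B$ and over $F$ -/

section Compat

open Obj

section

variable {B : Type u} [CommRing B] {D : GenDiffRing B} {F : Type u} [Field F] [Algebra B F]
  {E : GenDiffRing F} (hDE : D.IsMor E)
  {R : Type w} [CommRing R] [Algebra B R] [Algebra F R] [IsScalarTower B F R]
  {C : Obj D → Prop} {C' : Obj E → Prop}

/-- The families `g` over `B` and `g'` over `F` are intertwined by the morphisms `F ⊗ N → V`. -/
def Compat (g : AutFamily C R) (g' : AutFamily C' R) : Prop :=
  ∀ (N : Obj D) (hN : C N) (V : Obj E) (hV : C' V) (β : N.baseChange hDE →ₗ[F] V),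
    IsHom _ _ β → ∀ t, theta hDE R β (g ⟨N, hN⟩ t) = g' ⟨V, hV⟩ (theta hDE R β t)

variable {hDE} {g : AutFamily C R} {g' : AutFamily C' R}

theorem Compat.mul {k : AutFamily C R} {k' : AutFamily C' R} (h : Compat hDE g g')
    (h' : Compat hDE k k') : Compat hDE (g * k) (g' * k') := by
  intro N hN V hV β hβ t
  change theta hDE R β (g ⟨N, hN⟩ (k ⟨N, hN⟩ t)) = g' ⟨V, hV⟩ (k' ⟨V, hV⟩ (theta hDE R β t))
  rw [h N hN V hV β hβ, h' N hN V hV β hβ]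

theorem isHom_id (V : Obj E) : IsHom V V LinearMap.id := fun _ => rfl

theorem Compat.unique_left (h1 : ∀ N, C N → C' (N.baseChange hDE)) {k : AutFamily C R}
    (h : Compat hDE g g') (h' : Compat hDE k g') : g = k := by
  funext ⟨N, hN⟩
  ext1 t
  apply (theta_bijective hDE R (β := LinearMap.id) Function.bijective_id).1
  rw [h N hN _ (h1 N hN) _ (isHom_id _), h' N hN _ (h1 N hN) _ (isHom_id _)]

/-- Every $V$ in $C'$ is isomorphic to some $F\otimes N$ with $N$ in $C$, and compatibility with
that isomorphism determines $g'_V$. This uniqueness yields multiplicativity of the correspondence.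
-/
theorem Compat.unique_right (h2 : ∀ V, C' V → bcImage hDE C V) {k' : AutFamily C' R}
    (h : Compat hDE g g') (h' : Compat hDE g k') : g' = k' := by
  funext ⟨V, hV⟩
  ext1 t
  obtain ⟨N, hN, α, hα⟩ := h2 V hV
  obtain ⟨t, rfl⟩ := (theta_bijective hDE R (β := α.toLinearMap) α.bijective).2 t
  rw [← h N hN V hV _ hα, ← h' N hN V hV _ hα]

theorem Compat.isImage (h2 : ∀ V, C' V → bcImage hDE C V) {R' : Type w} [CommRing R']
    [Algebra B R'] [Algebra F R'] [IsScalarTower B F R'] {k : AutFamily C R'}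
    {k' : AutFamily C' R'} (h : Compat hDE g g') (h' : Compat hDE k k') (f : R →ₐ[F] R')
    (him : IsImage (f.restrictScalars B) g k) : IsImage f g' k' := by
  intro V hV t
  obtain ⟨N, hN, α, hα⟩ := h2 V hV
  obtain ⟨t, rfl⟩ := (theta_bijective hDE R (β := α.toLinearMap) α.bijective).2 t
  rw [← h N hN V hV _ hα, rTensor_theta, rTensor_theta, ← h' N hN V hV _ hα, him]

theorem cancelBaseChange_of_compat (h : Compat hDE g g') {N : Obj D} (hN : C N) (hN' : C' (N.baseChange hDE))
    (t : R ⊗[F] (F ⊗[B] N)) :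
    AlgebraTensorModule.cancelBaseChange B F R R N (g' ⟨N.baseChange hDE, hN'⟩ t) =
      g ⟨N, hN⟩ (AlgebraTensorModule.cancelBaseChange B F R R N t) := by
  have hid : ∀ s, theta hDE R (N := N) LinearMap.id s =
      (AlgebraTensorModule.cancelBaseChange B F R R N).symm s := fun s => by
    induction s using TensorProduct.induction_on with
    | zero => simp only [map_zero]; rfl
    | tmul r n => rfl
    | add x y hx hy =>
      rw [map_add, map_add, hx, hy]
      rfl
  have := h N hN _ hN' _ (isHom_id _) (AlgebraTensorModule.cancelBaseChange B F R R N t)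
  rw [hid, hid, LinearEquiv.symm_apply_apply] at this
  rw [← this]
  exact LinearEquiv.apply_symm_apply _ _

/-- The bijections `theta` attached to $\alpha$, $\alpha'$ and $\alpha\otimes\alpha'$ transport one
tensor condition to the other. -/
theorem Compat.tensor_iff (h : Compat hDE g g') {N N' : Obj D} {V V' : Obj E} (hN : C N)
    (hN' : C N') (hNN' : C (N.tensor N')) (hV : C' V) (hV' : C' V') (hVV' : C' (V.tensor V'))
    (α : N.baseChange hDE ≃ₗ[F] V) (α' : N'.baseChange hDE ≃ₗ[F] V')
    (hα : IsHom _ _ α.toLinearMap) (hα' : IsHom _ _ α'.toLinearMap) :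
    (∀ t, tensorComparison N N' R (g ⟨N.tensor N', hNN'⟩ t) =
      TensorProduct.congr (g ⟨N, hN⟩) (g ⟨N', hN'⟩) (tensorComparison N N' R t)) ↔
    (∀ t, tensorComparison V V' R (g' ⟨V.tensor V', hVV'⟩ t) =
      TensorProduct.congr (g' ⟨V, hV⟩) (g' ⟨V', hV'⟩) (tensorComparison V V' R t)) := by
  let γ : (N.tensor N').baseChange hDE ≃ₗ[F] V.tensor V' :=
    (tensorIso hDE N N').trans (TensorProduct.congr α α')
  have hγ : IsHom _ _ γ.toLinearMap := (hα.tensor hα').comp (isHom_tensorIso hDE N N')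
  have hγ' : ∀ n n', γ.toLinearMap (inc hDE _ (tm n n')) =
      tm (α.toLinearMap (inc hDE N n)) (α'.toLinearMap (inc hDE N' n')) := fun n n' =>
    congrArg (TensorProduct.congr α α') (tensorIso_inc hDE n n')
  have hθ := theta_bijective hDE R (β := α.toLinearMap) α.bijective
  have hθ' := theta_bijective hDE R (β := α'.toLinearMap) α'.bijective
  have hθγ := theta_bijective hDE R (β := γ.toLinearMap) γ.bijective
  have hinj : Function.Injective
      (TensorProduct.map (theta hDE R α.toLinearMap) (theta hDE R α'.toLinearMap)) :=
    (TensorProduct.congr (LinearEquiv.ofBijective _ hθ) (LinearEquiv.ofBijective _ hθ')).injective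
  have hcong : ∀ x, TensorProduct.congr (g' ⟨V, hV⟩) (g' ⟨V', hV'⟩)
      (TensorProduct.map (theta hDE R α.toLinearMap) (theta hDE R α'.toLinearMap) x) =
      TensorProduct.map (theta hDE R α.toLinearMap) (theta hDE R α'.toLinearMap)
        (TensorProduct.congr (g ⟨N, hN⟩) (g ⟨N', hN'⟩) x) := by
    intro x
    induction x using TensorProduct.induction_on with
    | zero => simp only [map_zero]
    | tmul a b =>
      simp only [TensorProduct.map_tmul, TensorProduct.congr_tmul, h N hN V hV _ hα,
        h N' hN' V' hV' _ hα']
    | add x y hx hy => simp only [map_add, hx, hy]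
  refine (forall_congr' fun t => ?_).trans hθγ.2.forall.symm
  rw [← h _ hNN' _ hVV' _ hγ, tensorComparison_theta hDE R _ _ _ hγ',
    tensorComparison_theta hDE R _ _ _ hγ', hcong, hinj.eq_iff]

theorem Compat.prol_iff (h : Compat hDE g g') {N : Obj D} {V : Obj E} (hN : C N)
    (hNp : C N.prol) (hV : C' V) (hVp : C' V.prol)
    (α : N.baseChange hDE ≃ₗ[F] V) (hα : IsHom _ _ α.toLinearMap)
    (dR : Derivation ℤ R R) (hd : ∀ c, dR (algebraMap F R c) = algebraMap F R (E.der c)) :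
    (∀ t, prolComparison N R dR (der_compat hDE hd) (g ⟨N.prol, hNp⟩ t) =
      Prol.map dR (g ⟨N, hN⟩).toLinearMap (prolComparison N R dR (der_compat hDE hd) t)) ↔
    (∀ t, prolComparison V R dR hd (g' ⟨V.prol, hVp⟩ t) =
      Prol.map dR (g' ⟨V, hV⟩).toLinearMap (prolComparison V R dR hd t)) := by
  let γ : N.prol.baseChange hDE →ₗ[F] V.prol :=
    Prol.map E.der α.toLinearMap ∘ₗ (prolIso hDE N).toLinearMap
  have hγ : IsHom _ _ γ := hα.prol.comp (isHom_prolIso hDE N)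
  have hγ' : ∀ a b, γ (inc hDE N.prol (Prol.mk D.der a b)) =
      Prol.mk E.der (α.toLinearMap (inc hDE N a)) (α.toLinearMap (inc hDE N b)) := fun a b =>
    congrArg (Prol.map E.der α.toLinearMap) (prolIso_inc hDE a b)
  have hθ := theta_bijective hDE R (β := α.toLinearMap) α.bijective
  have hγb : Function.Bijective γ := by
    have hp : Function.Bijective (Prol.map E.der α.toLinearMap) :=
      Function.Bijective.prodMap α.bijective α.bijective
    exact hp.comp (prolIso hDE N).bijective
  have hθγ := theta_bijective hDE R hγb
  have hinj : Function.Injective (Prol.map dR (theta hDE R α.toLinearMap)) :=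
    Function.Injective.prodMap hθ.1 hθ.1
  have hcong : ∀ x, Prol.map dR (g' ⟨V, hV⟩).toLinearMap
      (Prol.map dR (theta hDE R α.toLinearMap) x) =
      Prol.map dR (theta hDE R α.toLinearMap) (Prol.map dR (g ⟨N, hN⟩).toLinearMap x) := fun x =>
    Prod.ext (h N hN V hV _ hα x.1).symm (h N hN V hV _ hα x.2).symm
  refine (forall_congr' fun t => ?_).trans hθγ.2.forall.symm
  rw [← h _ hNp _ hVp _ hγ, prolComparison_theta hDE R _ _ hγ',
    prolComparison_theta hDE R _ _ hγ', hcong, hinj.eq_iff]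

/-- Compatibility is demanded for all morphisms $F\otimes N\to V$, not only for isomorphisms, so it
already forces naturality on both sides. Only the unit and tensor conditions have to be transported.
-/
theorem Compat.mem_tensorAut_iff (h : Compat hDE g g') (hC : IsTannakian C)
    (h1 : ∀ N, C N → C' (N.baseChange hDE)) (hC' : IsTannakian C')
    (h2 : ∀ V, C' V → bcImage hDE C V) : g ∈ TensorAut C R ↔ g' ∈ TensorAut C' R := by
  have hunit : ∀ t, theta hDE R (unitIso hDE).toLinearMap (g ⟨_, hC.unit⟩ t) =
      g' ⟨_, hC'.unit⟩ (theta hDE R (unitIso hDE).toLinearMap t) :=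
    h _ hC.unit _ hC'.unit _ (isHom_unitIso hDE)
  have hub := theta_bijective hDE R (β := (unitIso hDE).toLinearMap) (unitIso hDE).bijective
  constructor
  · rintro ⟨-, hu, ht⟩
    refine ⟨fun V V' hV hV' f hf t => ?_, fun _ t => ?_, fun V V' hV hV' hVV' => ?_⟩
    · obtain ⟨N, hN, α, hα⟩ := h2 V hV
      obtain ⟨t, rfl⟩ := (theta_bijective hDE R (β := α.toLinearMap) α.bijective).2 t
      rw [← h N hN V hV _ hα, baseChange_theta, baseChange_theta,
        h N hN V' hV' _ (hf.comp hα)]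
    · obtain ⟨t, rfl⟩ := hub.2 t
      rw [← hunit, hu]
    · obtain ⟨N, hN, α, hα⟩ := h2 V hV
      obtain ⟨N', hN', α', hα'⟩ := h2 V' hV'
      exact (h.tensor_iff hN hN' (hC.tensor _ _ hN hN') hV hV' hVV' α α' hα hα').1
        (ht N N' hN hN' _)
  · rintro ⟨-, hu, ht⟩
    refine ⟨fun N N' hN hN' f hf t => ?_, fun _ t => ?_, fun N N' hN hN' hNN' => ?_⟩
    · apply (theta_bijective hDE R (β := LinearMap.id) Function.bijective_id).1
      rw [theta_baseChange, h N hN _ (h1 N' hN') _ ((isHom_id _).comp (isHom_bcMap hDE hf)),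
        h N' hN' _ (h1 N' hN') _ (isHom_id _), theta_baseChange]
    · apply hub.1
      rw [hunit, hu]
    · exact (h.tensor_iff hN hN' hNN' (h1 N hN) (h1 N' hN')
        (hC'.tensor _ _ (h1 N hN) (h1 N' hN')) (LinearEquiv.refl F _) (LinearEquiv.refl F _)
        (isHom_id _) (isHom_id _)).2 (ht _ _ (h1 N hN) (h1 N' hN') _)

theorem Compat.mem_diffTensorAut_iff (h : Compat hDE g g') (hC : IsDiffTannakian C)
    (h1 : ∀ N, C N → C' (N.baseChange hDE)) (hC' : IsDiffTannakian C')
    (h2 : ∀ V, C' V → bcImage hDE C V)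
    (dR : Derivation ℤ R R) (hd : ∀ c, dR (algebraMap F R c) = algebraMap F R (E.der c)) :
    g ∈ DiffTensorAut C R dR (der_compat hDE hd) ↔ g' ∈ DiffTensorAut C' R dR hd := by
  refine and_congr (h.mem_tensorAut_iff hC.toIsTannakian h1 hC'.toIsTannakian h2) ⟨?_, ?_⟩
  · intro hp V hV hVp
    obtain ⟨N, hN, α, hα⟩ := h2 V hV
    exact (h.prol_iff hN (hC.prol N hN) hV hVp α hα dR hd).1 (hp N hN _)
  · intro hp N hN hNp
    exact (h.prol_iff hN hNp (h1 N hN) (hC'.prol _ (h1 N hN)) (LinearEquiv.refl F _)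
      (isHom_id _) dR hd).2 (hp _ (h1 N hN) _)

/-- Take for $g_N$ the conjugate of $g'_{F\otimes N}$ under $R\otimes_BN=R\otimes_F(F\otimes_BN)$;
naturality of $g'$ extends the compatibility from the identity of $F\otimes N$ to arbitrary $\beta$.
-/
theorem exists_compat_left (h1 : ∀ N, C N → C' (N.baseChange hDE)) (hg' : g' ∈ TensorAut C' R) :
    ∃ g : AutFamily C R, Compat hDE g g' := by
  let θ : ∀ N : Obj D, R ⊗[B] N ≃ₗ[R] R ⊗[F] N.baseChange hDE := fun N =>
    LinearEquiv.ofBijective _ (theta_bijective hDE R (β := LinearMap.id) Function.bijective_id)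
  have hθ : ∀ (N : Obj D) t, θ N t = theta hDE R LinearMap.id t := fun _ _ => rfl
  refine ⟨fun N => (θ N.1).trans ((g' ⟨_, h1 N.1 N.2⟩).trans (θ N.1).symm),
    fun N hN V hV β hβ t => ?_⟩
  have hcomp : ∀ t, theta hDE R β t = β.baseChange R (θ N t) := fun t => by
    rw [hθ, baseChange_theta, LinearMap.comp_id]
  rw [hcomp, hcomp, ← hg'.1 _ _ (h1 N hN) hV β hβ]
  simp only [LinearEquiv.trans_apply, LinearEquiv.apply_symm_apply]

end

/-! ### Fractions of morphisms and the comparison isomorphism -/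

section

variable {B : Type u} [CommRing B] [IsDomain B] [IsNoetherianRing B] {D : GenDiffRing B}
  {F : Type u} [Field F] [Algebra B F] [IsFractionRing B F]
  {E : GenDiffRing F} (hDE : D.IsMor E)

/-- A morphism `F ⊗ N → F ⊗ N'` is a quotient of two morphisms over `B`. -/
theorem exists_correspondence (hlat : HasLattices D) {N N' : Obj D}
    {ψ : N.baseChange hDE →ₗ[F] N'.baseChange hDE} (hψ : IsHom _ _ ψ) :
    ∃ (L : Obj D) (i : L →ₗ[B] N.prod N') (a : L →ₗ[B] N) (b : L →ₗ[B] N'),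
      IsHom _ _ i ∧ Function.Injective i ∧ IsHom _ _ a ∧ IsHom _ _ b ∧
      Function.Bijective (bcMap hDE a) ∧ bcMap hDE b = ψ ∘ₗ bcMap hDE a := by
  -- The graph of $\psi$ is a subobject of $F\otimes(N\times N')$. Its lattice $L$ projects to $N$
  -- by a map that becomes an isomorphism over $F$, and to $N'$ by a map that becomes $\psi$
  -- composed with that isomorphism.
  let j₀ : N.baseChange hDE →ₗ[F] (N.baseChange hDE).prod (N'.baseChange hDE) :=
    LinearMap.prod LinearMap.id ψ
  have hj₀ : IsHom _ _ j₀ := fun z => Prod.ext rfl (hψ z)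
  have hj₀i : Function.Injective j₀ := fun x y hxy => congrArg Prod.fst hxy
  obtain ⟨L, i, e, hi, hii, he, hie⟩ := exists_lattice hDE hlat
    (j := (prodIso hDE N N').symm.toLinearMap ∘ₗ j₀) ((isHom_prodIso hDE N N').symm.comp hj₀)
    ((prodIso hDE N N').symm.injective.comp hj₀i)
  have key : ∀ z, j₀ (e z) = prodIso hDE N N' (bcMap hDE i z) := fun z => by
    rw [← hie]
    exact ((prodIso hDE N N').apply_symm_apply _).symm
  let a : L →ₗ[B] N := LinearMap.fst B N N' ∘ₗ i
  let b : L →ₗ[B] N' := LinearMap.snd B N N' ∘ₗ i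
  have ha : bcMap hDE a = e.toLinearMap := bc_ext hDE fun l => by
    have := key (inc hDE L l)
    rw [bcMap_inc] at this
    rw [bcMap_inc]
    exact (congrArg Prod.fst this).symm
  have hb : bcMap hDE b = ψ ∘ₗ e.toLinearMap := bc_ext hDE fun l => by
    have := key (inc hDE L l)
    rw [bcMap_inc] at this
    rw [bcMap_inc]
    exact (congrArg Prod.snd this).symm
  exact ⟨L, i, a, b, hi, hii, (isHom_fst N N').comp hi, (isHom_snd N N').comp hi,
    by rw [ha]; exact e.bijective, by rw [hb, ha]⟩

variable {hDE} {R : Type w} [CommRing R] [Algebra B R] [Algebra F R] [IsScalarTower B F R]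
  {C : Obj D → Prop} {C' : Obj E → Prop}

/-- Choose a model $X$ over $B$ for each $V$ and transport $g_X$ to $V$. The result could depend on
the model; it does not, because a morphism $F\otimes N\to F\otimes X$ is a fraction of two morphisms
over $B$, with both of which $g$ commutes. -/
theorem exists_compat_right (hlat : HasLattices D) (hC : IsTannakian C)
    (h2 : ∀ V, C' V → bcImage hDE C V) {g : AutFamily C R} (hg : g ∈ TensorAut C R) :
    ∃ g' : AutFamily C' R, Compat hDE g g' := by
  choose X hX α hα using h2
  let θ : ∀ (V : Obj E) (hV : C' V), R ⊗[B] X V hV ≃ₗ[R] R ⊗[F] V := fun V hV =>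
    LinearEquiv.ofBijective _
      (theta_bijective hDE R (β := (α V hV).toLinearMap) (α V hV).bijective)
  have hθ : ∀ (V : Obj E) (hV : C' V) t, θ V hV t = theta hDE R (α V hV).toLinearMap t :=
    fun _ _ _ => rfl
  refine ⟨fun V => (θ V.1 V.2).symm.trans ((g ⟨X V.1 V.2, hX V.1 V.2⟩).trans (θ V.1 V.2)),
    fun N hN V hV β hβ t => ?_⟩
  obtain ⟨L, i, a, b, hi, hii, ha, hb, hab, hba⟩ := exists_correspondence hDE hlat
    ((hα V hV).symm.comp hβ)
  have hL : C L := hC.sub _ _ i (hC.prod _ _ hN (hX V hV)) hi hii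
  have hβa : β ∘ₗ bcMap hDE a = (α V hV).toLinearMap ∘ₗ bcMap hDE b := by
    rw [hba]
    ext z
    exact ((α V hV).apply_symm_apply _).symm
  -- Since $R$ is an $F$-algebra, the map $a$, which is bijective over $F$, remains so over $R$; it
  -- suffices to compare the two sides on $R\otimes L$.
  have hsurj : Function.Surjective (a.baseChange R) := by
    intro y
    obtain ⟨s, hs⟩ := (theta_bijective hDE R hab).2 (theta hDE R LinearMap.id y)
    refine ⟨s, (theta_bijective hDE R (β := LinearMap.id) Function.bijective_id).1 ?_⟩
    rw [← hs, theta_baseChange, LinearMap.id_comp]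
  obtain ⟨s, rfl⟩ := hsurj t
  rw [← hg.1 _ _ hL hN a ha, theta_baseChange, theta_baseChange, hβa, ← theta_baseChange,
    ← theta_baseChange, hg.1 _ _ hL (hX V hV) b hb, ← hθ, ← hθ]
  simp only [LinearEquiv.trans_apply, LinearEquiv.symm_apply_apply]

/-- Families of automorphisms over `B` and over `F` correspond to each other. -/
theorem exists_mulEquiv_compat (hlat : HasLattices D) (hC : IsTannakian C)
    (h1 : ∀ N, C N → C' (N.baseChange hDE)) (h2 : ∀ V, C' V → bcImage hDE C V)
    (S : Subgroup (AutFamily C R)) (S' : Subgroup (AutFamily C' R)) (hS : S ≤ TensorAut C R)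
    (hS' : S' ≤ TensorAut C' R)
    (hSS' : ∀ g g', Compat hDE g g' → (g ∈ S ↔ g' ∈ S')) :
    ∃ e : S ≃* S', ∀ g, Compat hDE g.1 (e g).1 := by
  have hex : ∀ g : S, ∃ g' : S', Compat hDE g.1 g'.1 := fun g =>
    let ⟨g', hg'⟩ := exists_compat_right hlat hC h2 (hS g.2)
    ⟨⟨g', (hSS' _ _ hg').1 g.2⟩, hg'⟩
  choose e he using hex
  refine ⟨MulEquiv.ofBijective (MonoidHom.mk' e fun g k => Subtype.ext
    ((he (g * k)).unique_right h2 ((he g).mul (he k)))) ⟨fun g k hgk => ?_, fun g' => ?_⟩, he⟩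
  · have hgk' : e g = e k := hgk
    refine Subtype.ext ((he g).unique_left h1 ?_)
    rw [hgk']
    exact he k
  · obtain ⟨g, hg⟩ := exists_compat_left h1 (hS' g'.2)
    exact ⟨⟨g, (hSS' _ _ hg).2 g'.2⟩, Subtype.ext ((he _).unique_right h2 hg)⟩

variable (hDE)

/-- For each $R$ an isomorphism is chosen whose values are compatible with its arguments.
Compatibility determines it uniquely, so the separate choices are automatically functorial in $R$.
-/
theorem galLoc_of_hasLattices (hlat : HasLattices D) (M : Obj D) : GalLoc.{u, w} hDE M := by
  have h1 : ∀ N, Gen M N → Gen (M.baseChange hDE) (N.baseChange hDE) := fun N hN =>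
    hN _ (isTannakian_preimage hDE (isTannakian_gen _)) (Gen.self _)
  have h2 : ∀ V, Gen (M.baseChange hDE) V → bcImage hDE (Gen M) V := fun V hV =>
    hV _ (isTannakian_bcImage hDE hlat (isTannakian_gen M)) ⟨M, Gen.self M, IsIso.refl _⟩
  have hex (R : Type w) [CommRing R] [Algebra B R] [Algebra F R] [IsScalarTower B F R] :
      ∃ e : Gal M R ≃* Gal (M.baseChange hDE) R, ∀ g, Compat hDE g.1 (e g).1 :=
    exists_mulEquiv_compat hlat (isTannakian_gen M) h1 h2 _ _ le_rfl le_rfl fun g g' h =>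
      h.mem_tensorAut_iff (isTannakian_gen M) h1 (isTannakian_gen _) h2
  refine ⟨fun R _ _ _ _ => (hex R).choose, ?_, ?_⟩
  · intro R R' _ _ _ _ _ _ _ _ f g g' h
    exact ((hex R).choose_spec g).isImage h2 ((hex R').choose_spec g') f h
  · intro R _ _ _ _ g t
    exact cancelBaseChange_of_compat ((hex R).choose_spec g) _ _ t

theorem galDiffLoc_of_hasLattices (hlat : HasLattices D) (M : Obj D) :
    GalDiffLoc.{u, w} hDE M := by
  have h1 : ∀ N, GenDiff M N → GenDiff (M.baseChange hDE) (N.baseChange hDE) := fun N hN =>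
    hN _ (isDiffTannakian_preimage hDE (isDiffTannakian_genDiff _)) (GenDiff.self _)
  have h2 : ∀ V, GenDiff (M.baseChange hDE) V → bcImage hDE (GenDiff M) V := fun V hV =>
    hV _ (isDiffTannakian_bcImage hDE hlat (isDiffTannakian_genDiff M))
      ⟨M, GenDiff.self M, IsIso.refl _⟩
  have hex (R : Type w) [CommRing R] [Algebra B R] [Algebra F R] [IsScalarTower B F R]
      (dR : Derivation ℤ R R) (hd : ∀ c, dR (algebraMap F R c) = algebraMap F R (E.der c)) :
      ∃ e : GalDiff M R dR (der_compat hDE hd) ≃* GalDiff (M.baseChange hDE) R dR hd,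
        ∀ g, Compat hDE g.1 (e g).1 :=
    exists_mulEquiv_compat hlat (isDiffTannakian_genDiff M).toIsTannakian h1 h2 _ _
      inf_le_left inf_le_left fun g g' h =>
        h.mem_diffTensorAut_iff (isDiffTannakian_genDiff M) h1 (isDiffTannakian_genDiff _) h2 dR hd
  refine ⟨fun R _ _ _ _ dR hd => (hex R dR hd).choose, ?_, ?_⟩
  · intro R R' _ _ _ _ _ _ _ _ dR hd dR' hd' f _ g g' h
    exact ((hex R dR hd).choose_spec g).isImage h2 ((hex R' dR' hd').choose_spec g') f h
  · intro R _ _ _ _ dR hd g t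
    exact cancelBaseChange_of_compat ((hex R dR hd).choose_spec g) _ _ t

end

end Compat

/-! ### The fraction field of `O[x, 1/P(x), 1/P(qx), …]` -/

section FractionField

theorem ne_zero_of_map_ne_zero {O κ : Type u} [CommRing O] [CommRing κ] {φ : O →+* κ} {q : O} {P : O[X]}
    (hq : φ q ≠ 0) (hP : P.map φ ≠ 0) : q ≠ 0 ∧ P ≠ 0 :=
  ⟨fun h => hq (by rw [h, map_zero]), fun h => hP (by rw [h, Polynomial.map_zero])⟩

variable {O κ : Type u} [CommRing O] [CommRing κ] [IsDomain κ]

theorem exists_map_eq_C_mul {φ : O →+* κ} (hφ : Function.Injective φ)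
    (hfrac : ∀ a : κ, ∃ b c : O, c ≠ 0 ∧ φ c * a = φ b) (p : κ[X]) :
    ∃ (c : O) (r : O[X]), c ≠ 0 ∧ r.map φ = C (φ c) * p := by
  have : IsDomain O := hφ.isDomain φ
  induction p using Polynomial.induction_on' with
  | add p p' hp hp' =>
    obtain ⟨c, r, hc, h⟩ := hp
    obtain ⟨c', r', hc', h'⟩ := hp'
    refine ⟨c * c', C c' * r + C c * r', mul_ne_zero hc hc', ?_⟩
    simp only [Polynomial.map_add, Polynomial.map_mul, Polynomial.map_C, h, h', map_mul]
    ring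
  | monomial n a =>
    obtain ⟨b, c, hc, h⟩ := hfrac a
    exact ⟨c, monomial n b, hc, by rw [Polynomial.map_monomial, C_mul_monomial, h]⟩

theorem toRat_algebraMap (φ : O →+* κ) (q : O) (P : O[X]) (hq : φ q ≠ 0) (hP : P.map φ ≠ 0)
    (p : O[X]) : toRat φ q P hq hP (algebraMap O[X] (QAlg q P) p) =
      algebraMap κ[X] (RatFunc κ) (p.map φ) := locMap_algebraMap _ _ _ _ _ _ p

theorem toRat_injective {φ : O →+* κ} (hφ : Function.Injective φ) (q : O) (P : O[X])
    (hq : φ q ≠ 0) (hP : P.map φ ≠ 0) : Function.Injective (toRat φ q P hq hP) := by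
  rw [injective_iff_map_eq_zero]
  intro a ha
  obtain ⟨p, s, rfl⟩ := IsLocalization.exists_mk'_eq (denoms q P) a
  have h := congrArg (toRat φ q P hq hP) (IsLocalization.mk'_spec (QAlg q P) p s)
  rw [map_mul, ha, zero_mul, toRat_algebraMap, eq_comm,
    map_eq_zero_iff _ (IsFractionRing.injective κ[X] (RatFunc κ)),
    Polynomial.map_eq_zero_iff hφ] at h
  rw [h, IsLocalization.mk'_zero]

theorem isFractionRing_toRat {φ : O →+* κ} (hφ : Function.Injective φ)
    (hfrac : ∀ a : κ, ∃ b c : O, c ≠ 0 ∧ φ c * a = φ b) (q : O) (P : O[X])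
    (hq : φ q ≠ 0) (hP : P.map φ ≠ 0) :
    letI := (toRat φ q P hq hP).toAlgebra
    IsFractionRing (QAlg q P) (RatFunc κ) := by
  let _ := (toRat φ q P hq hP).toAlgebra
  have hinj := toRat_injective hφ q P hq hP
  have : IsDomain O := hφ.isDomain φ
  have : IsDomain (QAlg q P) := hinj.isDomain (toRat φ q P hq hP)
  refine ⟨fun y => ?_, fun z => ?_, fun {x y} h => ⟨1, by rw [hinj h]⟩⟩
  · refine IsUnit.mk0 _ fun h => nonZeroDivisors.ne_zero y.2 (hinj ?_)
    rw [map_zero]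
    exact h
  -- With $p'=cp$ and $r'=dr$ over $O$, the fraction $p/r$ equals $dp'/(cr')$.
  · obtain ⟨p, r, hr, rfl⟩ := IsFractionRing.div_surjective (A := κ[X]) z
    obtain ⟨c, p', hc, hp'⟩ := exists_map_eq_C_mul hφ hfrac p
    obtain ⟨d, r', hd, hr'⟩ := exists_map_eq_C_mul hφ hfrac r
    have hr0 : r ≠ 0 := nonZeroDivisors.ne_zero hr
    have hcr : C c * r' ≠ 0 := by
      refine mul_ne_zero (C_ne_zero.2 hc) ?_
      rw [← Polynomial.map_ne_zero_iff hφ, hr']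
      exact mul_ne_zero (C_ne_zero.2 ((map_ne_zero_iff φ hφ).2 hd)) hr0
    have hne : algebraMap O[X] (QAlg q P) (C c * r') ≠ 0 := by
      intro h
      have h' := congrArg (toRat φ q P hq hP) h
      rw [toRat_algebraMap, map_zero,
        map_eq_zero_iff _ (IsFractionRing.injective κ[X] (RatFunc κ)),
        Polynomial.map_eq_zero_iff hφ] at h'
      exact hcr h'
    refine ⟨(algebraMap O[X] (QAlg q P) (C d * p'),
      ⟨_, mem_nonZeroDivisors_of_ne_zero hne⟩), ?_⟩
    change _ * toRat φ q P hq hP (algebraMap O[X] (QAlg q P) (C c * r')) =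
      toRat φ q P hq hP (algebraMap O[X] (QAlg q P) (C d * p'))
    have hr1 : algebraMap κ[X] (RatFunc κ) r ≠ 0 := by
      rwa [Ne, map_eq_zero_iff _ (IsFractionRing.injective κ[X] (RatFunc κ))]
    rw [toRat_algebraMap, toRat_algebraMap, div_mul_eq_mul_div, div_eq_iff hr1, ← map_mul,
      ← map_mul]
    congr 1
    rw [Polynomial.map_mul, Polynomial.map_mul, hr', hp', Polynomial.map_C, Polynomial.map_C]
    ring

theorem diffGalLoc_and_diffGalDiffLoc [IsDedekindDomain O] {φ : O →+* κ}
    (hφ : Function.Injective φ) (hfrac : ∀ a : κ, ∃ b c : O, c ≠ 0 ∧ φ c * a = φ b) (q : O)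
    (P : O[X]) (hq : φ q ≠ 0) (hP : P.map φ ≠ 0) (M : Obj (QAlg.diffRing q P)) :
    DiffGalLoc.{u, w} φ q P hq hP M ∧ DiffGalDiffLoc.{u, w} φ q P hq hP M := by
  let _ := (toRat φ q P hq hP).toAlgebra
  have := isFractionRing_toRat hφ hfrac q P hq hP
  obtain ⟨hq', hP'⟩ := ne_zero_of_map_ne_zero hq hP
  have := isDomain_QAlg hq' hP'
  have : IsNoetherianRing (QAlg q P) :=
    IsLocalization.isNoetherianRing (denoms q P) _ inferInstance
  have hlat : HasLattices (QAlg.diffRing q P) := hasLattices_of_isDedekindDomain rfl hq' hP'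
  exact ⟨galLoc_of_hasLattices _ hlat M, galDiffLoc_of_hasLattices _ hlat M⟩

theorem connGalLoc_and_connGalDiffLoc [IsDedekindDomain O] {φ : O →+* κ}
    (hφ : Function.Injective φ) (hfrac : ∀ a : κ, ∃ b c : O, c ≠ 0 ∧ φ c * a = φ b) (q : O)
    (P : O[X]) (hq : φ q ≠ 0) (hP : P.map φ ≠ 0) (M : Obj (QAlg.connRing q P)) :
    ConnGalLoc.{u, w} φ q P hq hP M ∧ ConnGalDiffLoc.{u, w} φ q P hq hP M := by
  let _ := (toRat φ q P hq hP).toAlgebra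
  have := isFractionRing_toRat hφ hfrac q P hq hP
  obtain ⟨hq', hP'⟩ := ne_zero_of_map_ne_zero hq hP
  have := isDomain_QAlg hq' hP'
  have : IsNoetherianRing (QAlg q P) :=
    IsLocalization.isNoetherianRing (denoms q P) _ inferInstance
  have hlat : HasLattices (QAlg.connRing q P) := hasLattices_of_isDedekindDomain rfl hq' hP'
  exact ⟨galLoc_of_hasLattices _ hlat M, galDiffLoc_of_hasLattices _ hlat M⟩

end FractionField

/-! ### Residue fields as base rings -/

section Spec

variable {O : Type u} [CommRing O]

theorem isDedekindDomain_quotient (v : Ideal O) [v.IsMaximal] : IsDedekindDomain (O ⧸ v) := by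
  let _ := Ideal.Quotient.field v
  infer_instance

theorem exists_id_mul_eq [Nontrivial O] (a : O) :
    ∃ b c : O, c ≠ 0 ∧ RingHom.id O c * a = RingHom.id O b :=
  ⟨a, 1, one_ne_zero, one_mul a⟩

/-- The residue field is itself a Dedekind domain with its own fraction field, so $\mathcal A_v$ is
treated by the general statement with the identity of $k_v$ in place of $\mathcal O_K\to K$. -/
theorem specDiffGalLoc_and_specDiffGalDiffLoc (q : O) (P : O[X]) (v : Ideal O) [v.IsMaximal]
    (hq : Ideal.Quotient.mk v q ≠ 0) (hP : P.map (Ideal.Quotient.mk v) ≠ 0)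
    (M : Obj (QAlg.diffRing q P)) :
    SpecDiffGalLoc.{u, w} q P v hq hP M ∧ SpecDiffGalDiffLoc.{u, w} q P v hq hP M := by
  have := isDedekindDomain_quotient v
  exact diffGalLoc_and_diffGalDiffLoc Function.injective_id exists_id_mul_eq _ _ _ _ _

theorem specConnGalLoc_and_specConnGalDiffLoc (q : O) (P : O[X]) (v : Ideal O) [v.IsMaximal]
    (hq : Ideal.Quotient.mk v q ≠ 0) (hP : P.map (Ideal.Quotient.mk v) ≠ 0)
    (M : Obj (QAlg.connRing q P)) :
    SpecConnGalLoc.{u, w} q P v hq hP M ∧ SpecConnGalDiffLoc.{u, w} q P v hq hP M := by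
  have := isDedekindDomain_quotient v
  exact connGalLoc_and_connGalDiffLoc Function.injective_id exists_id_mul_eq _ _ _ _ _

end Spec

theorem exists_algebraMap_mul_eq (k : Type v) (K : Type u) [Field k] [Field K] [Algebra k[X] K]
    [Algebra (RatFunc k) K] [IsScalarTower k[X] (RatFunc k) K] [FunctionField k K] (a : K) :
    ∃ b c : OK k K, c ≠ 0 ∧ algebraMap (OK k K) K c * a = algebraMap (OK k K) K b := by
  obtain ⟨⟨b, c⟩, h⟩ := IsLocalization.surj (nonZeroDivisors (OK k K)) a
  exact ⟨b, c, nonZeroDivisors.ne_zero c.2, by rw [mul_comm]; exact h⟩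

end

end QDiff

theorem mainTheorem10 {k : Type v} {K : Type u} [Field k] [Field K] [Algebra k[X] K]
    [Algebra (RatFunc k) K] [IsScalarTower k[X] (RatFunc k) K] [FunctionField k K]
    (P : (QDiff.OK k K)[X]) (hP : P ≠ 0) :
    -- `q`-difference modules `(M, Σ)` over `A = O_K[x, 1/P(x), 1/P(qx), …]`
    (∀ (M : Type u) [AddCommGroup M] [Module (QDiff.QAlg (QDiff.qOK k K) P) M]
      [Module.Finite (QDiff.QAlg (QDiff.qOK k K) P) M]
      [Module.Projective (QDiff.QAlg (QDiff.qOK k K) P) M]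
      (S : M →ₛₗ[QDiff.QAlg.sig (QDiff.qOK k K) P] M)
      (hS : Submodule.span (QDiff.QAlg (QDiff.qOK k K) P) (Set.range S) = ⊤),
      QDiff.DiffGalLoc.{u, w} (algebraMap (QDiff.OK k K) K) (QDiff.qOK k K) P
        (QDiff.qOK_ne_zero k K) (QDiff.map_ne_zero_of_ne_zero k K hP)
        (QDiff.QAlg.ofSemilinear (QDiff.qOK k K) P M S hS) ∧
      QDiff.DiffGalDiffLoc.{u, w} (algebraMap (QDiff.OK k K) K) (QDiff.qOK k K) P
        (QDiff.qOK_ne_zero k K) (QDiff.map_ne_zero_of_ne_zero k K hP)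
        (QDiff.QAlg.ofSemilinear (QDiff.qOK k K) P M S hS) ∧
      ∀ (v : Ideal (QDiff.OK k K)) [v.IsMaximal]
        (hq : Ideal.Quotient.mk v (QDiff.qOK k K) ≠ 0)
        (_ : Ideal.Quotient.mk v (QDiff.qOK k K) ≠ 1)
        (hPv : P.map (Ideal.Quotient.mk v) ≠ 0),
        QDiff.SpecDiffGalLoc.{u, w} (QDiff.qOK k K) P v hq hPv
          (QDiff.QAlg.ofSemilinear (QDiff.qOK k K) P M S hS) ∧
        QDiff.SpecDiffGalDiffLoc.{u, w} (QDiff.qOK k K) P v hq hPv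
          (QDiff.QAlg.ofSemilinear (QDiff.qOK k K) P M S hS)) ∧
    -- modules with connection `(M, Δ_q)` over `(A, δ_q)`; here `v` may be a place with `q_v = 1`
    (∀ M : QDiff.Obj (QDiff.QAlg.connRing (QDiff.qOK k K) P),
      QDiff.ConnGalLoc.{u, w} (algebraMap (QDiff.OK k K) K) (QDiff.qOK k K) P
        (QDiff.qOK_ne_zero k K) (QDiff.map_ne_zero_of_ne_zero k K hP) M ∧
      QDiff.ConnGalDiffLoc.{u, w} (algebraMap (QDiff.OK k K) K) (QDiff.qOK k K) P
        (QDiff.qOK_ne_zero k K) (QDiff.map_ne_zero_of_ne_zero k K hP) M ∧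
      ∀ (v : Ideal (QDiff.OK k K)) [v.IsMaximal]
        (hq : Ideal.Quotient.mk v (QDiff.qOK k K) ≠ 0)
        (hPv : P.map (Ideal.Quotient.mk v) ≠ 0),
        QDiff.SpecConnGalLoc.{u, w} (QDiff.qOK k K) P v hq hPv M ∧
        QDiff.SpecConnGalDiffLoc.{u, w} (QDiff.qOK k K) P v hq hPv M) := by
  have := QDiff.isDedekindDomain_OK k K
  have hinj : Function.Injective (algebraMap (QDiff.OK k K) K) := Subtype.val_injective
  have hfrac := QDiff.exists_algebraMap_mul_eq k K
  refine ⟨fun M _ _ _ _ S hS => ?_, fun M => ?_⟩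
  · have h := QDiff.diffGalLoc_and_diffGalDiffLoc.{u, w} hinj hfrac (QDiff.qOK k K) P
      (QDiff.qOK_ne_zero k K) (QDiff.map_ne_zero_of_ne_zero k K hP)
      (QDiff.QAlg.ofSemilinear (QDiff.qOK k K) P M S hS)
    exact ⟨h.1, h.2, fun v _ hq _ hPv =>
      QDiff.specDiffGalLoc_and_specDiffGalDiffLoc.{u, w} _ P v hq hPv _⟩
  · have h := QDiff.connGalLoc_and_connGalDiffLoc.{u, w} hinj hfrac (QDiff.qOK k K) P
      (QDiff.qOK_ne_zero k K) (QDiff.map_ne_zero_of_ne_zero k K hP) M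
    exact ⟨h.1, h.2, fun v _ hq hPv =>
      QDiff.specConnGalLoc_and_specConnGalDiffLoc.{u, w} _ P v hq hPv M⟩
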